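/- Let $(M,g)$ be a smooth four-dimensional Lorentzian manifold of signature $(-,+,+,+)$, $u$ a smooth geodesic unit time-like vector field on $M$ and $\varrho\ge 0$ a smooth function such that the dust Einstein equation $\mathrm{Ric}_{ij}-\tfrac12 \mathrm R\,g_{ij}=\varrho\,u_iu_j-\Lambda g_{ij}$ holds, with $\Lambda\in\mathbb R$ constant ($8\pi G=c=1$). Let $\Sigma_0$ be a three-dimensional hypersurface orthogonal to $u$, and suppose that the proper-time flow of $u$ starting on $\Sigma_0$ is defined for all $t$ in an open interval $I\ni 0$ and that $(t,x)\mapsto\Phi_t(x)$ is a smooth injective immersion of $I\times\Sigma_0$ into $M$; put $\Sigma_t=\Phi_t(\Sigma_0)$ (the flow-orthogonal foliation; the dust is then irrotational on it). Let $\mathcal D\subset\Sigma_0$ be a compact domain (compact with non-empty interior) and $\mathcal D_t=\Phi_t(\mathcal D)$. For a scalar $\psi$ let $\langle\psi\rangle(t)=\int_{\mathcal D_t}\psi\,\eta\big/\int_{\mathcal D_t}\eta$, where $\eta$ is the volume element of the metric $h$ induced on $\Sigma_t$, and let an overdot denote $\partial_t$ along the flow lines (at fixed comoving coordinates). Let $\Theta_{ij}=u_{i;j}$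 be the expansion tensor on the leaves, $\Theta=\Theta^i{}_i$, let $\mathcal R^i{}_j$ and $\mathcal R$ be the Ricci tensor and Ricci scalar of $(\Sigma_t,h)$, and put $$\sigma^i{}_j=\Theta^i{}_j-\tfrac13\delta^i{}_j\Theta,\quad \tau^i{}_j=\mathcal R^i{}_j-\tfrac13\delta^i{}_j\mathcal R,\quad \sigma^2=\tfrac12\sigma^i{}_j\sigma^j{}_i,\quad \tau^2=\tfrac12\tau^i{}_j\tau^j{}_i,$$ $$\nu=2\tau^i{}_j\sigma^j{}_i,\quad \kappa=2\dot\tau^i{}_j\sigma^j{}_i,\quad \mu=-\tfrac13(\Theta-\langle\Theta\rangle)\mathcal R,\quad H_{\mathcal D}=\tfrac13\langle\Theta\rangle,$$ $$\mathcal Q_{\mathcal D}=\tfrac23\left(\langle\Theta^2\rangle-\langle\Theta\rangle^2\right)-2\langle\sigma^2\rangle,\qquad \mathcal Q^{\mathcal R}_{\mathcal D}=\tfrac13\left(\langle\mathcal R^2\rangle-\langle\mathcal R\rangle^2\right)-4\langle\tau^2\rangle,$$ $$\varrho_{\rm eff}=\langle\varrho\rangle-\tfrac12\mathcal Q_{\mathcal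 D}-\tfrac12\langle\mathcal R\rangle,\qquad p_{\rm eff}=-\tfrac12\mathcal Q_{\mathcal D}+\tfrac16\langle\mathcal R\rangle .$$ Then all these averages exist and $\mathcal D_t$ has finite positive volume for $t\in I$; on $I$ the functions $\mathcal Q_{\mathcal D}$, $\langle\mathcal R\rangle$, $H_{\mathcal D}$ are $C^2$ and $\langle\nu\rangle$, $\langle\mu\rangle$, $\varrho_{\rm eff}$ are $C^1$; and for all $t\in I$, writing $\dot{\langle\psi\rangle}$ for the time derivative of $\langle\psi\rangle$, $$\ddot{\mathcal Q}_{\mathcal D}+6H_{\mathcal D}\dot{\mathcal Q}_{\mathcal D}+6\dot H_{\mathcal D}\mathcal Q_{\mathcal D}=-\left(\ddot{\langle\mathcal R\rangle}+2H_{\mathcal D}\dot{\langle\mathcal R\rangle}+2\dot H_{\mathcal D}\langle\mathcal R\rangle\right)=\dot{\langle\nu\rangle}+\dot{\langle\mu\rangle}$$ $$=-3H_{\mathcal D}\langle\nu\rangle+\tfrac13\left(\langle\nu\Theta\rangle-\langle\nu\rangle\langle\Theta\rangle\right)-8H_{\mathcal D}\langle\mu\rangle-\tfrac23\left(\langle\mu\Theta\rangle-\langle\mu\rangle\langle\Theta\rangle\right)+\mathcal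 Q^{\mathcal R}_{\mathcal D}-\tfrac12\left(\langle\varrho\mathcal R\rangle-\langle\varrho\rangle\langle\mathcal R\rangle\right)+\langle\kappa\rangle,$$ coupled to the effective Friedmann equations $$3H_{\mathcal D}^2=\varrho_{\rm eff}+\Lambda,\qquad 3\dot H_{\mathcal D}=-\tfrac32\left(\varrho_{\rm eff}+p_{\rm eff}\right),\qquad \dot\varrho_{\rm eff}+3H_{\mathcal D}\left(\varrho_{\rm eff}+p_{\rm eff}\right)=0 .$$ -/

import Mathlib

open Set MeasureTheory
open scoped Manifold ContDiff Matrix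

noncomputable section

namespace DustCosmology

/-! ### Tensor calculus in coordinates -/

/-- Coordinate space `ℝⁿ`. -/
abbrev Coord (n : ℕ) : Type := EuclideanSpace ℝ (Fin n)

/-- The `i`-th coordinate basis vector of `ℝⁿ`. -/
def basisVec {n : ℕ} (i : Fin n) : Coord n := EuclideanSpace.single i (1 : ℝ)

/-- The partial derivative `∂ᵢ f (x)`. -/
def pderiv {n : ℕ} (i : Fin n) (f : Coord n → ℝ) (x : Coord n) : ℝ :=
  fderiv ℝ f x (basisVec i)

/-- The Christoffel symbol `Γᵏᵢⱼ` of a metric with components `G`. -/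
def christoffel {n : ℕ} (G : Coord n → Matrix (Fin n) (Fin n) ℝ) (k i j : Fin n)
    (x : Coord n) : ℝ :=
  (1 / 2) * ∑ l, (G x)⁻¹ k l *
    (pderiv i (fun y => G y l j) x + pderiv j (fun y => G y l i) x
      - pderiv l (fun y => G y i j) x)

/-- The Ricci tensor `Rᵢⱼ = ∂ₖΓᵏᵢⱼ - ∂ⱼΓᵏᵢₖ + ΓᵏₖₗΓˡᵢⱼ - ΓᵏⱼₗΓˡᵢₖ`
(positive on round spheres). -/
def ricci {n : ℕ} (G : Coord n → Matrix (Fin n) (Fin n) ℝ) (x : Coord n) :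
    Matrix (Fin n) (Fin n) ℝ :=
  Matrix.of fun i j =>
    ∑ k, (pderiv k (christoffel G k i j) x - pderiv j (christoffel G k i k) x)
    + ∑ k, ∑ l, (christoffel G k k l x * christoffel G l i j x
        - christoffel G k j l x * christoffel G l i k x)

/-- The Ricci tensor with mixed components `Rⁱⱼ`. -/
def ricciMixed {n : ℕ} (G : Coord n → Matrix (Fin n) (Fin n) ℝ) (x : Coord n) :
    Matrix (Fin n) (Fin n) ℝ :=
  (G x)⁻¹ * ricci G x

/-- The Ricci scalar. -/
def scalarCurv {n : ℕ} (G : Coord n → Matrix (Fin n) (Fin n) ℝ) (x : Coord n) : ℝ :=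
  (ricciMixed G x).trace

/-- The covariant derivative `w_{i;j} = ∂ⱼwᵢ - Γᵏᵢⱼ wₖ` of a one-form with components `w`. -/
def covDerivForm {n : ℕ} (G : Coord n → Matrix (Fin n) (Fin n) ℝ) (w : Coord n → Fin n → ℝ)
    (x : Coord n) : Matrix (Fin n) (Fin n) ℝ :=
  Matrix.of fun i j =>
    pderiv j (fun y => w y i) x - ∑ k, christoffel G k i j x * w x k

/-- The covariant acceleration `(∇_U U)ᵏ = Uʲ∂ⱼUᵏ + Γᵏᵢⱼ Uⁱ Uʲ` of a vector field with
components `U`. -/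
def covAccel {n : ℕ} (G : Coord n → Matrix (Fin n) (Fin n) ℝ) (U : Coord n → Fin n → ℝ)
    (x : Coord n) (k : Fin n) : ℝ :=
  ∑ j, U x j * pderiv j (fun y => U y k) x
    + ∑ i, ∑ j, christoffel G k i j x * U x i * U x j

/-- The trace-free part `A - (1/3)(tr A) 1` of a mixed tensor on a three-dimensional space. -/
def traceFree (A : Matrix (Fin 3) (Fin 3) ℝ) : Matrix (Fin 3) (Fin 3) ℝ :=
  A - ((1 / 3) * A.trace) • (1 : Matrix (Fin 3) (Fin 3) ℝ)

/-! ### Lorentzian metrics -/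

/-- A smooth Lorentzian metric of signature `(-,+,+,+)` on a four-dimensional manifold. -/
structure LorentzMetric (M : Type*) [TopologicalSpace M] [ChartedSpace (Coord 4) M]
    [IsManifold (𝓡 4) ∞ M] where
  val : ∀ p : M, TangentSpace (𝓡 4) p →L[ℝ] TangentSpace (𝓡 4) p →L[ℝ] ℝ
  symm : ∀ p v w, val p v w = val p w v
  lorentzian : ∀ p, ∃ v, val p v v < 0 ∧ ∀ w, w ≠ 0 → val p v w = 0 → 0 < val p w w
  contMDiff : ContMDiff (𝓡 4) ((𝓡 4).prod 𝓘(ℝ, Coord 4 →L[ℝ] Coord 4 →L[ℝ] ℝ)) ∞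
    (fun p => Bundle.TotalSpace.mk' (Coord 4 →L[ℝ] Coord 4 →L[ℝ] ℝ)
      (E := fun p : M => TangentSpace (𝓡 4) p →L[ℝ] TangentSpace (𝓡 4) p →L[ℝ] ℝ) p (val p))

section Components

variable {M : Type*} [TopologicalSpace M] [ChartedSpace (Coord 4) M] [IsManifold (𝓡 4) ∞ M]

/-- The components `g(∂ᵢφ, ∂ⱼφ)` of the pull-back of `g` by a map `φ : ℝⁿ → M`; for `φ` the inverse
of a chart of `M` these are the components of `g` in that chart, for `φ` a parametrization of a
submanifold those of the induced metric. -/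
def LorentzMetric.components (g : LorentzMetric M) {n : ℕ} (φ : Coord n → M) (x : Coord n) :
    Matrix (Fin n) (Fin n) ℝ :=
  Matrix.of fun i j =>
    g.val (φ x) (mfderiv (𝓡 n) (𝓡 4) φ x (basisVec i)) (mfderiv (𝓡 n) (𝓡 4) φ x (basisVec j))

/-- The components `uⁱ` of a vector field in a chart. -/
def vecComponents (e : OpenPartialHomeomorph M (Coord 4)) (u : ∀ p : M, TangentSpace (𝓡 4) p)
    (x : Coord 4) (i : Fin 4) : ℝ :=
  (show Coord 4 from mfderiv (𝓡 4) (𝓡 4) e (e.symm x) (u (e.symm x))) i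

/-- The components `uᵢ = g(u, ∂ᵢ)` in a chart of the one-form that is metric-dual to `u`. -/
def LorentzMetric.formComponents (g : LorentzMetric M) (e : OpenPartialHomeomorph M (Coord 4))
    (u : ∀ p : M, TangentSpace (𝓡 4) p) (x : Coord 4) (i : Fin 4) : ℝ :=
  g.val (e.symm x) (u (e.symm x)) (mfderiv (𝓡 4) (𝓡 4) e.symm x (basisVec i))

end Components

/-! ### Volume measures -/

section Volume

variable {S : Type*} [TopologicalSpace S] [ChartedSpace (Coord 3) S]

theorem exists_countable_chart_cover [SecondCountableTopology S] [Nonempty S] :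
    ∃ c : ℕ → S, ⋃ n, (chartAt (Coord 3) (c n)).source = univ := by
  obtain ⟨s, hs, hcov⟩ := TopologicalSpace.countable_cover_nhds
    (f := fun x : S => (chartAt (Coord 3) x).source) (fun x => chart_source_mem_nhds _ x)
  have hne : s.Nonempty := by
    by_contra h
    rw [not_nonempty_iff_eq_empty] at h
    obtain ⟨x⟩ := ‹Nonempty S›
    have hx : x ∈ ⋃ y ∈ s, (chartAt (Coord 3) y).source := hcov ▸ mem_univ x
    simp [h] at hx
  obtain ⟨c, rfl⟩ := hs.exists_eq_range hne
  exact ⟨c, by simpa using hcov⟩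

variable (S) in
/-- Centres of a countable family of charts that covers `S`. -/
def chartCentre [SecondCountableTopology S] [Nonempty S] : ℕ → S :=
  Classical.choose (exists_countable_chart_cover (S := S))

variable (S) in
/-- A partition of `S` into countably many Borel sets, each of them inside one chart. -/
def chartPiece [SecondCountableTopology S] [Nonempty S] : ℕ → Set S :=
  disjointed fun n => (chartAt (Coord 3) (chartCentre S n)).source

/-- The Riemannian volume measure on `S` of a metric whose components in a chart `e` are `h e`:
in each chart it is `√(det h) dx¹dx²dx³`. (By the change of variables formula it does not depend on
the countable family of charts that is used to assemble it.) -/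
def riemannianVolume [SecondCountableTopology S] [Nonempty S] [MeasurableSpace S]
    (h : OpenPartialHomeomorph S (Coord 3) → Coord 3 → Matrix (Fin 3) (Fin 3) ℝ) : Measure S :=
  Measure.sum fun n =>
    let e := chartAt (Coord 3) (chartCentre S n)
    Measure.map e.symm
      ((volume.restrict (e.target ∩ e.symm ⁻¹' chartPiece S n)).withDensity
        fun y => ENNReal.ofReal (Real.sqrt (h e y).det))

end Volume

/-! ### Irrotational dust in a flow-orthogonal foliation -/

/-- A four-dimensional spacetime `M` filled with dust of density `ϱ` and four-velocity `u` that
solves the Einstein equation with cosmological constant `Λ` (units `8πG = c = 1`), together with its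
foliation by the leaves `Σ_t = Φ_t(S)`, `t ∈ I`, obtained from an initial three-dimensional leaf
`Σ_0 = Φ_0(S)` orthogonal to `u` by the proper-time flow of `u`. -/
structure DustSpacetime (M : Type*) [TopologicalSpace M] [ChartedSpace (Coord 4) M]
    [IsManifold (𝓡 4) ∞ M] (S : Type*) [TopologicalSpace S] [ChartedSpace (Coord 3) S]
    [IsManifold (𝓡 3) ∞ S] where
  /-- the spacetime metric -/
  g : LorentzMetric M
  /-- the four-velocity -/
  u : ∀ p : M, TangentSpace (𝓡 4) p
  /-- the rest mass density -/
  density : M → ℝ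
  /-- the cosmological constant -/
  Λ : ℝ
  contMDiff_u : ContMDiff (𝓡 4) (𝓡 4).tangent ∞
    (fun p => (⟨p, u p⟩ : TangentBundle (𝓡 4) M))
  contMDiff_density : ContMDiff (𝓡 4) 𝓘(ℝ, ℝ) ∞ density
  density_nonneg : ∀ p, 0 ≤ density p
  unit : ∀ p, g.val p (u p) (u p) = -1
  geodesic : ∀ e ∈ IsManifold.maximalAtlas (𝓡 4) ∞ M, ∀ x ∈ e.target, ∀ k,
    covAccel (g.components e.symm) (vecComponents e u) x k = 0
  /-- `Rᵢⱼ - (R/2) gᵢⱼ = ϱ uᵢuⱼ - Λ gᵢⱼ` in all charts -/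
  einstein : ∀ e ∈ IsManifold.maximalAtlas (𝓡 4) ∞ M, ∀ x ∈ e.target, ∀ i j,
    ricci (g.components e.symm) x i j
        - scalarCurv (g.components e.symm) x / 2 * g.components e.symm x i j
      = density (e.symm x) * g.formComponents e u x i * g.formComponents e u x j
        - Λ * g.components e.symm x i j
  /-- the interval of proper time -/
  I : Set ℝ
  isOpen_I : IsOpen I
  ordConnected_I : I.OrdConnected
  zero_mem_I : (0 : ℝ) ∈ I
  /-- the flow of `u`, starting from the initial leaf -/
  Φ : ℝ → S → M
  contMDiffOn_Φ : ContMDiffOn (𝓘(ℝ, ℝ).prod (𝓡 3)) (𝓡 4) ∞ (fun q : ℝ × S => Φ q.1 q.2)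
    (I ×ˢ univ)
  isMIntegralCurveOn_Φ : ∀ x, IsMIntegralCurveOn (I := 𝓡 4) (fun t => Φ t x) u I
  /-- proper time and the points of the initial leaf parametrize the tube of flow lines -/
  injOn_Φ : InjOn (fun q : ℝ × S => Φ q.1 q.2) (I ×ˢ univ)
  immersion_Φ : ∀ t ∈ I, ∀ x, Function.Injective
    (mfderiv (𝓘(ℝ, ℝ).prod (𝓡 3)) (𝓡 4) (fun q : ℝ × S => Φ q.1 q.2) (t, x))
  /-- the initial leaf is orthogonal to the four-velocity -/
  orthogonal : ∀ x (v : TangentSpace (𝓡 3) x),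
    g.val (Φ 0 x) (u (Φ 0 x)) (mfderiv (𝓡 3) (𝓡 4) (Φ 0) x v) = 0

namespace DustSpacetime

variable {M : Type*} [TopologicalSpace M] [ChartedSpace (Coord 4) M] [IsManifold (𝓡 4) ∞ M]
  {S : Type*} [TopologicalSpace S] [ChartedSpace (Coord 3) S] [IsManifold (𝓡 3) ∞ S]
  (W : DustSpacetime M S)

/-! #### Tensors on the leaves

All tensors on the leaf `Σ_t` are transported to `S` by `Φ_t`, and expressed in a chart `e` of `S`,
so that `∂_t` is taken along the flow lines. -/

/-- The components `hᵢⱼ` of the metric induced on the leaf `Σ_t`. -/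
def leafMetric (e : OpenPartialHomeomorph S (Coord 3)) (t : ℝ) (y : Coord 3) :
    Matrix (Fin 3) (Fin 3) ℝ :=
  W.g.components (fun z => W.Φ t (e.symm z)) y

/-- The components `Θᵢⱼ = u_{μ;ν} ∂ᵢΦ^μ ∂ⱼΦ^ν` of the expansion tensor on the leaf `Σ_t`. -/
def expansionLow (e : OpenPartialHomeomorph S (Coord 3)) (t : ℝ) (y : Coord 3) :
    Matrix (Fin 3) (Fin 3) ℝ :=
  let e' := chartAt (Coord 4) (W.Φ t (e.symm y))
  let J : Matrix (Fin 4) (Fin 3) ℝ :=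
    Matrix.of fun μ i => pderiv i (fun z => e' (W.Φ t (e.symm z)) μ) y
  Jᵀ * covDerivForm (W.g.components e'.symm) (W.g.formComponents e' W.u)
    (e' (W.Φ t (e.symm y))) * J

/-- The mixed components `Θⁱⱼ`. -/
def expansion (e : OpenPartialHomeomorph S (Coord 3)) (t : ℝ) (y : Coord 3) :
    Matrix (Fin 3) (Fin 3) ℝ :=
  (W.leafMetric e t y)⁻¹ * W.expansionLow e t y

/-- The shear `σⁱⱼ = Θⁱⱼ - (1/3) δⁱⱼ Θ`. -/
def shear (e : OpenPartialHomeomorph S (Coord 3)) (t : ℝ) (y : Coord 3) :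
    Matrix (Fin 3) (Fin 3) ℝ :=
  traceFree (W.expansion e t y)

/-- The trace-free part `τⁱⱼ = ℛⁱⱼ - (1/3) δⁱⱼ ℛ` of the Ricci tensor of the leaf. -/
def curvAniso (e : OpenPartialHomeomorph S (Coord 3)) (t : ℝ) (y : Coord 3) :
    Matrix (Fin 3) (Fin 3) ℝ :=
  traceFree (ricciMixed (W.leafMetric e t) y)

/-- The time derivative `∂_t τⁱⱼ`. -/
def curvAnisoDot (e : OpenPartialHomeomorph S (Coord 3)) (t : ℝ) (y : Coord 3) :
    Matrix (Fin 3) (Fin 3) ℝ :=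
  Matrix.of fun i j => deriv (fun s => W.curvAniso e s y i j) t

/-! #### Scalars on the leaves, as functions of `t` and of the point `x` of `S` -/

/-- The density `ϱ`. -/
def rho (t : ℝ) (x : S) : ℝ := W.density (W.Φ t x)

/-- The rate of expansion `Θ = Θⁱᵢ`. -/
def theta (t : ℝ) (x : S) : ℝ :=
  (W.expansion (chartAt (Coord 3) x) t (chartAt (Coord 3) x x)).trace

/-- The scalar curvature `ℛ` of the leaf. -/
def scalR (t : ℝ) (x : S) : ℝ :=
  scalarCurv (W.leafMetric (chartAt (Coord 3) x) t) (chartAt (Coord 3) x x)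

/-- `σ² = (1/2) σⁱⱼ σʲᵢ`. -/
def sigmaSq (t : ℝ) (x : S) : ℝ :=
  let e := chartAt (Coord 3) x
  (1 / 2) * (W.shear e t (e x) * W.shear e t (e x)).trace

/-- `τ² = (1/2) τⁱⱼ τʲᵢ`. -/
def tauSq (t : ℝ) (x : S) : ℝ :=
  let e := chartAt (Coord 3) x
  (1 / 2) * (W.curvAniso e t (e x) * W.curvAniso e t (e x)).trace

/-- `ν = 2 τⁱⱼ σʲᵢ`. -/
def nu (t : ℝ) (x : S) : ℝ :=
  let e := chartAt (Coord 3) x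
  2 * (W.curvAniso e t (e x) * W.shear e t (e x)).trace

/-- `κ = 2 (∂_t τⁱⱼ) σʲᵢ`. -/
def kappa (t : ℝ) (x : S) : ℝ :=
  let e := chartAt (Coord 3) x
  2 * (W.curvAnisoDot e t (e x) * W.shear e t (e x)).trace

/-! #### Averages -/

variable [SecondCountableTopology S] [Nonempty S] [MeasurableSpace S]

/-- The volume measure of the leaf `Σ_t`, transported to `S` by `Φ_t`. -/
def leafVolume (t : ℝ) : Measure S := riemannianVolume fun e => W.leafMetric e t

/-- The volume average `⟨ψ⟩ (t)` over the domain `Φ_t(D)`. -/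
def avg (D : Set S) (ψ : ℝ → S → ℝ) (t : ℝ) : ℝ := ⨍ x in D, ψ t x ∂(W.leafVolume t)

/-- The covariance `⟨ψχ⟩ - ⟨ψ⟩⟨χ⟩`. -/
def cov (D : Set S) (ψ χ : ℝ → S → ℝ) (t : ℝ) : ℝ :=
  W.avg D (fun s x => ψ s x * χ s x) t - W.avg D ψ t * W.avg D χ t

/-- `μ = -(1/3) (Θ - ⟨Θ⟩) ℛ`. -/
def mu (D : Set S) (t : ℝ) (x : S) : ℝ :=
  -(1 / 3) * (W.theta t x - W.avg D W.theta t) * W.scalR t x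

/-- The volume Hubble rate `H_D = (1/3) ⟨Θ⟩`. -/
def hubble (D : Set S) (t : ℝ) : ℝ := (1 / 3) * W.avg D W.theta t

/-- The kinematical backreaction `Q_D = (2/3) (⟨Θ²⟩ - ⟨Θ⟩²) - 2⟨σ²⟩`. -/
def backreaction (D : Set S) (t : ℝ) : ℝ :=
  (2 / 3) * (W.avg D (fun s x => W.theta s x ^ 2) t - W.avg D W.theta t ^ 2)
    - 2 * W.avg D W.sigmaSq t

/-- The curvature backreaction `Q^ℛ_D = (1/3) (⟨ℛ²⟩ - ⟨ℛ⟩²) - 4⟨τ²⟩`. -/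
def curvBackreaction (D : Set S) (t : ℝ) : ℝ :=
  (1 / 3) * (W.avg D (fun s x => W.scalR s x ^ 2) t - W.avg D W.scalR t ^ 2)
    - 4 * W.avg D W.tauSq t

/-- The effective density. -/
def rhoEff (D : Set S) (t : ℝ) : ℝ :=
  W.avg D W.rho t - (1 / 2) * W.backreaction D t - (1 / 2) * W.avg D W.scalR t

/-- The effective pressure. -/
def pEff (D : Set S) (t : ℝ) : ℝ :=
  -(1 / 2) * W.backreaction D t + (1 / 6) * W.avg D W.scalR t

end DustSpacetime

end DustCosmology

end

/-! The whole argument takes place in comoving coordinates `(t, y)`, with `t` the proper time along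
the flow and `y` a chart of the initial leaf. There the metric is synchronous, `-dt² + hᵢⱼ dyⁱdyʲ`:
`g₀₀ = -1` because `u` is a unit field, the geodesic equation makes `g₀ᵢ` constant in time, and
orthogonality of the initial leaf makes that constant zero (`adaptedMetric_eq_syncMetric`). In these
coordinates `Θᵢⱼ = ½ ∂ₜhᵢⱼ` (`expansionLow_eq`), and the Einstein equation splits into the
Raychaudhuri equation, the momentum and Hamiltonian constraints, and the evolution equation `∂ₜΘⁱⱼ =
(ϱ/2 + Λ)δⁱⱼ - ΘΘⁱⱼ - ℛⁱⱼ` (`SyncEinstein.evolution`).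

From these come ordinary differential equations along each flow line for `Θ`, `ℛ`, `σ²`, `ν` and
`ϱ`. The delicate one is `∂ₜℛ = -2 ℛⁱⱼΘʲᵢ`. By the Palatini identity `hⁱʲ∂ₜℛᵢⱼ` is the divergence of
a vector field built from `∂ₜΓ`, and the momentum constraint says precisely that this vector
vanishes (`contracted_pderiv_zero_spatialRicci`), so that only the derivative of `hⁱʲ` is left.
Conservation of dust, `∂ₜϱ = -ϱΘ`, is then read off from the time derivative of the Hamiltonian
constraint, with no appeal to the Bianchi identity.

The volume element of `Σ_t` is that of `Σ_0` times a factor `J` with `∂ₜJ = ΘJ`. Every average is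
therefore a quotient of integrals against one fixed measure over a compact set, and differentiation
under the integral gives the commutation rule `⟨ψ⟩˙ = ⟨ψ˙⟩ + ⟨ψΘ⟩ - ⟨ψ⟩⟨Θ⟩` (`hasDerivAt_avg`).

Averaging the Hamiltonian constraint expresses `Q` through `⟨ϱ⟩`, `⟨ℛ⟩` and `⟨Θ⟩`
(`backreaction_eq`); this is the first Friedmann equation. Since `⟨μ⟩` is `-⅓` times the covariance
of `ℛ` and `Θ`, the commutation rule yields the first-order laws `⟨ℛ⟩˙ + 2H⟨ℛ⟩ = -(⟨ν⟩ + ⟨μ⟩)` and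
`Q˙ + 6HQ = ⟨ν⟩ + ⟨μ⟩`. One further derivative gives both second-order left-hand sides, and the
rates of `⟨ν⟩` and `⟨μ⟩`, computed from the pointwise equations, give the right-hand side. -/

noncomputable section

namespace DustCosmology

/-! ### Calculus of partial derivatives -/

section PartialDerivatives

variable {n : ℕ} {f g : Coord n → ℝ} {x : Coord n}

theorem pderiv_congr (i : Fin n) (h : f =ᶠ[nhds x] g) : pderiv i f x = pderiv i g x := by
  simp only [pderiv, h.fderiv_eq]

theorem pderiv_const (i : Fin n) (c : ℝ) : pderiv i (fun _ => c) x = 0 := by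
  simp [pderiv]

theorem pderiv_add (i : Fin n) (hf : DifferentiableAt ℝ f x) (hg : DifferentiableAt ℝ g x) :
    pderiv i (fun y => f y + g y) x = pderiv i f x + pderiv i g x := by
  simp [pderiv, fderiv_fun_add hf hg]

theorem pderiv_sub (i : Fin n) (hf : DifferentiableAt ℝ f x) (hg : DifferentiableAt ℝ g x) :
    pderiv i (fun y => f y - g y) x = pderiv i f x - pderiv i g x := by
  simp [pderiv, fderiv_fun_sub hf hg]

theorem pderiv_mul (i : Fin n) (hf : DifferentiableAt ℝ f x) (hg : DifferentiableAt ℝ g x) :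
    pderiv i (fun y => f y * g y) x = pderiv i f x * g x + f x * pderiv i g x := by
  simp [pderiv, fderiv_fun_mul hf hg]; ring

theorem pderiv_const_mul (i : Fin n) (c : ℝ) (hf : DifferentiableAt ℝ f x) :
    pderiv i (fun y => c * f y) x = c * pderiv i f x := by
  simp [pderiv, fderiv_const_mul hf c]

theorem pderiv_sum (i : Fin n) {ι : Type*} (s : Finset ι) {F : ι → Coord n → ℝ}
    (hF : ∀ a ∈ s, DifferentiableAt ℝ (F a) x) :
    pderiv i (fun y => ∑ a ∈ s, F a y) x = ∑ a ∈ s, pderiv i (F a) x := by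
  simp [pderiv, fderiv_fun_sum hF]

variable {Ω : Set (Coord n)}

theorem contDiffOn_pderiv (hΩ : IsOpen Ω) (hf : ContDiffOn ℝ ∞ f Ω) (i : Fin n) :
    ContDiffOn ℝ ∞ (pderiv i f) Ω :=
  (hf.fderiv_of_isOpen hΩ (m := ∞) le_rfl).clm_apply contDiffOn_const

theorem differentiableAt_of_contDiffOn (hΩ : IsOpen Ω) (hf : ContDiffOn ℝ ∞ f Ω) (hx : x ∈ Ω) :
    DifferentiableAt ℝ f x :=
  (hf.contDiffAt (hΩ.mem_nhds hx)).differentiableAt (by simp)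

theorem pderiv_comm (hΩ : IsOpen Ω) (hf : ContDiffOn ℝ ∞ f Ω) (hx : x ∈ Ω) (i j : Fin n) :
    pderiv i (pderiv j f) x = pderiv j (pderiv i f) x := by
  have hc := hf.contDiffAt (hΩ.mem_nhds hx)
  have hd : DifferentiableAt ℝ (fderiv ℝ f) x :=
    (hc.fderiv_right (m := 1) (by norm_cast)).differentiableAt (by simp)
  have key : ∀ a b : Fin n, pderiv a (pderiv b f) x
      = fderiv ℝ (fderiv ℝ f) x (basisVec a) (basisVec b) := by
    intro a b
    have h2 : HasFDerivAt (fun y => fderiv ℝ f y (basisVec b))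
        ((fderiv ℝ (fderiv ℝ f) x).flip (basisVec b)) x := by
      simpa using hd.hasFDerivAt.clm_apply (hasFDerivAt_const (basisVec b) x)
    show fderiv ℝ (fun y => fderiv ℝ f y (basisVec b)) x (basisVec a) = _
    rw [h2.fderiv]; rfl
  rw [key, key]
  exact (hc.isSymmSndFDerivAt (by simp only [minSmoothness_of_isRCLikeNormedField]; exact WithTop.coe_le_coe.2 (le_top : (2 : ℕ∞) ≤ ⊤))).eq _ _

/-- The entrywise partial derivative of a matrix-valued function. -/
def pderivMat {m : Type*} (i : Fin n) (A : Coord n → Matrix m m ℝ) (x : Coord n) : Matrix m m ℝ :=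
  Matrix.of fun a b => pderiv i (fun y => A y a b) x

/-- Smoothness of the entries of a matrix-valued function. -/
def SmoothMatOn {m : Type*} (A : Coord n → Matrix m m ℝ) (Ω : Set (Coord n)) : Prop :=
  ∀ a b, ContDiffOn ℝ ∞ (fun y => A y a b) Ω

variable {m : Type*} {A B : Coord n → Matrix m m ℝ}

theorem SmoothMatOn.differentiableAt (hΩ : IsOpen Ω) (hA : SmoothMatOn A Ω) (hx : x ∈ Ω) (a b : m) :
    DifferentiableAt ℝ (fun y => A y a b) x :=
  differentiableAt_of_contDiffOn hΩ (hA a b) hx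

theorem SmoothMatOn.pderivMat (hΩ : IsOpen Ω) (hA : SmoothMatOn A Ω) (i : Fin n) :
    SmoothMatOn (pderivMat i A) Ω := fun a b => contDiffOn_pderiv hΩ (hA a b) i

theorem SmoothMatOn.mul [Fintype m] (hA : SmoothMatOn A Ω) (hB : SmoothMatOn B Ω) :
    SmoothMatOn (fun y => A y * B y) Ω := by
  intro a b
  simp only [Matrix.mul_apply]
  exact ContDiffOn.sum fun c _ => (hA a c).mul (hB c b)

theorem SmoothMatOn.trace [Fintype m] (hA : SmoothMatOn A Ω) : ContDiffOn ℝ ∞ (fun y => (A y).trace) Ω := by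
  simp only [Matrix.trace, Matrix.diag]
  exact ContDiffOn.sum fun c _ => hA c c

theorem SmoothMatOn.det [Fintype m] [DecidableEq m] (hA : SmoothMatOn A Ω) :
    ContDiffOn ℝ ∞ (fun y => (A y).det) Ω := by
  simp only [Matrix.det_apply']
  exact ContDiffOn.sum fun c _ => contDiffOn_const.mul (contDiffOn_prod fun i _ => hA _ _)

theorem SmoothMatOn.inv [Fintype m] [DecidableEq m] (hA : SmoothMatOn A Ω) (h0 : ∀ y ∈ Ω, (A y).det ≠ 0) :
    SmoothMatOn (fun y => (A y)⁻¹) Ω := by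
  intro a b
  -- Cramer's rule: each entry of the inverse is a quotient of two determinants, both polynomial in
  -- the entries of `A`.
  have h1 : ∀ y, (A y)⁻¹ a b = ((A y).det)⁻¹ * ((A y).updateRow b (Pi.single a 1)).det := by
    intro y
    rw [Matrix.inv_def, Matrix.smul_apply, Matrix.adjugate_apply]
    simp
  simp only [h1]
  refine (hA.det.inv h0).mul (SmoothMatOn.det fun c d => ?_)
  by_cases hc : c = b
  · subst hc; simpa using contDiffOn_const
  · simpa [Matrix.updateRow_ne hc] using hA c d

theorem pderivMat_mul [Fintype m] (i : Fin n) (hA : ∀ a b, DifferentiableAt ℝ (fun y => A y a b) x)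
    (hB : ∀ a b, DifferentiableAt ℝ (fun y => B y a b) x) :
    pderivMat i (fun y => A y * B y) x = pderivMat i A x * B x + A x * pderivMat i B x := by
  ext a b
  simp only [pderivMat, Matrix.mul_apply, Matrix.of_apply, Matrix.add_apply]
  rw [pderiv_sum (F := fun c y => A y a c * B y c b) _ _ fun c _ => (hA a c).mul (hB c b), ← Finset.sum_add_distrib]
  exact Finset.sum_congr rfl fun c _ => pderiv_mul i (hA a c) (hB c b)

theorem pderiv_trace [Fintype m] (i : Fin n) (hA : ∀ a b, DifferentiableAt ℝ (fun y => A y a b) x) :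
    pderiv i (fun y => (A y).trace) x = (pderivMat i A x).trace := by
  simp only [Matrix.trace, Matrix.diag]
  rw [pderiv_sum _ _ fun c _ => hA c c]; rfl

theorem pderivMat_congr (i : Fin n) (h : A =ᶠ[nhds x] B) : pderivMat i A x = pderivMat i B x := by
  ext a b
  exact pderiv_congr i (h.mono fun y hy => by simp only [hy])

/-- Differentiate `A⁻¹ A = 1` and solve for the derivative of `A⁻¹`. -/
theorem pderivMat_inv [Fintype m] [DecidableEq m] (hΩ : IsOpen Ω) (hA : SmoothMatOn A Ω)
    (h0 : ∀ y ∈ Ω, (A y).det ≠ 0) (hx : x ∈ Ω) (i : Fin n) :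
    pderivMat i (fun y => (A y)⁻¹) x = -((A x)⁻¹ * pderivMat i A x * (A x)⁻¹) := by
  have h1 := pderivMat_mul i ((hA.inv h0).differentiableAt hΩ hx) (hA.differentiableAt hΩ hx)
  have h2 : pderivMat i (fun y => (A y)⁻¹ * A y) x = 0 := by
    rw [pderivMat_congr (B := fun _ => 1) i ?_]
    · ext a b; simp [pderivMat, pderiv_const]
    · filter_upwards [hΩ.mem_nhds hx] with y hy
      exact Matrix.nonsing_inv_mul _ (isUnit_iff_ne_zero.2 (h0 y hy))
  rw [h2] at h1
  have h3 : pderivMat i (fun y => (A y)⁻¹) x * A x = -((A x)⁻¹ * pderivMat i A x) :=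
    eq_neg_of_add_eq_zero_left h1.symm
  have h4 := Matrix.mul_nonsing_inv (A x) (isUnit_iff_ne_zero.2 (h0 x hx))
  calc _ = pderivMat i (fun y => (A y)⁻¹) x * (A x * (A x)⁻¹) := by rw [h4, mul_one]
    _ = _ := by rw [← mul_assoc, h3, neg_mul]

end PartialDerivatives

/-! ### Synchronous coordinates -/

section Synchronous

/-- The point of `ℝ⁴` with time coordinate `t` and spatial coordinates `y`. -/
def joinCoord (t : ℝ) (y : Coord 3) : Coord 4 := WithLp.toLp 2 (Fin.cons t fun i => y i)

/-- The spatial coordinates of a point of `ℝ⁴`. -/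
def spatial (q : Coord 4) : Coord 3 := WithLp.toLp 2 fun i => q i.succ

@[simp] theorem joinCoord_zero (t : ℝ) (y : Coord 3) : joinCoord t y 0 = t := rfl
@[simp] theorem joinCoord_succ (t : ℝ) (y : Coord 3) (i : Fin 3) :
    joinCoord t y i.succ = y i := rfl
@[simp] theorem spatial_apply (q : Coord 4) (i : Fin 3) : spatial q i = q i.succ := rfl
@[simp] theorem spatial_joinCoord (t : ℝ) (y : Coord 3) : spatial (joinCoord t y) = y := rfl
@[simp] theorem joinCoord_spatial (q : Coord 4) : joinCoord (q 0) (spatial q) = q := by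
  ext i; refine Fin.cases ?_ (fun j => ?_) i <;> simp

theorem contDiff_spatial : ContDiff ℝ ∞ spatial := by
  rw [contDiff_euclidean]
  intro i; exact contDiff_piLp_apply (p := 2)

/-- The inclusion of the spatial coordinates. -/
def spatialIncl : Coord 3 →L[ℝ] Coord 4 :=
  LinearMap.toContinuousLinearMap
    { toFun := fun y => joinCoord 0 y
      map_add' := fun y z => by
        ext i; refine Fin.cases ?_ (fun j => ?_) i <;> simp
      map_smul' := fun c z => by
        ext i; refine Fin.cases ?_ (fun j => ?_) i <;> simp }

theorem spatialIncl_basisVec (i : Fin 3) : spatialIncl (basisVec i) = basisVec i.succ := by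
  ext k; refine Fin.cases ?_ (fun j => ?_) k
  · simp [spatialIncl, basisVec, Fin.succ_ne_zero]
  · simp [spatialIncl, basisVec]

theorem joinCoord_eq (t : ℝ) (y : Coord 3) :
    joinCoord t y = spatialIncl y + t • basisVec 0 := by
  ext k; refine Fin.cases ?_ (fun j => ?_) k
  · simp [spatialIncl, basisVec]
  · simp [spatialIncl, basisVec, Fin.succ_ne_zero]

theorem hasFDerivAt_joinCoord_right (t : ℝ) (y : Coord 3) :
    HasFDerivAt (fun z => joinCoord t z) spatialIncl y := by
  simp only [joinCoord_eq]
  exact (spatialIncl.hasFDerivAt).add_const _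

theorem hasDerivAt_joinCoord_left (t : ℝ) (y : Coord 3) :
    HasDerivAt (fun s => joinCoord s y) (basisVec 0) t := by
  simp only [joinCoord_eq]
  simpa using ((hasDerivAt_id t).smul_const (basisVec (0 : Fin 4))).const_add (spatialIncl y)

theorem pderiv_joinCoord {f : Coord 4 → ℝ} {t : ℝ} {y : Coord 3}
    (hf : DifferentiableAt ℝ f (joinCoord t y)) (i : Fin 3) :
    pderiv i (fun z => f (joinCoord t z)) y = pderiv i.succ f (joinCoord t y) := by
  have := hf.hasFDerivAt.comp y (hasFDerivAt_joinCoord_right t y)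
  simp only [pderiv, ← spatialIncl_basisVec]
  rw [show (fun z => f (joinCoord t z)) = f ∘ fun z => joinCoord t z from rfl, this.fderiv]
  rfl

theorem hasDerivAt_joinCoord {f : Coord 4 → ℝ} {t : ℝ} {y : Coord 3}
    (hf : DifferentiableAt ℝ f (joinCoord t y)) :
    HasDerivAt (fun s => f (joinCoord s y)) (pderiv 0 f (joinCoord t y)) t :=
  hf.hasFDerivAt.comp_hasDerivAt t (hasDerivAt_joinCoord_left t y)

/-- The block matrix with time-time entry `a` and spatial block `h`. -/
def blk (a : ℝ) (h : Matrix (Fin 3) (Fin 3) ℝ) : Matrix (Fin 4) (Fin 4) ℝ :=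
  Matrix.of (Fin.cons (Fin.cons a 0) fun i => Fin.cons 0 (h i))

section
variable (a : ℝ) (h : Matrix (Fin 3) (Fin 3) ℝ) (i j : Fin 3)
@[simp] theorem blk_zero_zero : blk a h 0 0 = a := rfl
@[simp] theorem blk_zero_succ : blk a h 0 i.succ = 0 := rfl
@[simp] theorem blk_succ_zero : blk a h i.succ 0 = 0 := rfl
@[simp] theorem blk_succ_succ : blk a h i.succ j.succ = h i j := rfl
end

theorem blk_inv {h : Matrix (Fin 3) (Fin 3) ℝ} (hh : h.det ≠ 0) : (blk (-1) h)⁻¹ = blk (-1) h⁻¹ := by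
  refine Matrix.inv_eq_right_inv ?_
  have h1 := Matrix.mul_nonsing_inv h (isUnit_iff_ne_zero.2 hh)
  ext i j
  rw [Matrix.mul_apply, Fin.sum_univ_succ]
  refine Fin.cases ?_ (fun i => ?_) i <;> refine Fin.cases ?_ (fun j => ?_) j
  · simp
  · simp [(Fin.succ_ne_zero j).symm]
  · simp [(Fin.succ_ne_zero i)]
  · simpa [Matrix.mul_apply, Matrix.one_apply] using congrFun (congrFun h1 i) j

variable (h : Coord 4 → Matrix (Fin 3) (Fin 3) ℝ)

/-- The synchronous metric `-dt² + hᵢⱼ dyⁱ dyʲ`. -/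
def syncMetric (q : Coord 4) : Matrix (Fin 4) (Fin 4) ℝ := blk (-1) (h q)

/-- Half the time derivative of the spatial metric. -/
def expLow (q : Coord 4) : Matrix (Fin 3) (Fin 3) ℝ := (1 / 2 : ℝ) • pderivMat 0 h q

/-- The mixed tensor `h⁻¹ ∂ₜh / 2`. -/
def expMixed (q : Coord 4) : Matrix (Fin 3) (Fin 3) ℝ := (h q)⁻¹ * expLow h q

/-- The Christoffel symbols of the spatial metric, as functions on `ℝ⁴`. -/
def spatialChristoffel (k i j : Fin 3) (q : Coord 4) : ℝ :=
  (1 / 2) * ∑ l, (h q)⁻¹ k l *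
    (pderiv i.succ (fun y => h y l j) q + pderiv j.succ (fun y => h y l i) q
      - pderiv l.succ (fun y => h y i j) q)

/-- The Ricci tensor of the spatial metric, as a function on `ℝ⁴`. -/
def spatialRicci (q : Coord 4) : Matrix (Fin 3) (Fin 3) ℝ :=
  Matrix.of fun i j =>
    ∑ k, (pderiv k.succ (spatialChristoffel h k i j) q - pderiv j.succ (spatialChristoffel h k i k) q)
    + ∑ k, ∑ l, (spatialChristoffel h k k l q * spatialChristoffel h l i j q
        - spatialChristoffel h k j l q * spatialChristoffel h l i k q)

variable {h} {Ω : Set (Coord 4)}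

theorem SmoothMatOn.expLow (hΩ : IsOpen Ω) (hh : SmoothMatOn h Ω) : SmoothMatOn (expLow h) Ω :=
  fun a b => contDiffOn_const.mul (hh.pderivMat hΩ 0 a b)

theorem SmoothMatOn.expMixed (hΩ : IsOpen Ω) (hh : SmoothMatOn h Ω) (h0 : ∀ y ∈ Ω, (h y).det ≠ 0) :
    SmoothMatOn (expMixed h) Ω :=
  (hh.inv h0).mul (hh.expLow hΩ)

theorem contDiffOn_spatialChristoffel (hΩ : IsOpen Ω) (hh : SmoothMatOn h Ω)
    (h0 : ∀ y ∈ Ω, (h y).det ≠ 0) (k i j : Fin 3) :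
    ContDiffOn ℝ ∞ (spatialChristoffel h k i j) Ω := by
  refine contDiffOn_const.mul (ContDiffOn.sum fun l _ => (hh.inv h0 k l).mul ?_)
  exact ((contDiffOn_pderiv hΩ (hh _ _) _).add (contDiffOn_pderiv hΩ (hh _ _) _)).sub
    (contDiffOn_pderiv hΩ (hh _ _) _)

theorem christoffel_slice (hΩ : IsOpen Ω) (hh : SmoothMatOn h Ω) {t : ℝ} {y : Coord 3}
    (hq : joinCoord t y ∈ Ω) (k i j : Fin 3) :
    christoffel (fun z => h (joinCoord t z)) k i j y = spatialChristoffel h k i j (joinCoord t y) := by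
  have hd := fun a b => pderiv_joinCoord (hh.differentiableAt hΩ hq a b)
  simp only [christoffel, spatialChristoffel, hd]

/-- The curvature of a leaf involves derivatives at fixed time only, so the curvatures of all leaves
together form one function on `ℝ⁴`. That is the form in which a time derivative can be taken. -/
theorem ricci_slice (hΩ : IsOpen Ω) (hh : SmoothMatOn h Ω) (h0 : ∀ y ∈ Ω, (h y).det ≠ 0)
    {t : ℝ} {y : Coord 3} (hq : joinCoord t y ∈ Ω) :
    ricci (fun z => h (joinCoord t z)) y = spatialRicci h (joinCoord t y) := by
  have hc : Continuous fun z : Coord 3 => joinCoord t z :=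
    continuous_iff_continuousAt.2 fun z => (hasFDerivAt_joinCoord_right t z).continuousAt
  have hev : ∀ k i j, christoffel (fun z => h (joinCoord t z)) k i j
      =ᶠ[nhds y] fun z => spatialChristoffel h k i j (joinCoord t z) := fun k i j => by
    filter_upwards [hc.continuousAt.preimage_mem_nhds (hΩ.mem_nhds hq)] with z hz
    exact christoffel_slice hΩ hh hz k i j
  have hd := fun k i j => pderiv_joinCoord
    (differentiableAt_of_contDiffOn hΩ (contDiffOn_spatialChristoffel hΩ hh h0 k i j) hq)
  ext i j
  simp only [ricci, spatialRicci, Matrix.of_apply, pderiv_congr _ (hev _ _ _), hd,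
    christoffel_slice hΩ hh hq]

end Synchronous

section Synchronous

variable {h : Coord 4 → Matrix (Fin 3) (Fin 3) ℝ} {Ω : Set (Coord 4)} {q : Coord 4}

theorem christoffel_sync_zero_zero_left (h0 : (h q).det ≠ 0) (j : Fin 4) :
    christoffel (syncMetric h) 0 0 j q = 0 := by
  simp only [christoffel, syncMetric, blk_inv h0, Fin.sum_univ_succ (n := 3)]
  refine Fin.cases ?_ (fun j => ?_) j <;> simp [pderiv_const]

theorem christoffel_symm {n : ℕ} {G : Coord n → Matrix (Fin n) (Fin n) ℝ}
    (hG : ∀ x i j, G x i j = G x j i) (k i j : Fin n) :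
    christoffel G k i j = christoffel G k j i := by
  funext x
  simp only [christoffel, hG _ i j]
  congr 1
  exact Finset.sum_congr rfl fun l _ => by ring

theorem syncMetric_symm (hs : ∀ y, (h y)ᵀ = h y) (y : Coord 4) (i j : Fin 4) :
    syncMetric h y i j = syncMetric h y j i := by
  refine Fin.cases ?_ (fun i => ?_) i <;> refine Fin.cases ?_ (fun j => ?_) j <;> simp [syncMetric]
  exact congrFun (congrFun (hs y) j) i

theorem christoffel_sync_zero_succ_succ (h0 : (h q).det ≠ 0) (i j : Fin 3) :
    christoffel (syncMetric h) 0 i.succ j.succ q = expLow h q i j := by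
  simp [christoffel, syncMetric, blk_inv h0, Fin.sum_univ_succ (n := 3), pderiv_const, expLow,
    pderivMat]

theorem christoffel_sync_succ_zero_zero (h0 : (h q).det ≠ 0) (k : Fin 3) :
    christoffel (syncMetric h) k.succ 0 0 q = 0 := by
  simp [christoffel, syncMetric, blk_inv h0, Fin.sum_univ_succ (n := 3), pderiv_const]

theorem christoffel_sync_succ_zero_succ (h0 : (h q).det ≠ 0) (k j : Fin 3) :
    christoffel (syncMetric h) k.succ 0 j.succ q = expMixed h q k j := by
  simp only [christoffel, syncMetric, blk_inv h0, Fin.sum_univ_succ (n := 3), pderiv_const, expMixed,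
    expLow, pderivMat, blk_succ_zero, blk_succ_succ, blk_zero_succ, Matrix.mul_apply]
  simp [Finset.mul_sum]
  exact Finset.sum_congr rfl fun l _ => by ring

theorem christoffel_sync_succ_succ_succ (h0 : (h q).det ≠ 0) (k i j : Fin 3) :
    christoffel (syncMetric h) k.succ i.succ j.succ q = spatialChristoffel h k i j q := by
  simp [christoffel, syncMetric, blk_inv h0, Fin.sum_univ_succ (n := 3), spatialChristoffel]

theorem spatialChristoffel_symm (hs : ∀ y, (h y)ᵀ = h y) (k i j : Fin 3) :
    spatialChristoffel h k i j q = spatialChristoffel h k j i q := by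
  have h1 : ∀ y, h y i j = h y j i := fun y => congrFun (congrFun (hs y) j) i
  simp only [spatialChristoffel, h1]
  congr 1
  exact Finset.sum_congr rfl fun l _ => by ring

/-- The Christoffel symbols of a synchronous metric. -/
theorem christoffel_sync (hs : ∀ y, (h y)ᵀ = h y) (h0 : (h q).det ≠ 0) :
    (∀ j, christoffel (syncMetric h) 0 0 j q = 0) ∧ (∀ j, christoffel (syncMetric h) 0 j 0 q = 0) ∧
    (∀ i j : Fin 3, christoffel (syncMetric h) 0 i.succ j.succ q = expLow h q i j) ∧
    (∀ k : Fin 3, christoffel (syncMetric h) k.succ 0 0 q = 0) ∧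
    (∀ k j : Fin 3, christoffel (syncMetric h) k.succ 0 j.succ q = expMixed h q k j) ∧
    (∀ k j : Fin 3, christoffel (syncMetric h) k.succ j.succ 0 q = expMixed h q k j) ∧
    (∀ k i j : Fin 3,
      christoffel (syncMetric h) k.succ i.succ j.succ q = spatialChristoffel h k i j q) := by
  have hsym := fun k i j => congrFun (christoffel_symm (syncMetric_symm hs) k i j) q
  refine ⟨christoffel_sync_zero_zero_left h0, fun j => ?_, christoffel_sync_zero_succ_succ h0,
    christoffel_sync_succ_zero_zero h0, christoffel_sync_succ_zero_succ h0, fun k j => ?_,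
    christoffel_sync_succ_succ_succ h0⟩
  · rw [hsym, christoffel_sync_zero_zero_left h0]
  · rw [hsym, christoffel_sync_succ_zero_succ h0]

/-- The partial derivatives of the Christoffel symbols of a synchronous metric. -/
theorem pderiv_christoffel_sync (hΩ : IsOpen Ω) (hs : ∀ y, (h y)ᵀ = h y)
    (h0 : ∀ y ∈ Ω, (h y).det ≠ 0) (hq : q ∈ Ω) (a : Fin 4) :
    (∀ j, pderiv a (christoffel (syncMetric h) 0 0 j) q = 0) ∧
    (∀ j, pderiv a (christoffel (syncMetric h) 0 j 0) q = 0) ∧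
    (∀ i j : Fin 3, pderiv a (christoffel (syncMetric h) 0 i.succ j.succ) q
      = pderivMat a (expLow h) q i j) ∧
    (∀ k : Fin 3, pderiv a (christoffel (syncMetric h) k.succ 0 0) q = 0) ∧
    (∀ k j : Fin 3, pderiv a (christoffel (syncMetric h) k.succ 0 j.succ) q
      = pderivMat a (expMixed h) q k j) ∧
    (∀ k j : Fin 3, pderiv a (christoffel (syncMetric h) k.succ j.succ 0) q
      = pderivMat a (expMixed h) q k j) ∧
    (∀ k i j : Fin 3, pderiv a (christoffel (syncMetric h) k.succ i.succ j.succ) q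
      = pderiv a (spatialChristoffel h k i j) q) := by
  have key : ∀ {f g : Coord 4 → ℝ}, (∀ y ∈ Ω, f y = g y) → pderiv a f q = pderiv a g q :=
    fun {f g} hfg => pderiv_congr a (by filter_upwards [hΩ.mem_nhds hq] with y hy using hfg y hy)
  have hc := fun y hy => christoffel_sync (q := y) hs (h0 y hy)
  refine ⟨fun j => ?_, fun j => ?_, fun i j => ?_, fun k => ?_, fun k j => ?_, fun k j => ?_,
    fun k i j => ?_⟩
  · rw [key (g := fun _ => 0) fun y hy => (hc y hy).1 j, pderiv_const]
  · rw [key (g := fun _ => 0) fun y hy => (hc y hy).2.1 j, pderiv_const]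
  · exact key fun y hy => (hc y hy).2.2.1 i j
  · rw [key (g := fun _ => 0) fun y hy => (hc y hy).2.2.2.1 k, pderiv_const]
  · exact key fun y hy => (hc y hy).2.2.2.2.1 k j
  · exact key fun y hy => (hc y hy).2.2.2.2.2.1 k j
  · exact key fun y hy => (hc y hy).2.2.2.2.2.2 k i j

/-- The time-time component of the Ricci tensor of a synchronous metric. -/
theorem ricci_sync_zero_zero (hΩ : IsOpen Ω) (hs : ∀ y, (h y)ᵀ = h y)
    (h0 : ∀ y ∈ Ω, (h y).det ≠ 0) (hq : q ∈ Ω) :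
    ricci (syncMetric h) q 0 0
      = -(pderivMat 0 (expMixed h) q).trace - (expMixed h q * expMixed h q).trace := by
  obtain ⟨c1, c2, c3, c4, c5, c6, c7⟩ := christoffel_sync hs (h0 q hq)
  have hp := pderiv_christoffel_sync hΩ hs h0 hq
  simp only [ricci, Matrix.of_apply, Fin.sum_univ_succ (n := 3), c1, c2, c4, c5, c6,
    (hp _).1, (hp _).2.1, (hp _).2.2.2.1, (hp _).2.2.2.2.1, Matrix.trace,
    Matrix.diag, Matrix.mul_apply]
  simp [sub_eq_add_neg]

/-- The time-space components of the Ricci tensor of a synchronous metric. -/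
theorem ricci_sync_zero_succ (hΩ : IsOpen Ω) (hs : ∀ y, (h y)ᵀ = h y)
    (h0 : ∀ y ∈ Ω, (h y).det ≠ 0) (hq : q ∈ Ω) (j : Fin 3) :
    ricci (syncMetric h) q 0 j.succ
      = ∑ k, (pderivMat k.succ (expMixed h) q k j - pderivMat j.succ (expMixed h) q k k)
        + ∑ k, ∑ l, (spatialChristoffel h k k l q * expMixed h q l j
          - spatialChristoffel h k j l q * expMixed h q l k) := by
  obtain ⟨c1, c2, c3, c4, c5, c6, c7⟩ := christoffel_sync hs (h0 q hq)
  have hp := pderiv_christoffel_sync hΩ hs h0 hq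
  simp only [ricci, Matrix.of_apply, Fin.sum_univ_succ (n := 3), c1, c2, c4, c5, c6, c7,
    (hp _).1, (hp _).2.1, (hp _).2.2.2.2.1]
  simp

/-- The space-space components of the Ricci tensor of a synchronous metric. -/
theorem ricci_sync_succ_succ (hΩ : IsOpen Ω) (hs : ∀ y, (h y)ᵀ = h y)
    (h0 : ∀ y ∈ Ω, (h y).det ≠ 0) (hq : q ∈ Ω) (i j : Fin 3) :
    ricci (syncMetric h) q i.succ j.succ
      = spatialRicci h q i j + pderivMat 0 (expLow h) q i j
        + (expMixed h q).trace * expLow h q i j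
        - ∑ l, expLow h q j l * expMixed h q l i - ∑ l, expMixed h q l j * expLow h q i l := by
  obtain ⟨c1, c2, c3, c4, c5, c6, c7⟩ := christoffel_sync hs (h0 q hq)
  have hp := pderiv_christoffel_sync hΩ hs h0 hq
  simp only [ricci, spatialRicci, Matrix.of_apply, Fin.sum_univ_succ (n := 3), c1, c2, c3, c6, c7,
    (hp _).2.1, (hp _).2.2.1,
    (hp _).2.2.2.2.2.2, Matrix.trace, Matrix.diag]
  simp only [Finset.sum_add_distrib, Finset.sum_sub_distrib, Finset.sum_mul]
  simp
  ring

end Synchronous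

/-! ### Variation of the leaf curvature in time: the Palatini identity and the momentum constraint.
-/

section Palatini

/-- The Palatini identity with all analysis stripped off. `H` is the inverse metric, `c` the
Christoffel symbols, `A` their variation, `dA k i j` the derivative `∂ₖHⁱʲ` (`hdH` is metric
compatibility) and `d a k i j` the derivative `∂ₐAᵏᵢⱼ`. The contracted variation of the Ricci tensor
is the covariant divergence of `HⁱʲAᵏᵢⱼ - HᵏʲAˡⱼₗ`; `hF` says that this vector vanishes and `hdF`
that its coordinate divergence does. -/
theorem palatini_algebra (H : Matrix (Fin 3) (Fin 3) ℝ) (c A dA : Fin 3 → Fin 3 → Fin 3 → ℝ)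
    (d : Fin 3 → Fin 3 → Fin 3 → Fin 3 → ℝ)
    (hH : ∀ i j, H i j = H j i) (hc : ∀ k i j, c k i j = c k j i) (hA : ∀ k i j, A k i j = A k j i)
    (hdH : ∀ k i j, dA k i j = -∑ m, (c i k m * H m j + c j k m * H i m))
    (hF : ∀ k, ∑ i, ∑ j, H i j * A k i j = ∑ j, H k j * ∑ l, A l j l)
    (hdF : ∑ k, ∑ i, ∑ j, (dA k i j * A k i j + H i j * d k k i j)
      = ∑ k, ∑ j, (dA k k j * ∑ l, A l j l + H k j * ∑ l, d k l j l)) :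
    ∑ i, ∑ j, H i j * (∑ k, (d k k i j - d j k i k)
      + ∑ k, ∑ l, (A k k l * c l i j + c k k l * A l i j - (A k j l * c l i k + c k j l * A l i k)))
      = 0 := by
  have h1 : ∑ i, ∑ j, H i j * ∑ k, (d k k i j - d j k i k)
      = ∑ k, ∑ i, ∑ j, H i j * d k k i j - ∑ k, ∑ j, H k j * ∑ l, d k l j l := by
    simp only [Finset.sum_sub_distrib, mul_sub]
    congr 1
    · simp only [Finset.mul_sum]
      rw [Finset.sum_comm' (t' := Finset.univ) (s' := fun _ => Finset.univ) (by simp)]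
      simp only [Fin.sum_univ_three]; ring
    · rw [Finset.sum_comm]
      exact Finset.sum_congr rfl fun i _ => Finset.sum_congr rfl fun j _ => by rw [hH]
  have h2 : ∑ k, ∑ i, ∑ j, H i j * d k k i j - ∑ k, ∑ j, H k j * ∑ l, d k l j l
      = ∑ k, ∑ j, dA k k j * ∑ l, A l j l - ∑ k, ∑ i, ∑ j, dA k i j * A k i j := by
    simp only [Finset.sum_add_distrib] at hdF
    linarith
  -- Contracting `hF` with `Γⁿₙₖ` supplies the connection term that completes the coordinate
  -- divergence to a covariant one.
  have h3 : ∑ k, (∑ n, c n n k) * (∑ i, ∑ j, H i j * A k i j)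
      = ∑ k, (∑ n, c n n k) * ∑ j, H k j * ∑ l, A l j l := by simp only [hF]
  simp only [mul_add, Finset.sum_add_distrib, h1, h2]
  simp only [hdH]
  simp only [Fin.sum_univ_three] at h3 ⊢
  simp only [hH 1 0, hH 2 0, hH 2 1, hc _ 1 0, hc _ 2 0, hc _ 2 1, hA _ 1 0, hA _ 2 0, hA _ 2 1] at h3 ⊢
  linear_combination h3
end Palatini

section Palatini

variable {h : Coord 4 → Matrix (Fin 3) (Fin 3) ℝ} {Ω : Set (Coord 4)} {q : Coord 4}

theorem expLow_symm (hs : ∀ y, (h y)ᵀ = h y) (i j : Fin 3) : expLow h q i j = expLow h q j i := by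
  have h1 : ∀ y, h y i j = h y j i := fun y => congrFun (congrFun (hs y) j) i
  simp [expLow, pderivMat, h1]

theorem inv_symm {n : ℕ} {A : Matrix (Fin n) (Fin n) ℝ} (hs : Aᵀ = A) (i j : Fin n) :
    A⁻¹ i j = A⁻¹ j i := by
  have : (A⁻¹)ᵀ = A⁻¹ := by rw [Matrix.transpose_nonsing_inv, hs]
  exact congrFun (congrFun this j) i

/-- Metric compatibility of the Levi-Civita connection, `∇ₖhⁱʲ = 0`, written with coordinate
derivatives. -/
theorem pderiv_succ_inv (hΩ : IsOpen Ω) (hh : SmoothMatOn h Ω) (hs : ∀ y, (h y)ᵀ = h y)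
    (h0 : ∀ y ∈ Ω, (h y).det ≠ 0) (hq : q ∈ Ω) (k i j : Fin 3) :
    pderiv k.succ (fun y => (h y)⁻¹ i j) q
      = -∑ m, (spatialChristoffel h i k m q * (h q)⁻¹ m j
          + spatialChristoffel h j k m q * (h q)⁻¹ i m) := by
  have hu := isUnit_iff_ne_zero.2 (h0 q hq)
  set Γ : Matrix (Fin 3) (Fin 3) ℝ := Matrix.of fun m b => spatialChristoffel h m k b q with hΓ
  set Dk : Matrix (Fin 3) (Fin 3) ℝ := Matrix.of fun l j =>
    pderiv k.succ (fun y => h y l j) q + pderiv j.succ (fun y => h y l k) q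
      - pderiv l.succ (fun y => h y k j) q with hDk
  have e1 : Γ = (1 / 2 : ℝ) • ((h q)⁻¹ * Dk) := by
    ext m b; simp [hΓ, hDk, Matrix.mul_apply, spatialChristoffel]
  have e2 : h q * Γ = (1 / 2 : ℝ) • Dk := by
    rw [e1, Matrix.mul_smul, ← mul_assoc, Matrix.mul_nonsing_inv _ hu, one_mul]
  -- Lowering the index of `Γ` gives half of `Dk`. The last two terms of `Dk` are antisymmetric in
  -- its indices, so adding the transpose leaves `∂ₖh` alone.
  have e3 : pderivMat k.succ h q = h q * Γ + (h q * Γ)ᵀ := by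
    rw [e2]
    have h1 : ∀ y a b, h y a b = h y b a := fun y a b => congrFun (congrFun (hs y) b) a
    ext a b
    simp only [hDk, pderivMat, Matrix.add_apply, Matrix.transpose_apply, Matrix.smul_apply,
      Matrix.of_apply, smul_eq_mul]
    simp only [h1 _ b a, h1 _ k b, h1 _ k a]
    ring
  have e4 := pderivMat_inv hΩ hh h0 hq k.succ
  rw [e3, Matrix.transpose_mul, hs] at e4
  have e5 : -((h q)⁻¹ * (h q * Γ + Γᵀ * h q) * (h q)⁻¹) = -(Γ * (h q)⁻¹ + (h q)⁻¹ * Γᵀ) := by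
    rw [mul_add, add_mul, ← mul_assoc, Matrix.nonsing_inv_mul _ hu, one_mul, mul_assoc, mul_assoc,
      Matrix.mul_nonsing_inv _ hu, mul_one]
  rw [e5] at e4
  have := congrFun (congrFun e4 i) j
  simp only [pderivMat, Matrix.of_apply, Matrix.neg_apply, Matrix.add_apply, Matrix.mul_apply,
    Matrix.transpose_apply, hΓ] at this
  rw [this, Finset.sum_add_distrib]
  simp only [mul_comm]

/-- The spatial covariant derivative of the expansion tensor. -/
def covExpLow (h : Coord 4 → Matrix (Fin 3) (Fin 3) ℝ) (q : Coord 4) (i l j : Fin 3) : ℝ :=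
  pderiv i.succ (fun y => expLow h y l j) q
    - ∑ m, spatialChristoffel h m i l q * expLow h q m j
    - ∑ m, spatialChristoffel h m i j q * expLow h q l m

theorem covExpLow_symm (hs : ∀ y, (h y)ᵀ = h y) (i l j : Fin 3) :
    covExpLow h q i l j = covExpLow h q i j l := by
  simp only [covExpLow, expLow_symm hs l, expLow_symm hs _ j]
  ring

theorem pderivMat_zero_eq (q : Coord 4) : pderivMat 0 h q = (2 : ℝ) • expLow h q := by
  simp [expLow, smul_smul]

theorem pderiv_zero_inv (hΩ : IsOpen Ω) (hh : SmoothMatOn h Ω)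
    (h0 : ∀ y ∈ Ω, (h y).det ≠ 0) (hq : q ∈ Ω) :
    pderivMat 0 (fun y => (h y)⁻¹) q = -(2 : ℝ) • (expMixed h q * (h q)⁻¹) := by
  rw [pderivMat_inv hΩ hh h0 hq, pderivMat_zero_eq, expMixed]
  simp

/-- The time derivative of the Christoffel symbols of the spatial metric. -/
theorem pderiv_zero_spatialChristoffel (hΩ : IsOpen Ω) (hh : SmoothMatOn h Ω)
    (hs : ∀ y, (h y)ᵀ = h y) (h0 : ∀ y ∈ Ω, (h y).det ≠ 0) (hq : q ∈ Ω) (k i j : Fin 3) :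
    pderiv 0 (spatialChristoffel h k i j) q
      = ∑ l, (h q)⁻¹ k l * (covExpLow h q i l j + covExpLow h q j l i - covExpLow h q l i j) := by
  have hd : ∀ a b (i : Fin 3), DifferentiableAt ℝ (pderiv i.succ fun y => h y a b) q := fun a b i =>
    differentiableAt_of_contDiffOn hΩ (contDiffOn_pderiv hΩ (hh a b) _) hq
  have hi : ∀ a b, DifferentiableAt ℝ (fun y => (h y)⁻¹ a b) q := fun a b =>
    (hh.inv h0).differentiableAt hΩ hq a b
  have hc : ∀ a b (i : Fin 3), pderiv 0 (pderiv i.succ fun y => h y a b) q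
      = 2 * pderiv i.succ (fun y => expLow h y a b) q := by
    intro a b i
    rw [pderiv_comm hΩ (hh a b) hq]
    have h2 : (pderiv 0 fun y => h y a b) = fun y => 2 * expLow h y a b := by
      funext y; simp [expLow, pderivMat]
    rw [h2, pderiv_const_mul _ _ ((hh.expLow hΩ).differentiableAt hΩ hq a b)]
  have hinv : ∀ a b, pderiv 0 (fun y => (h y)⁻¹ a b) q = -2 * (expMixed h q * (h q)⁻¹) a b := by
    intro a b
    simpa [pderivMat] using congrFun (congrFun (pderiv_zero_inv hΩ hh h0 hq) a) b
  have e1 : pderiv 0 (spatialChristoffel h k i j) q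
      = (1 / 2) * ∑ l, (-2 * (expMixed h q * (h q)⁻¹) k l *
        (pderiv i.succ (fun y => h y l j) q + pderiv j.succ (fun y => h y l i) q
          - pderiv l.succ (fun y => h y i j) q) + (h q)⁻¹ k l *
        (2 * pderiv i.succ (fun y => expLow h y l j) q + 2 * pderiv j.succ (fun y => expLow h y l i) q
          - 2 * pderiv l.succ (fun y => expLow h y i j) q)) := by
    show pderiv 0 (fun y => (1 / 2) * ∑ l, (h y)⁻¹ k l *
      (pderiv i.succ (fun y => h y l j) y + pderiv j.succ (fun y => h y l i) y
        - pderiv l.succ (fun y => h y i j) y)) q = _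
    have hdd : ∀ l, DifferentiableAt ℝ (fun y => pderiv i.succ (fun y => h y l j) y
        + pderiv j.succ (fun y => h y l i) y - pderiv l.succ (fun y => h y i j) y) q :=
      fun l => ((hd l j i).add (hd l i j)).sub (hd i j l)
    rw [pderiv_const_mul (f := fun y => ∑ l, (h y)⁻¹ k l *
      (pderiv i.succ (fun y => h y l j) y + pderiv j.succ (fun y => h y l i) y
        - pderiv l.succ (fun y => h y i j) y)) _ _
        (DifferentiableAt.fun_sum fun l _ => (hi k l).mul (hdd l)),
      pderiv_sum (F := fun l y => (h y)⁻¹ k l *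
        (pderiv i.succ (fun y => h y l j) y + pderiv j.succ (fun y => h y l i) y
        - pderiv l.succ (fun y => h y i j) y)) _ _ fun l _ => (hi k l).mul (hdd l)]
    congr 1
    refine Finset.sum_congr rfl fun l _ => ?_
    rw [pderiv_mul _ (hi k l) (hdd l), hinv,
      pderiv_sub _ ((hd l j i).fun_add (hd l i j)) (hd i j l), pderiv_add _ (hd l j i) (hd l i j),
      hc, hc, hc]
  -- The derivative of the inverse metric contributes `Γᵐᵢⱼ` contracted with `Θ`. In the combination
  -- of three covariant derivatives all other connection terms cancel, so this is exactly what is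
  -- missing.
  have e2 : ∑ l, (expMixed h q * (h q)⁻¹) k l *
        (pderiv i.succ (fun y => h y l j) q + pderiv j.succ (fun y => h y l i) q
          - pderiv l.succ (fun y => h y i j) q)
      = ∑ l, (h q)⁻¹ k l * (2 * ∑ m, expLow h q l m * spatialChristoffel h m i j q) := by
    simp only [expMixed, spatialChristoffel, Fin.sum_univ_three, Matrix.mul_apply]
    ring
  have hLs := fun a b => expLow_symm (q := q) hs a b
  have hcs := fun k a b => spatialChristoffel_symm (q := q) hs k a b
  rw [e1, Finset.sum_add_distrib]
  simp only [mul_assoc, ← Finset.mul_sum _ _ (-2 : ℝ)]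
  rw [e2, mul_add, ← mul_assoc, Finset.mul_sum, Finset.mul_sum, ← Finset.sum_add_distrib]
  refine Finset.sum_congr rfl fun l _ => ?_
  simp only [covExpLow, hcs _ l i, hcs _ l j, hcs _ j i, hLs i _, Fin.sum_univ_three]
  simp only [hLs l _]
  ring

theorem pderiv_succ_expMixed (hΩ : IsOpen Ω) (hh : SmoothMatOn h Ω) (hs : ∀ y, (h y)ᵀ = h y)
    (h0 : ∀ y ∈ Ω, (h y).det ≠ 0) (hq : q ∈ Ω) (k i j : Fin 3) :
    pderivMat k.succ (expMixed h) q i j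
      = ∑ l, ((-∑ m, (spatialChristoffel h i k m q * (h q)⁻¹ m l
          + spatialChristoffel h l k m q * (h q)⁻¹ i m)) * expLow h q l j
          + (h q)⁻¹ i l * pderiv k.succ (fun y => expLow h y l j) q) := by
  have h1 := pderivMat_mul k.succ ((hh.inv h0).differentiableAt hΩ hq)
    ((hh.expLow hΩ).differentiableAt hΩ hq)
  rw [show expMixed h = fun y => (h y)⁻¹ * expLow h y from rfl, h1]
  simp only [Matrix.add_apply, Matrix.mul_apply, Finset.sum_add_distrib, pderivMat, Matrix.of_apply,
    pderiv_succ_inv hΩ hh hs h0 hq]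

/-- The gradient of the rate of expansion. -/
theorem sum_pderiv_succ_expMixed_diag (hΩ : IsOpen Ω) (hh : SmoothMatOn h Ω)
    (hs : ∀ y, (h y)ᵀ = h y) (h0 : ∀ y ∈ Ω, (h y).det ≠ 0) (hq : q ∈ Ω) (j : Fin 3) :
    ∑ k, pderivMat j.succ (expMixed h) q k k
      = ∑ k, ∑ l, (h q)⁻¹ k l * covExpLow h q j k l := by
  have hLs := fun a b => expLow_symm (q := q) hs a b
  have hHs := inv_symm (hs q)
  have hdLs : ∀ a b, pderiv j.succ (fun y => expLow h y a b) q
      = pderiv j.succ (fun y => expLow h y b a) q := fun a b =>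
    congrArg (fun f => pderiv j.succ f q) (funext fun y => expLow_symm (q := y) hs a b)
  simp only [pderiv_succ_expMixed hΩ hh hs h0 hq, covExpLow, Fin.sum_univ_three]
  simp only [hLs 1 0, hLs 2 0, hLs 2 1, hHs 1 0, hHs 2 0, hHs 2 1, hdLs 1 0, hdLs 2 0, hdLs 2 1]
  ring

/-- The divergence of the expansion tensor. -/
theorem divergence_expMixed (hΩ : IsOpen Ω) (hh : SmoothMatOn h Ω)
    (hs : ∀ y, (h y)ᵀ = h y) (h0 : ∀ y ∈ Ω, (h y).det ≠ 0) (hq : q ∈ Ω) (j : Fin 3) :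
    ∑ k, pderivMat k.succ (expMixed h) q k j
        + ∑ k, ∑ l, (spatialChristoffel h k k l q * expMixed h q l j
          - spatialChristoffel h k j l q * expMixed h q l k)
      = ∑ k, ∑ l, (h q)⁻¹ k l * covExpLow h q k l j := by
  have hHs := inv_symm (hs q)
  have hcs := fun k a b => spatialChristoffel_symm (q := q) hs k a b
  simp only [pderiv_succ_expMixed hΩ hh hs h0 hq, covExpLow, Fin.sum_univ_three, expMixed,
    Matrix.mul_apply]
  have hLs := fun a b => expLow_symm (q := q) hs a b
  simp only [hHs 1 0, hHs 2 0, hHs 2 1, hcs _ 1 0, hcs _ 2 0, hcs _ 2 1, hcs _ j 0, hcs _ j 1, hcs _ j 2,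
    hLs 1 0, hLs 2 0, hLs 2 1]
  ring

/-- The momentum constraint: `Θᵏⱼ` has the divergence `∂ⱼΘ`. -/
def MomentumConstraint (h : Coord 4 → Matrix (Fin 3) (Fin 3) ℝ) (q : Coord 4) : Prop :=
  ∀ j : Fin 3, ∑ k, (pderivMat k.succ (expMixed h) q k j - pderivMat j.succ (expMixed h) q k k)
    + ∑ k, ∑ l, (spatialChristoffel h k k l q * expMixed h q l j
      - spatialChristoffel h k j l q * expMixed h q l k) = 0

/-- As `∂ₜΓᵏᵢⱼ = ∇ᵢΘᵏⱼ + ∇ⱼΘᵏᵢ - ∇ᵏΘᵢⱼ`, the left side is `2∇ᵢΘⁱᵏ - ∇ᵏΘ` and the right side is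
`∇ᵏΘ`. They differ by twice the momentum constraint. This is hypothesis `hF` of `palatini_algebra`.
-/
theorem contracted_pderiv_zero_spatialChristoffel (hΩ : IsOpen Ω) (hh : SmoothMatOn h Ω)
    (hs : ∀ y, (h y)ᵀ = h y) (h0 : ∀ y ∈ Ω, (h y).det ≠ 0) (hq : q ∈ Ω)
    (hm : MomentumConstraint h q) (k : Fin 3) :
    ∑ i, ∑ j, (h q)⁻¹ i j * pderiv 0 (spatialChristoffel h k i j) q
      = ∑ j, (h q)⁻¹ k j * ∑ l, pderiv 0 (spatialChristoffel h l j l) q := by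
  have hHs := inv_symm (hs q)
  have hS := fun i l j => covExpLow_symm (q := q) hs i l j
  have hm' : ∀ j, ∑ k, ∑ l, (h q)⁻¹ k l * covExpLow h q k l j
      = ∑ k, ∑ l, (h q)⁻¹ k l * covExpLow h q j k l := by
    intro j
    rw [← divergence_expMixed hΩ hh hs h0 hq, ← sum_pderiv_succ_expMixed_diag hΩ hh hs h0 hq]
    have := hm j
    rw [Finset.sum_sub_distrib] at this
    linarith
  have h3 : ∑ j, (h q)⁻¹ k j * ∑ a, ∑ b, (h q)⁻¹ a b * covExpLow h q a b j
      = ∑ j, (h q)⁻¹ k j * ∑ a, ∑ b, (h q)⁻¹ a b * covExpLow h q j a b := by simp only [hm']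
  simp only [pderiv_zero_spatialChristoffel hΩ hh hs h0 hq]
  simp only [Fin.sum_univ_three] at h3 ⊢
  simp only [hHs 1 0, hHs 2 0, hHs 2 1, hS _ 1 0, hS _ 2 0, hS _ 2 1] at h3 ⊢
  linear_combination 2 * h3

/-- Under the momentum constraint the time derivative of the Ricci tensor is trace-free. -/
theorem contracted_pderiv_zero_spatialRicci (hΩ : IsOpen Ω) (hh : SmoothMatOn h Ω)
    (hs : ∀ y, (h y)ᵀ = h y) (h0 : ∀ y ∈ Ω, (h y).det ≠ 0) (hq : q ∈ Ω)
    (hm : ∀ y ∈ Ω, MomentumConstraint h y) :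
    ∑ i, ∑ j, (h q)⁻¹ i j * pderiv 0 (fun y => spatialRicci h y i j) q = 0 := by
  have hc := contDiffOn_spatialChristoffel hΩ hh h0
  have hdc : ∀ k i j, DifferentiableAt ℝ (spatialChristoffel h k i j) q := fun k i j =>
    differentiableAt_of_contDiffOn hΩ (hc k i j) hq
  have hddc : ∀ a k i j, DifferentiableAt ℝ (pderiv a (spatialChristoffel h k i j)) q :=
    fun a k i j => differentiableAt_of_contDiffOn hΩ (contDiffOn_pderiv hΩ (hc k i j) a) hq
  have hi : ∀ a b, DifferentiableAt ℝ (fun y => (h y)⁻¹ a b) q := fun a b =>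
    (hh.inv h0).differentiableAt hΩ hq a b
  set A : Fin 3 → Fin 3 → Fin 3 → ℝ := fun k i j => pderiv 0 (spatialChristoffel h k i j) q with hA
  set d : Fin 3 → Fin 3 → Fin 3 → Fin 3 → ℝ := fun a k i j =>
    pderiv a.succ (pderiv 0 (spatialChristoffel h k i j)) q with hd
  -- Leibniz rule for the Ricci tensor, with partial derivatives interchanged so that `∂ₜ` acts
  -- directly on the Christoffel symbols.
  have hR : ∀ i j, pderiv 0 (fun y => spatialRicci h y i j) q
      = ∑ k, (d k k i j - d j k i k)
      + ∑ k, ∑ l, (A k k l * spatialChristoffel h l i j q + spatialChristoffel h k k l q * A l i j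
        - (A k j l * spatialChristoffel h l i k q + spatialChristoffel h k j l q * A l i k)) := by
    intro i j
    simp only [spatialRicci, Matrix.of_apply]
    rw [pderiv_add _ (DifferentiableAt.fun_sum fun k _ => (hddc _ _ _ _).fun_sub (hddc _ _ _ _))
      (DifferentiableAt.fun_sum fun k _ => DifferentiableAt.fun_sum fun l _ =>
        ((hdc _ _ _).fun_mul (hdc _ _ _)).fun_sub ((hdc _ _ _).fun_mul (hdc _ _ _))),
      pderiv_sum _ _ fun k _ => (hddc _ _ _ _).fun_sub (hddc _ _ _ _),
      pderiv_sum _ _ fun k _ => DifferentiableAt.fun_sum fun l _ =>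
        ((hdc _ _ _).fun_mul (hdc _ _ _)).fun_sub ((hdc _ _ _).fun_mul (hdc _ _ _))]
    congr 1
    · refine Finset.sum_congr rfl fun k _ => ?_
      rw [pderiv_sub _ (hddc _ _ _ _) (hddc _ _ _ _), pderiv_comm hΩ (hc _ _ _) hq 0 k.succ,
        pderiv_comm hΩ (hc _ _ _) hq 0 j.succ]
    · refine Finset.sum_congr rfl fun k _ => ?_
      rw [pderiv_sum _ _ fun l _ =>
        ((hdc _ _ _).fun_mul (hdc _ _ _)).fun_sub ((hdc _ _ _).fun_mul (hdc _ _ _))]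
      refine Finset.sum_congr rfl fun l _ => ?_
      rw [pderiv_sub _ ((hdc _ _ _).fun_mul (hdc _ _ _)) ((hdc _ _ _).fun_mul (hdc _ _ _)),
        pderiv_mul _ (hdc _ _ _) (hdc _ _ _), pderiv_mul _ (hdc _ _ _) (hdc _ _ _)]
  simp only [hR]
  refine palatini_algebra (h q)⁻¹ _ A (fun k i j => pderiv k.succ (fun y => (h y)⁻¹ i j) q) d
    (inv_symm (hs q)) (fun k i j => spatialChristoffel_symm hs k i j) (fun k i j => ?_)
    (fun k i j => pderiv_succ_inv hΩ hh hs h0 hq k i j)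
    (fun k => contracted_pderiv_zero_spatialChristoffel hΩ hh hs h0 hq (hm q hq) k) ?_
  · exact congrArg (fun f => pderiv 0 f q) (funext fun y => spatialChristoffel_symm hs k i j)
  · refine Finset.sum_congr rfl fun k _ => ?_
    -- The trace identity holds on all of `Ω`, hence may be differentiated in space; here the
    -- constraint is needed near `q`, not just at `q`.
    have h1 : (fun y => ∑ i, ∑ j, (h y)⁻¹ i j * pderiv 0 (spatialChristoffel h k i j) y)
        =ᶠ[nhds q] fun y => ∑ j, (h y)⁻¹ k j * ∑ l, pderiv 0 (spatialChristoffel h l j l) y := by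
      filter_upwards [hΩ.mem_nhds hq] with y hy
      exact contracted_pderiv_zero_spatialChristoffel hΩ hh hs h0 hy (hm y hy) k
    have h2 := pderiv_congr k.succ h1
    rw [pderiv_sum _ _ fun i _ => DifferentiableAt.fun_sum fun j _ =>
        (hi _ _).fun_mul (hddc _ _ _ _),
      pderiv_sum _ _ fun j _ => (hi _ _).fun_mul
        (DifferentiableAt.fun_sum fun l _ => hddc _ _ _ _)] at h2
    refine Eq.trans (Finset.sum_congr rfl fun i _ => ?_) (h2.trans
      (Finset.sum_congr rfl fun j _ => ?_))
    · rw [pderiv_sum _ _ fun j _ => (hi _ _).fun_mul (hddc _ _ _ _)]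
      exact Finset.sum_congr rfl fun j _ => (pderiv_mul _ (hi _ _) (hddc _ _ _ _)).symm
    · rw [pderiv_mul _ (hi _ _) (DifferentiableAt.fun_sum fun l _ => hddc _ _ _ _),
        pderiv_sum _ _ fun l _ => hddc _ _ _ _]

end Palatini

/-! ### The Einstein equation of comoving dust, split into constraints and evolution equations. -/

section DustEquations

variable {h : Coord 4 → Matrix (Fin 3) (Fin 3) ℝ} {Ω : Set (Coord 4)} {q : Coord 4}
  {ρ : Coord 4 → ℝ} {Λ : ℝ}

/-- The dust Einstein equation in synchronous comoving coordinates. -/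
def SyncEinstein (h : Coord 4 → Matrix (Fin 3) (Fin 3) ℝ) (ρ : Coord 4 → ℝ) (Λ : ℝ)
    (q : Coord 4) : Prop :=
  ∀ i j, ricci (syncMetric h) q i j - scalarCurv (syncMetric h) q / 2 * syncMetric h q i j
    = ρ q * (if i = 0 then -1 else 0) * (if j = 0 then -1 else 0) - Λ * syncMetric h q i j

/-- Trace reversal. In four dimensions the trace of the equation gives `R = ϱ + 4Λ`, so the
coefficient `R/2 - Λ` of the metric is `ϱ/2 + Λ`. -/
theorem SyncEinstein.ricci_eq (h0 : (h q).det ≠ 0) (hE : SyncEinstein h ρ Λ q) :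
    ricci (syncMetric h) q = (ρ q / 2 + Λ) • syncMetric h q + ρ q • blk 1 0 := by
  set R := scalarCurv (syncMetric h) q with hR
  have h1 : ricci (syncMetric h) q = (R / 2 - Λ) • syncMetric h q + ρ q • blk 1 0 := by
    ext i j
    have := hE i j
    have h2 : (if i = 0 then (-1 : ℝ) else 0) * (if j = 0 then -1 else 0) = blk 1 0 i j := by
      refine Fin.cases ?_ (fun i => ?_) i <;> refine Fin.cases ?_ (fun j => ?_) j <;>
        simp [Fin.succ_ne_zero]
    rw [mul_assoc, h2] at this
    simp only [Matrix.add_apply, Matrix.smul_apply, smul_eq_mul]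
    linarith
  have h3 : R = 4 * (R / 2 - Λ) - ρ q := by
    have hu : IsUnit (syncMetric h q).det := by
      have h5 : blk (-1) (h q) * blk (-1) (h q)⁻¹ = 1 := by
        have h1 := Matrix.mul_nonsing_inv (h q) (isUnit_iff_ne_zero.2 h0)
        ext i j
        rw [Matrix.mul_apply, Fin.sum_univ_succ]
        refine Fin.cases ?_ (fun i => ?_) i <;> refine Fin.cases ?_ (fun j => ?_) j
        · simp
        · simp [(Fin.succ_ne_zero j).symm]
        · simp [Fin.succ_ne_zero i]
        · simpa [Matrix.mul_apply, Matrix.one_apply] using congrFun (congrFun h1 i) j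
      exact Matrix.isUnit_det_of_right_inverse h5
    have h4 : R = ((syncMetric h q)⁻¹ * ricci (syncMetric h) q).trace := rfl
    conv_lhs => rw [h4, h1]
    rw [mul_add, Matrix.mul_smul, Matrix.mul_smul, Matrix.nonsing_inv_mul _ hu, Matrix.trace_add,
      Matrix.trace_smul, Matrix.trace_smul, Matrix.trace_one, syncMetric, blk_inv h0]
    have h6 : (blk (-1) (h q)⁻¹ * blk 1 0).trace = -1 := by
      simp [Matrix.trace, Matrix.mul_apply, Fin.sum_univ_succ (n := 3)]
    rw [h6]
    simp; ring
  rw [h1]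
  congr 2
  linarith

theorem SyncEinstein.raychaudhuri (hΩ : IsOpen Ω) (hs : ∀ y, (h y)ᵀ = h y)
    (h0 : ∀ y ∈ Ω, (h y).det ≠ 0) (hq : q ∈ Ω) (hE : SyncEinstein h ρ Λ q) :
    (pderivMat 0 (expMixed h) q).trace
      = -(expMixed h q * expMixed h q).trace - ρ q / 2 + Λ := by
  have h1 := congrFun (congrFun (hE.ricci_eq (h0 q hq)) 0) 0
  rw [ricci_sync_zero_zero hΩ hs h0 hq] at h1
  simp [syncMetric] at h1
  linarith

/-- The time-space components have no source: the dust is comoving and the metric has no time-space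
components. -/
theorem SyncEinstein.momentum (hΩ : IsOpen Ω) (hs : ∀ y, (h y)ᵀ = h y)
    (h0 : ∀ y ∈ Ω, (h y).det ≠ 0) (hq : q ∈ Ω) (hE : SyncEinstein h ρ Λ q) :
    MomentumConstraint h q := by
  intro j
  have h1 := congrFun (congrFun (hE.ricci_eq (h0 q hq)) 0) j.succ
  rw [ricci_sync_zero_succ hΩ hs h0 hq] at h1
  rw [h1]; simp [syncMetric]

/-- The evolution equation of the mixed expansion tensor. -/
theorem SyncEinstein.evolution (hΩ : IsOpen Ω) (hh : SmoothMatOn h Ω) (hs : ∀ y, (h y)ᵀ = h y)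
    (h0 : ∀ y ∈ Ω, (h y).det ≠ 0) (hq : q ∈ Ω) (hE : SyncEinstein h ρ Λ q) :
    pderivMat 0 (expMixed h) q = (ρ q / 2 + Λ) • (1 : Matrix (Fin 3) (Fin 3) ℝ)
      - (expMixed h q).trace • expMixed h q - (h q)⁻¹ * spatialRicci h q := by
  have hu := isUnit_iff_ne_zero.2 (h0 q hq)
  have h1 : spatialRicci h q + pderivMat 0 (expLow h) q + (expMixed h q).trace • expLow h q
      - (2 : ℝ) • (expLow h q * expMixed h q) = (ρ q / 2 + Λ) • h q := by
    ext i j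
    have h1 := congrFun (congrFun (hE.ricci_eq (h0 q hq)) i.succ) j.succ
    rw [ricci_sync_succ_succ hΩ hs h0 hq] at h1
    have h2 : ∑ l, expLow h q j l * expMixed h q l i = (expLow h q * expMixed h q) i j := by
      have hLs := fun a b => expLow_symm (q := q) hs a b
      have hHs := inv_symm (hs q)
      simp only [expMixed, Matrix.mul_apply, Fin.sum_univ_three]
      simp only [hLs 0 i, hLs 1 i, hLs 2 i, hLs j 0, hLs j 1, hLs j 2, hHs 1 0, hHs 2 0, hHs 2 1]
      ring
    have h3 : ∑ l, expMixed h q l j * expLow h q i l = (expLow h q * expMixed h q) i j := by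
      simp only [Matrix.mul_apply, mul_comm]
    rw [h2, h3] at h1
    simp only [syncMetric, Matrix.add_apply, Matrix.smul_apply, smul_eq_mul, blk_succ_succ,
      Matrix.zero_apply, mul_zero, add_zero] at h1
    simp only [Matrix.add_apply, Matrix.sub_apply, Matrix.smul_apply, smul_eq_mul]
    linarith
  have h2 : pderivMat 0 (expMixed h) q = -(2 : ℝ) • (expMixed h q * expMixed h q)
      + (h q)⁻¹ * pderivMat 0 (expLow h) q := by
    have := pderivMat_mul 0 ((hh.inv h0).differentiableAt hΩ hq)
      ((hh.expLow hΩ).differentiableAt hΩ hq)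
    rw [show expMixed h = fun y => (h y)⁻¹ * expLow h y from rfl, this, pderiv_zero_inv hΩ hh h0 hq,
      expMixed]
    simp [mul_assoc]
  have h3 := congrArg (fun X => (h q)⁻¹ * X) h1
  simp only [mul_add, mul_sub, Matrix.mul_smul, Matrix.nonsing_inv_mul _ hu, ← mul_assoc] at h3
  rw [show (h q)⁻¹ * expLow h q = expMixed h q from rfl] at h3
  rw [h2, ← h3, neg_smul]
  abel

/-- The Hamiltonian constraint. -/
theorem SyncEinstein.hamiltonian (hΩ : IsOpen Ω) (hh : SmoothMatOn h Ω) (hs : ∀ y, (h y)ᵀ = h y)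
    (h0 : ∀ y ∈ Ω, (h y).det ≠ 0) (hq : q ∈ Ω) (hE : SyncEinstein h ρ Λ q) :
    ((h q)⁻¹ * spatialRicci h q).trace + (expMixed h q).trace ^ 2
      - (expMixed h q * expMixed h q).trace = 2 * ρ q + 2 * Λ := by
  -- The trace of the evolution equation and the Raychaudhuri equation both give `∂ₜΘ`; equating
  -- them leaves a relation without time derivatives.
  have h1 := congrArg Matrix.trace (hE.evolution hΩ hh hs h0 hq)
  rw [hE.raychaudhuri hΩ hs h0 hq] at h1
  simp only [Matrix.trace_sub, Matrix.trace_smul, Matrix.trace_one, smul_eq_mul,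
    Fintype.card_fin] at h1
  push_cast at h1
  linarith

theorem smoothMatOn_spatialRicci (hΩ : IsOpen Ω) (hh : SmoothMatOn h Ω)
    (h0 : ∀ y ∈ Ω, (h y).det ≠ 0) : SmoothMatOn (spatialRicci h) Ω := by
  have hc := contDiffOn_spatialChristoffel hΩ hh h0
  intro i j
  refine (ContDiffOn.sum fun k _ => (contDiffOn_pderiv hΩ (hc _ _ _) _).sub
    (contDiffOn_pderiv hΩ (hc _ _ _) _)).add (ContDiffOn.sum fun k _ => ContDiffOn.sum fun l _ =>
      ((hc _ _ _).mul (hc _ _ _)).sub ((hc _ _ _).mul (hc _ _ _)))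

/-- The evolution of the scalar curvature of the leaves. -/
theorem pderiv_zero_spatialScalar (hΩ : IsOpen Ω) (hh : SmoothMatOn h Ω) (hs : ∀ y, (h y)ᵀ = h y)
    (h0 : ∀ y ∈ Ω, (h y).det ≠ 0) (hq : q ∈ Ω) (hE : ∀ y ∈ Ω, SyncEinstein h ρ Λ y) :
    pderiv 0 (fun y => ((h y)⁻¹ * spatialRicci h y).trace) q
      = -2 * ((h q)⁻¹ * spatialRicci h q * expMixed h q).trace := by
  have hi := (hh.inv h0).differentiableAt hΩ hq
  have hr := (smoothMatOn_spatialRicci hΩ hh h0).differentiableAt hΩ hq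
  have hm := fun y hy => (hE y hy).momentum hΩ hs h0 hy
  rw [pderiv_trace _ (((hh.inv h0).mul (smoothMatOn_spatialRicci hΩ hh h0)).differentiableAt hΩ hq),
    pderivMat_mul _ hi hr, pderiv_zero_inv hΩ hh h0 hq, Matrix.trace_add]
  -- By the Palatini argument the derivative of `ℛᵢⱼ` has no trace, so only the derivative of the
  -- inverse metric contributes.
  have h1 : ((h q)⁻¹ * pderivMat 0 (spatialRicci h) q).trace = 0 := by
    rw [← contracted_pderiv_zero_spatialRicci hΩ hh hs h0 hq hm]
    have hHs := inv_symm (hs q)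
    simp only [Matrix.trace, Matrix.diag, Matrix.mul_apply, pderivMat, Matrix.of_apply]
    rw [Finset.sum_comm]
    exact Finset.sum_congr rfl fun i _ => Finset.sum_congr rfl fun j _ => by rw [hHs]
  rw [h1, add_zero, neg_smul, neg_mul, Matrix.trace_neg, Matrix.smul_mul, Matrix.trace_smul,
    mul_assoc, Matrix.trace_mul_comm]
  simp

end DustEquations

/-! ### Smoothness of metric components pulled back along a map. -/

section SmoothMaps

variable {M : Type*} [TopologicalSpace M] [ChartedSpace (Coord 4) M] [IsManifold (𝓡 4) ∞ M]
  {n : ℕ} {Ω : Set (Coord n)} {φ : Coord n → M}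

theorem contMDiffOn_mfderiv_const (hΩ : IsOpen Ω) (hφ : ContMDiffOn (𝓡 n) (𝓡 4) ∞ φ Ω)
    (v : Coord n) :
    ContMDiffOn (𝓡 n) (𝓡 4).tangent ∞
      (fun x => (⟨φ x, mfderiv (𝓡 n) (𝓡 4) φ x v⟩ : TangentBundle (𝓡 4) M)) Ω := by
  have h1 := hφ.contMDiffOn_tangentMapWithin (m := ∞) le_rfl hΩ.uniqueMDiffOn
  have h2 : ContMDiffOn (𝓡 n) (𝓡 n).tangent ∞
      (fun x => (⟨x, v⟩ : TangentBundle (𝓡 n) (Coord n))) Ω :=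
    contMDiffOn_vectorSpace_iff_contDiffOn.2 contDiffOn_const
  refine (h1.comp h2 fun x hx => hx).congr fun x hx => ?_
  simp only [Function.comp, tangentMapWithin, mfderivWithin_of_isOpen hΩ hx]

theorem LorentzMetric.contDiffOn_apply (g : LorentzMetric M)
    {v w : ∀ x : Coord n, TangentSpace (𝓡 4) (φ x)}
    (hφ : ContMDiffOn (𝓡 n) (𝓡 4) ∞ φ Ω)
    (hv : ContMDiffOn (𝓡 n) (𝓡 4).tangent ∞ (fun x => (⟨φ x, v x⟩ : TangentBundle (𝓡 4) M)) Ω)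
    (hw : ContMDiffOn (𝓡 n) (𝓡 4).tangent ∞ (fun x => (⟨φ x, w x⟩ : TangentBundle (𝓡 4) M)) Ω) :
    ContDiffOn ℝ ∞ (fun x => g.val (φ x) (v x) (w x)) Ω := by
  rw [← contMDiffOn_iff_contDiffOn]
  have : ContMDiffOn (𝓡 n) ((𝓡 4).prod 𝓘(ℝ)) ∞
      (fun m ↦ Bundle.TotalSpace.mk' ℝ (E := Bundle.Trivial M ℝ) (φ m) (g.val (φ m) (v m) (w m))) Ω := by
    apply ContMDiffOn.clm_bundle_apply₂ (F₁ := Coord 4) (F₂ := Coord 4)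
    · exact g.contMDiff.comp_contMDiffOn hφ
    · exact hv
    · exact hw
  intro x hx
  have h1 := this x hx
  simp only [Bundle.contMDiffWithinAt_totalSpace] at h1
  exact h1.2

theorem LorentzMetric.smoothMatOn_components (g : LorentzMetric M) (hΩ : IsOpen Ω)
    (hφ : ContMDiffOn (𝓡 n) (𝓡 4) ∞ φ Ω) : SmoothMatOn (g.components φ) Ω :=
  fun _ _ => g.contDiffOn_apply hφ (contMDiffOn_mfderiv_const hΩ hφ _)
    (contMDiffOn_mfderiv_const hΩ hφ _)

theorem LorentzMetric.components_symm (g : LorentzMetric M) (φ : Coord n → M) (x : Coord n) :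
    (g.components φ x)ᵀ = g.components φ x := by
  ext i j; exact g.symm _ _ _

theorem LorentzMetric.components_congr (g : LorentzMetric M) {ψ : Coord n → M} {x : Coord n}
    (h : φ =ᶠ[nhds x] ψ) : g.components φ x = g.components ψ x := by
  ext i j
  have h1 : φ x = ψ x := h.eq_of_nhds
  simp only [LorentzMetric.components, Matrix.of_apply, h.mfderiv_eq]
  congr 3

end SmoothMaps

/-- The projection to the spatial coordinates as a linear map. -/
def spatialProj : Coord 4 →L[ℝ] Coord 3 :=
  LinearMap.toContinuousLinearMap
    { toFun := spatial
      map_add' := fun y z => by ext i; simp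
      map_smul' := fun c z => by ext i; simp }

theorem hasFDerivAt_spatial (q : Coord 4) : HasFDerivAt spatial spatialProj q :=
  spatialProj.hasFDerivAt

/-- The time coordinate as a linear map. -/
def timeProj : Coord 4 →L[ℝ] ℝ := EuclideanSpace.proj 0

/-! ### Comoving coordinates as charts of the spacetime. -/

namespace DustSpacetime

variable {M : Type*} [TopologicalSpace M] [ChartedSpace (Coord 4) M] [IsManifold (𝓡 4) ∞ M]
  {S : Type*} [TopologicalSpace S] [ChartedSpace (Coord 3) S] [IsManifold (𝓡 3) ∞ S]
  (W : DustSpacetime M S) {e : OpenPartialHomeomorph S (Coord 3)}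

/-- Comoving coordinates adapted to the flow. -/
def adapted (e : OpenPartialHomeomorph S (Coord 3)) (q : Coord 4) : M :=
  W.Φ (q 0) (e.symm (spatial q))

/-- The domain of the comoving coordinates. -/
def adaptedDomain (e : OpenPartialHomeomorph S (Coord 3)) : Set (Coord 4) :=
  {q | q 0 ∈ W.I ∧ spatial q ∈ e.target}

theorem isOpen_adaptedDomain (e : OpenPartialHomeomorph S (Coord 3)) :
    IsOpen (W.adaptedDomain e) :=
  (W.isOpen_I.preimage timeProj.continuous).inter
    (e.open_target.preimage contDiff_spatial.continuous)

theorem joinCoord_mem_adaptedDomain {t : ℝ} {y : Coord 3} (ht : t ∈ W.I) (hy : y ∈ e.target) :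
    joinCoord t y ∈ W.adaptedDomain e := ⟨ht, hy⟩

theorem contMDiffOn_chartSymm_spatial (he : e ∈ atlas (Coord 3) S) :
    ContMDiffOn (𝓡 4) (𝓘(ℝ, ℝ).prod (𝓡 3)) ∞ (fun q : Coord 4 => (q 0, e.symm (spatial q)))
      (W.adaptedDomain e) := by
  have h1 : ContMDiffOn (𝓡 3) (𝓡 3) ∞ e.symm e.target :=
    contMDiffOn_symm_of_mem_maximalAtlas (IsManifold.subset_maximalAtlas he)
  have h2 : ContMDiff (𝓡 4) (𝓡 3) ∞ spatial := contDiff_spatial.contMDiff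
  have h3 : ContMDiff (𝓡 4) 𝓘(ℝ, ℝ) ∞ (fun q : Coord 4 => q 0) := timeProj.contDiff.contMDiff
  exact h3.contMDiffOn.prodMk (h1.comp h2.contMDiffOn fun q hq => hq.2)

theorem contMDiffOn_adapted (he : e ∈ atlas (Coord 3) S) :
    ContMDiffOn (𝓡 4) (𝓡 4) ∞ (W.adapted e) (W.adaptedDomain e) :=
  W.contMDiffOn_Φ.comp (W.contMDiffOn_chartSymm_spatial he) fun _ hq => ⟨hq.1, mem_univ _⟩

theorem mdifferentiableAt_adapted (he : e ∈ atlas (Coord 3) S) {q : Coord 4}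
    (hq : q ∈ W.adaptedDomain e) : MDifferentiableAt (𝓡 4) (𝓡 4) (W.adapted e) q :=
  ((W.contMDiffOn_adapted he).contMDiffAt ((W.isOpen_adaptedDomain e).mem_nhds hq)).mdifferentiableAt
    (by simp)

/-- At a fixed point of the leaf, the time coordinate line is a flow line, that is, an integral
curve of `u`. -/
theorem mfderiv_adapted_zero (he : e ∈ atlas (Coord 3) S) {q : Coord 4}
    (hq : q ∈ W.adaptedDomain e) :
    mfderiv (𝓡 4) (𝓡 4) (W.adapted e) q (basisVec 0) = W.u (W.adapted e q) := by
  obtain ⟨t, y, rfl⟩ : ∃ t y, q = joinCoord t y := ⟨_, _, (joinCoord_spatial q).symm⟩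
  have h1 : HasMFDerivAt 𝓘(ℝ, ℝ) (𝓡 4) (fun s => W.Φ s (e.symm y)) t
      ((1 : ℝ →L[ℝ] ℝ).smulRight (W.u (W.Φ t (e.symm y)))) :=
    (W.isMIntegralCurveOn_Φ (e.symm y) t hq.1).hasMFDerivAt (W.isOpen_I.mem_nhds hq.1)
  have h2 : HasMFDerivAt 𝓘(ℝ, ℝ) (𝓡 4) (fun s => joinCoord s y) t
      (ContinuousLinearMap.toSpanSingleton ℝ (basisVec 0)) :=
    (hasDerivAt_joinCoord_left t y).hasFDerivAt.hasMFDerivAt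
  have h3 := (W.mdifferentiableAt_adapted he hq).hasMFDerivAt.comp t h2
  have h4 := hasMFDerivAt_unique h3 h1
  have h5 : mfderiv (𝓡 4) (𝓡 4) (W.adapted e) (joinCoord t y) ((1 : ℝ) • basisVec 0)
      = (1 : ℝ) • W.u (W.adapted e (joinCoord t y)) :=
    congrArg (fun L : ℝ →L[ℝ] Coord 4 => L 1) h4
  have h6 : (1 : ℝ) • (basisVec 0 : Coord 4) = basisVec 0 := one_smul _ _
  rw [h6] at h5
  exact h5.trans (one_smul ℝ _)

theorem mfderiv_leaf (he : e ∈ atlas (Coord 3) S) {t : ℝ} {y : Coord 3}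
    (hq : joinCoord t y ∈ W.adaptedDomain e) (v : Coord 3) :
    mfderiv (𝓡 3) (𝓡 4) (fun z => W.Φ t (e.symm z)) y v
      = mfderiv (𝓡 4) (𝓡 4) (W.adapted e) (joinCoord t y) (spatialIncl v) := by
  have h2 : HasMFDerivAt (𝓡 3) (𝓡 4) (fun z => joinCoord t z) y spatialIncl :=
    (hasFDerivAt_joinCoord_right t y).hasMFDerivAt
  have h3 := (W.mdifferentiableAt_adapted he hq).hasMFDerivAt.comp y h2
  have h4 : (W.adapted e ∘ fun z => joinCoord t z) = fun z => W.Φ t (e.symm z) := rfl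
  rw [h4] at h3
  rw [h3.mfderiv]; rfl

/-- The coordinates factor through `ℝ × S`. The first factor `r` has injective derivative because
the time component and the chart `e` recover all four coordinates from it; the second is the flow,
an immersion by hypothesis. -/
theorem injective_mfderiv_adapted (he : e ∈ atlas (Coord 3) S) {q : Coord 4}
    (hq : q ∈ W.adaptedDomain e) :
    Function.Injective (mfderiv (𝓡 4) (𝓡 4) (W.adapted e) q) := by
  set r : Coord 4 → ℝ × S := fun q => (q 0, e.symm (spatial q)) with hr
  have hn := (W.isOpen_adaptedDomain e).mem_nhds hq
  have h1 : MDifferentiableAt (𝓡 4) (𝓘(ℝ, ℝ).prod (𝓡 3)) r q :=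
    ((W.contMDiffOn_chartSymm_spatial he).contMDiffAt hn).mdifferentiableAt (by simp)
  have h2 : MDifferentiableAt (𝓘(ℝ, ℝ).prod (𝓡 3)) (𝓡 4) (fun q : ℝ × S => W.Φ q.1 q.2) (r q) :=
    (W.contMDiffOn_Φ.contMDiffAt ((W.isOpen_I.prod isOpen_univ).mem_nhds
      ⟨hq.1, mem_univ _⟩)).mdifferentiableAt (by simp)
  have h3 : mfderiv (𝓡 4) (𝓡 4) (W.adapted e) q
      = (mfderiv (𝓘(ℝ, ℝ).prod (𝓡 3)) (𝓡 4) (fun q : ℝ × S => W.Φ q.1 q.2) (r q)).comp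
        (mfderiv (𝓡 4) (𝓘(ℝ, ℝ).prod (𝓡 3)) r q) :=
    (h2.hasMFDerivAt.comp q h1.hasMFDerivAt).mfderiv
  have h4 : Function.Injective (mfderiv (𝓡 4) (𝓘(ℝ, ℝ).prod (𝓡 3)) r q) := by
    have h5 : HasMFDerivAt (𝓡 4) 𝓘(ℝ, ℝ) (fun q => (r q).1) q
        ((ContinuousLinearMap.fst ℝ ℝ (Coord 3)).comp
          (mfderiv (𝓡 4) (𝓘(ℝ, ℝ).prod (𝓡 3)) r q)) :=
      (hasMFDerivAt_fst (r q)).comp q h1.hasMFDerivAt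
    have h6 : HasMFDerivAt (𝓡 4) 𝓘(ℝ, ℝ) (fun q => (r q).1) q timeProj :=
      timeProj.hasFDerivAt.hasMFDerivAt
    have h7 := hasMFDerivAt_unique h5 h6
    have hes : e.symm (spatial q) ∈ e.source := e.map_target hq.2
    have h8 : MDifferentiableAt (𝓡 3) (𝓡 3) e (r q).2 :=
        (contMDiffAt_of_mem_maximalAtlas (n := ∞) (IsManifold.subset_maximalAtlas he) hes).mdifferentiableAt
        (by simp)
    have h9 : HasMFDerivAt (𝓡 4) (𝓡 3) (fun q => e (r q).2) q
        ((mfderiv (𝓡 3) (𝓡 3) e (r q).2).comp ((ContinuousLinearMap.snd ℝ ℝ (Coord 3)).comp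
          (mfderiv (𝓡 4) (𝓘(ℝ, ℝ).prod (𝓡 3)) r q))) :=
      h8.hasMFDerivAt.comp q ((hasMFDerivAt_snd (r q)).comp q h1.hasMFDerivAt)
    have h10 : HasMFDerivAt (𝓡 4) (𝓡 3) (fun q => e (r q).2) q spatialProj := by
      refine (hasFDerivAt_spatial q).hasMFDerivAt.congr_of_eventuallyEq ?_
      filter_upwards [hn] with p hp
      exact e.right_inv hp.2
    have h11 := hasMFDerivAt_unique h9 h10
    rw [injective_iff_map_eq_zero]
    intro (v : Coord 4) hv
    have e1 : timeProj v = 0 := by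
      rw [← h7]
      show (mfderiv (𝓡 4) (𝓘(ℝ, ℝ).prod (𝓡 3)) r q v).1 = 0
      rw [hv]; rfl
    have e2 : spatialProj v = 0 := by
      rw [← h11]
      show mfderiv (𝓡 3) (𝓡 3) e (r q).2 (mfderiv (𝓡 4) (𝓘(ℝ, ℝ).prod (𝓡 3)) r q v).2 = 0
      rw [hv]; exact map_zero _
    have e3 := joinCoord_spatial v
    rw [show v 0 = 0 from e1, show spatial v = 0 from e2] at e3
    show v = 0
    rw [← e3]
    ext i; refine Fin.cases ?_ (fun j => ?_) i <;> simp
  rw [h3]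
  exact (W.immersion_Φ _ hq.1 _).comp h4

/-- The comoving coordinates are, locally, charts of the spacetime. -/
theorem exists_adapted_chart (he : e ∈ atlas (Coord 3) S) {q : Coord 4}
    (hq : q ∈ W.adaptedDomain e) :
    ∃ E ∈ IsManifold.maximalAtlas (𝓡 4) ∞ M, q ∈ E.target ∧ E.target ⊆ W.adaptedDomain e ∧
      EqOn E.symm (W.adapted e) E.target := by
  set c := chartAt (Coord 4) (W.adapted e q) with hc
  set Ω := W.adaptedDomain e ∩ W.adapted e ⁻¹' c.source with hΩ
  have hcm : c ∈ IsManifold.maximalAtlas (𝓡 4) ∞ M := IsManifold.chart_mem_maximalAtlas _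
  have hsm := W.contMDiffOn_adapted he
  have hΩo : IsOpen Ω :=
    hsm.continuousOn.isOpen_inter_preimage (W.isOpen_adaptedDomain e) c.open_source
  have hqΩ : q ∈ Ω := ⟨hq, mem_chart_source _ _⟩
  set F : Coord 4 → Coord 4 := fun p => c (W.adapted e p) with hF
  have hFs : ContDiffOn ℝ ∞ F Ω := contMDiffOn_iff_contDiffOn.1
    ((contMDiffOn_of_mem_maximalAtlas hcm).comp (hsm.mono inter_subset_left) fun p hp => hp.2)
  have hFd : ∀ p ∈ Ω, ∃ L : Coord 4 ≃L[ℝ] Coord 4, HasFDerivAt F (L : Coord 4 →L[ℝ] Coord 4) p := by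
    intro p hp
    have h1 := ((contMDiffAt_of_mem_maximalAtlas hcm hp.2).mdifferentiableAt (by simp)).hasMFDerivAt.comp p
      (W.mdifferentiableAt_adapted he hp.1).hasMFDerivAt
    obtain ⟨G, hG, hGi⟩ : ∃ G : Coord 4 →L[ℝ] Coord 4, HasFDerivAt F G p ∧ Function.Injective G :=
      ⟨_, h1.hasFDerivAt, fun v w hvw => W.injective_mfderiv_adapted he hp.1
        ((mdifferentiable_chart (I := 𝓡 4) (W.adapted e q)).mfderiv_injective hp.2 hvw)⟩
    exact ⟨(LinearEquiv.ofInjectiveEndo (G : Coord 4 →ₗ[ℝ] Coord 4) hGi).toContinuousLinearEquiv, hG⟩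
  obtain ⟨L, hL⟩ := hFd q hqΩ
  have hFat : ∀ p ∈ Ω, ContDiffAt ℝ ∞ F p := fun p hp => hFs.contDiffAt (hΩo.mem_nhds hp)
  -- The inverse function theorem at `q`. Restricting to `Ω` keeps the derivative of `F` invertible
  -- on the whole source, which makes the inverse smooth on the whole target.
  set f := ((hFat q hqΩ).toOpenPartialHomeomorph F hL (by simp)).restrOpen Ω hΩo with hf
  have hfF : ∀ p, f p = F p := fun p => rfl
  have hfs : f.source ⊆ Ω := fun p hp => hp.2
  have hqf : q ∈ f.source :=
    ⟨(hFat q hqΩ).mem_toOpenPartialHomeomorph_source hL (by simp), hqΩ⟩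
  have hfsymm : ContDiffOn ℝ ∞ f.symm f.target := by
    intro p hp
    have hp' := hfs (f.map_target hp)
    obtain ⟨L', hL'⟩ := hFd _ hp'
    exact (f.contDiffAt_symm hp hL' (hFat _ hp')).contDiffWithinAt
  -- The chart `c` followed by the local inverse of the comoving coordinates read in `c`. The
  -- geodesic and Einstein equations are assumed in every chart of the maximal atlas, hence in `E`.
  set E := c.trans f.symm with hE
  have hEt : ∀ p ∈ E.target, p ∈ f.source := by
    intro p hp
    simp only [hE, OpenPartialHomeomorph.trans_target, OpenPartialHomeomorph.symm_target] at hp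
    exact hp.1
  have hEeq : EqOn E.symm (W.adapted e) E.target := by
    intro p hp
    show c.symm (f p) = _
    rw [hfF]
    exact c.left_inv (hfs (hEt p hp)).2
  refine ⟨E, E.mem_maximalAtlas_of_contMDiffOn ?_ ?_, ?_, fun p hp => (hfs (hEt p hp)).1, hEeq⟩
  · refine (contMDiffOn_iff_contDiffOn.2 hfsymm).comp
      ((contMDiffOn_of_mem_maximalAtlas hcm).mono ?_) ?_
    · intro p hp; exact hp.1
    · intro p hp; exact hp.2
  · exact (hsm.mono fun p hp => (hfs (hEt p hp)).1).congr hEeq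
  · simp only [hE, OpenPartialHomeomorph.trans_target, OpenPartialHomeomorph.symm_target]
    exact ⟨hqf, c.map_source (mem_chart_source _ _)⟩

end DustSpacetime

/-! ### Linear algebra of Lorentzian forms -/

theorem sum_smul_basisVec {n : ℕ} (a : Coord n) : ∑ i, a i • (basisVec i : Coord n) = a := by
  ext k; simp [basisVec, Finset.sum_apply, Pi.single_apply]

theorem bilin_expand {n : ℕ} {E : Type*} [NormedAddCommGroup E] [NormedSpace ℝ E]
    (B : E →L[ℝ] E →L[ℝ] ℝ) (L : Coord n →L[ℝ] E) (a b : Coord n) :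
    B (L a) (L b) = ∑ i, ∑ j, a i * b j * B (L (basisVec i)) (L (basisVec j)) := by
  conv_lhs => rw [← sum_smul_basisVec a, ← sum_smul_basisVec b]
  simp only [map_sum, map_smul, sum_apply, smul_apply, smul_eq_mul, Finset.mul_sum]
  rw [Finset.sum_comm]
  refine Finset.sum_congr rfl fun i _ => Finset.sum_congr rfl fun j _ => by ring

/-- The orthogonal complement of a unit timelike vector is spacelike. -/
theorem spacelike_of_orthogonal {E : Type*} [NormedAddCommGroup E] [NormedSpace ℝ E]
    (B : E →L[ℝ] E →L[ℝ] ℝ) (hs : ∀ v w, B v w = B w v)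
    (hl : ∃ v, B v v < 0 ∧ ∀ w, w ≠ 0 → B v w = 0 → 0 < B w w) {u w : E} (hu : B u u = -1)
    (huw : B u w = 0) (hw : w ≠ 0) : 0 < B w w := by
  obtain ⟨v, -, hv⟩ := hl
  by_contra hneg
  have hwu : B w u = 0 := by rw [hs, huw]
  -- The combination of `u` and `w` that is orthogonal to the reference timelike vector `v`. Were it
  -- nonzero it would be spacelike, but if `B w w ≤ 0` then its square `-(B v w)² + (B v u)² B w w`
  -- is not positive.
  set z := B v w • u - B v u • w with hz
  have hz0 : z = 0 := by
    by_contra hz0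
    have h1 := hv z hz0 (by simp [hz]; ring)
    have h2 : B z z = -(B v w) ^ 2 + (B v u) ^ 2 * B w w := by
      simp [hz, hu, huw, hwu]; ring
    have h3 : (B v u) ^ 2 * B w w ≤ 0 := mul_nonpos_of_nonneg_of_nonpos (sq_nonneg _) (not_lt.1 hneg)
    nlinarith [sq_nonneg (B v w)]
  have h1 : B u z = -B v w := by simp [hz, hu, huw]
  have h2 : B v w = 0 := by rw [hz0] at h1; simpa using h1.symm
  exact hneg (hv w hw h2)

/-- A Lorentzian form is nondegenerate. -/
theorem eq_zero_of_lorentzian {E : Type*} [NormedAddCommGroup E] [NormedSpace ℝ E]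
    (B : E →L[ℝ] E →L[ℝ] ℝ) (hs : ∀ v w, B v w = B w v)
    (hl : ∃ v, B v v < 0 ∧ ∀ w, w ≠ 0 → B v w = 0 → 0 < B w w) {w : E} (h : ∀ z, B w z = 0) :
    w = 0 := by
  obtain ⟨v, -, hv⟩ := hl
  by_contra hw
  exact (hv w hw (by rw [hs, h])).ne' (h w)

/-- A kernel vector of the Gram matrix is mapped by `L` to a vector orthogonal to the image of `L`.
An injective `L` is onto, so nondegeneracy makes that vector zero. -/
theorem det_gram_ne_zero (B : Coord 4 →L[ℝ] Coord 4 →L[ℝ] ℝ) (hs : ∀ v w, B v w = B w v)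
    (hl : ∃ v, B v v < 0 ∧ ∀ w, w ≠ 0 → B v w = 0 → 0 < B w w) (L : Coord 4 →L[ℝ] Coord 4)
    (hL : Function.Injective L) :
    (Matrix.of fun i j => B (L (basisVec i)) (L (basisVec j))).det ≠ 0 := by
  intro h0
  obtain ⟨a, ha, h1⟩ := Matrix.exists_mulVec_eq_zero_iff.2 h0
  have hsurj : Function.Surjective L :=
    (LinearMap.injective_iff_surjective (f := (L : Coord 4 →ₗ[ℝ] Coord 4))).1 hL
  have h2 : L (WithLp.toLp 2 a) = 0 := by
    refine eq_zero_of_lorentzian B hs hl fun z => ?_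
    obtain ⟨b, rfl⟩ := hsurj z
    rw [hs, bilin_expand]
    refine Finset.sum_eq_zero fun i _ => ?_
    have := congrFun h1 i
    simp only [Matrix.mulVec, dotProduct, Matrix.of_apply, Pi.zero_apply] at this
    simp only [mul_assoc, ← Finset.mul_sum]
    rw [show ∑ j, a j * B (L (basisVec i)) (L (basisVec j)) = 0 by simpa [mul_comm] using this]
    simp
  have h3 : (WithLp.toLp 2 a : Coord 4) = 0 := hL (by rw [h2, map_zero])
  exact ha (by funext i; simpa using congrArg (fun x : Coord 4 => x i) h3)

/-! ### Locality of the curvature in coordinates -/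

section Locality

variable {n : ℕ} {G G' : Coord n → Matrix (Fin n) (Fin n) ℝ} {x : Coord n}

theorem christoffel_congr (h : G =ᶠ[nhds x] G') (k i j : Fin n) :
    christoffel G k i j =ᶠ[nhds x] christoffel G' k i j := by
  filter_upwards [h.eventuallyEq_nhds] with y hy
  have h1 : ∀ a b, (fun z => G z a b) =ᶠ[nhds y] fun z => G' z a b := fun a b =>
    hy.mono fun z hz => by simp only [hz]
  simp only [christoffel, pderiv_congr _ (h1 _ _), hy.eq_of_nhds]

theorem ricci_congr (h : G =ᶠ[nhds x] G') : ricci G x = ricci G' x := by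
  ext i j
  simp only [ricci, Matrix.of_apply, pderiv_congr _ (christoffel_congr h _ _ _),
    (christoffel_congr h _ _ _).eq_of_nhds]

theorem scalarCurv_congr (h : G =ᶠ[nhds x] G') : scalarCurv G x = scalarCurv G' x := by
  simp only [scalarCurv, ricciMixed, ricci_congr h, h.eq_of_nhds]

end Locality

/-! ### The metric is synchronous in comoving coordinates. -/

namespace DustSpacetime

variable {M : Type*} [TopologicalSpace M] [ChartedSpace (Coord 4) M] [IsManifold (𝓡 4) ∞ M]
  {S : Type*} [TopologicalSpace S] [ChartedSpace (Coord 3) S] [IsManifold (𝓡 3) ∞ S]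
  (W : DustSpacetime M S) {e : OpenPartialHomeomorph S (Coord 3)}

/-- The spacetime metric in comoving coordinates. -/
def adaptedMetric (e : OpenPartialHomeomorph S (Coord 3)) (q : Coord 4) :
    Matrix (Fin 4) (Fin 4) ℝ := W.g.components (W.adapted e) q

/-- The metric of the leaves as a function on `ℝ⁴`. -/
def leafMetric' (e : OpenPartialHomeomorph S (Coord 3)) (q : Coord 4) :
    Matrix (Fin 3) (Fin 3) ℝ := W.leafMetric e (q 0) (spatial q)

theorem adaptedMetric_zero_zero (he : e ∈ atlas (Coord 3) S) {q : Coord 4}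
    (hq : q ∈ W.adaptedDomain e) : W.adaptedMetric e q 0 0 = -1 := by
  simp only [adaptedMetric, LorentzMetric.components, Matrix.of_apply, W.mfderiv_adapted_zero he hq]
  exact W.unit _

theorem adaptedMetric_zero_left (he : e ∈ atlas (Coord 3) S) {q : Coord 4}
    (hq : q ∈ W.adaptedDomain e) (i : Fin 4) : W.adaptedMetric e q 0 i
      = W.g.val (W.adapted e q) (W.u (W.adapted e q))
        (mfderiv (𝓡 4) (𝓡 4) (W.adapted e) q (basisVec i)) := by
  simp only [adaptedMetric, LorentzMetric.components, Matrix.of_apply, W.mfderiv_adapted_zero he hq]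

theorem adaptedMetric_succ_succ (he : e ∈ atlas (Coord 3) S) {q : Coord 4}
    (hq : q ∈ W.adaptedDomain e) (i j : Fin 3) :
    W.adaptedMetric e q i.succ j.succ = W.leafMetric' e q i j := by
  obtain ⟨t, y, rfl⟩ : ∃ t y, q = joinCoord t y := ⟨_, _, (joinCoord_spatial q).symm⟩
  have h1 := W.mfderiv_leaf he hq (basisVec i)
  have h2 := W.mfderiv_leaf he hq (basisVec j)
  rw [spatialIncl_basisVec] at h1 h2
  exact (congrArg₂ (fun v w : Coord 4 => W.g.val (W.adapted e (joinCoord t y)) v w) h1 h2).symm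

theorem smoothMatOn_adaptedMetric (he : e ∈ atlas (Coord 3) S) :
    SmoothMatOn (W.adaptedMetric e) (W.adaptedDomain e) :=
  W.g.smoothMatOn_components (W.isOpen_adaptedDomain e) (W.contMDiffOn_adapted he)

theorem smoothMatOn_leafMetric (he : e ∈ atlas (Coord 3) S) :
    SmoothMatOn (W.leafMetric' e) (W.adaptedDomain e) := fun i j =>
  (W.smoothMatOn_adaptedMetric he i.succ j.succ).congr fun _ hq =>
    (W.adaptedMetric_succ_succ he hq i j).symm

theorem leafMetric_symm (q : Coord 4) : (W.leafMetric' e q)ᵀ = W.leafMetric' e q :=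
  W.g.components_symm (fun z => W.Φ (q 0) (e.symm z)) (spatial q)

theorem det_adaptedMetric_ne_zero (he : e ∈ atlas (Coord 3) S) {q : Coord 4}
    (hq : q ∈ W.adaptedDomain e) : (W.adaptedMetric e q).det ≠ 0 :=
  det_gram_ne_zero (W.g.val (W.adapted e q)) (W.g.symm _) (W.g.lorentzian _)
    (mfderiv (𝓡 4) (𝓡 4) (W.adapted e) q) (W.injective_mfderiv_adapted he hq)

theorem components_chart_eventuallyEq {E : OpenPartialHomeomorph M (Coord 4)}
    (hE : EqOn E.symm (W.adapted e) E.target) {q : Coord 4} (hq : q ∈ E.target) :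
    W.g.components E.symm =ᶠ[nhds q] W.adaptedMetric e := by
  filter_upwards [E.open_target.mem_nhds hq] with p hp
  exact W.g.components_congr (hE.eventuallyEq_of_mem (E.open_target.mem_nhds hp))

theorem mfderiv_chartSymm {E : OpenPartialHomeomorph M (Coord 4)}
    (hE : EqOn E.symm (W.adapted e) E.target) {q : Coord 4} (hq : q ∈ E.target) (v : Coord 4) :
    (mfderiv (𝓡 4) (𝓡 4) E.symm q v : Coord 4) = mfderiv (𝓡 4) (𝓡 4) (W.adapted e) q v := by
  rw [(hE.eventuallyEq_of_mem (E.open_target.mem_nhds hq)).mfderiv_eq]; rfl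

theorem vecComponents_adapted (he : e ∈ atlas (Coord 3) S) {E : OpenPartialHomeomorph M (Coord 4)}
    (hEm : E ∈ IsManifold.maximalAtlas (𝓡 4) ∞ M) (hEt : E.target ⊆ W.adaptedDomain e)
    (hE : EqOn E.symm (W.adapted e) E.target) {q : Coord 4} (hq : q ∈ E.target) (i : Fin 4) :
    vecComponents E W.u q i = if i = 0 then 1 else 0 := by
  have hEd : E.MDifferentiable (𝓡 4) (𝓡 4) :=
    ⟨(contMDiffOn_of_mem_maximalAtlas hEm).mdifferentiableOn (by simp),
      (contMDiffOn_symm_of_mem_maximalAtlas hEm).mdifferentiableOn (by simp)⟩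
  have h1 : W.u (E.symm q) = mfderiv (𝓡 4) (𝓡 4) E.symm q (basisVec 0) := by
    rw [show mfderiv (𝓡 4) (𝓡 4) E.symm q (basisVec 0) = _ from W.mfderiv_chartSymm hE hq _,
      W.mfderiv_adapted_zero he (hEt hq), hE hq]
  have h2 := congrArg (fun L : Coord 4 →L[ℝ] Coord 4 => L (basisVec 0)) (hEd.comp_symm_deriv hq)
  have h3 : (mfderiv (𝓡 4) (𝓡 4) E (E.symm q) (W.u (E.symm q)) : Coord 4) = basisVec 0 := by
    rw [h1]; exact h2
  simp only [vecComponents, h3, basisVec]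
  simp

/-- The flow lines are geodesics: `Γᵏ₀₀ = 0` in comoving coordinates. -/
theorem christoffel_adapted_zero (he : e ∈ atlas (Coord 3) S) {q : Coord 4}
    (hq : q ∈ W.adaptedDomain e) (k : Fin 4) : christoffel (W.adaptedMetric e) k 0 0 q = 0 := by
  obtain ⟨E, hEm, hqE, hEt, hE⟩ := W.exists_adapted_chart he hq
  have h1 := W.geodesic E hEm q hqE k
  have h2 : ∀ j, pderiv j (fun y => vecComponents E W.u y k) q = 0 := by
    intro j
    rw [pderiv_congr (g := fun _ => if k = 0 then 1 else 0), pderiv_const]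
    filter_upwards [E.open_target.mem_nhds hqE] with p hp
    exact W.vecComponents_adapted he hEm hEt hE hp k
  simp only [covAccel, h2, W.vecComponents_adapted he hEm hEt hE hqE,
    (christoffel_congr (W.components_chart_eventuallyEq hE hqE) _ _ _).eq_of_nhds] at h1
  simpa using h1

/-- Since `g₀₀` is constant, `Γᵏ₀₀` reduces to `gᵏᵐ ∂ₜg₀ₘ`. It vanishes along geodesics, and the
inverse metric can be cancelled. -/
theorem pderiv_zero_adaptedMetric_zero (he : e ∈ atlas (Coord 3) S) {q : Coord 4}
    (hq : q ∈ W.adaptedDomain e) (l : Fin 4) :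
    pderiv 0 (fun y => W.adaptedMetric e y 0 l) q = 0 := by
  set G := W.adaptedMetric e with hG
  have h1 : ∀ k, ∑ m, (G q)⁻¹ k m * pderiv 0 (fun y => G y m 0) q = 0 := by
    intro k
    have := W.christoffel_adapted_zero he hq k
    have h2 : ∀ m, pderiv m (fun y => G y 0 0) q = 0 := by
      intro m
      rw [pderiv_congr (g := fun _ => -1), pderiv_const]
      filter_upwards [(W.isOpen_adaptedDomain e).mem_nhds hq] with p hp
      exact W.adaptedMetric_zero_zero he hp
    simp only [christoffel, ← hG, h2, sub_zero, ← two_mul, mul_left_comm _ (2 : ℝ),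
      ← Finset.mul_sum] at this
    linarith
  have h2 : (G q)⁻¹ *ᵥ (fun m => pderiv 0 (fun y => G y m 0) q) = 0 := by
    funext k; exact h1 k
  have h3 := congrArg (fun v => G q *ᵥ v) h2
  simp only [Matrix.mulVec_mulVec, Matrix.mulVec_zero] at h3
  rw [Matrix.mul_nonsing_inv _ (isUnit_iff_ne_zero.2 (W.det_adaptedMetric_ne_zero he hq)),
    Matrix.one_mulVec] at h3
  have h4 : ∀ y, G y 0 l = G y l 0 := fun y =>
    congrFun (congrFun (W.g.components_symm (W.adapted e) y) l) 0
  simp only [h4]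
  exact congrFun h3 l

/-- The leaves are orthogonal to the four-velocity. -/
theorem adaptedMetric_zero_succ (he : e ∈ atlas (Coord 3) S) {q : Coord 4}
    (hq : q ∈ W.adaptedDomain e) (i : Fin 3) : W.adaptedMetric e q 0 i.succ = 0 := by
  obtain ⟨t, y, rfl⟩ : ∃ t y, q = joinCoord t y := ⟨_, _, (joinCoord_spatial q).symm⟩
  have hd : ∀ s ∈ W.I, HasDerivAt (fun s => W.adaptedMetric e (joinCoord s y) 0 i.succ) 0 s := by
    intro s hs
    have hs' : joinCoord s y ∈ W.adaptedDomain e := ⟨hs, hq.2⟩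
    have := hasDerivAt_joinCoord ((W.smoothMatOn_adaptedMetric he).differentiableAt
      (W.isOpen_adaptedDomain e) hs' 0 i.succ)
    rwa [W.pderiv_zero_adaptedMetric_zero he hs'] at this
  -- The component is constant along the flow line because `I` is an interval, so it suffices to
  -- evaluate it on the initial leaf.
  have h1 := W.isOpen_I.is_const_of_deriv_eq_zero W.ordConnected_I.isPreconnected
    (fun s hs => (hd s hs).differentiableAt.differentiableWithinAt) (fun s hs => (hd s hs).deriv)
    hq.1 W.zero_mem_I
  simp only [joinCoord_zero] at h1
  rw [h1]
  have h0 : joinCoord 0 y ∈ W.adaptedDomain e := ⟨W.zero_mem_I, hq.2⟩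
  rw [W.adaptedMetric_zero_left he h0, ← spatialIncl_basisVec, ← W.mfderiv_leaf he h0]
  have h2 : MDifferentiableAt (𝓡 3) (𝓡 4) (W.Φ 0) (e.symm y) := by
    have h3 : ContMDiffAt (𝓘(ℝ, ℝ).prod (𝓡 3)) (𝓡 4) ∞ (fun q : ℝ × S => W.Φ q.1 q.2)
        (0, e.symm y) :=
      W.contMDiffOn_Φ.contMDiffAt ((W.isOpen_I.prod isOpen_univ).mem_nhds ⟨W.zero_mem_I, mem_univ _⟩)
    have h4 : ContMDiffAt (𝓡 3) (𝓘(ℝ, ℝ).prod (𝓡 3)) ∞ (fun x : S => ((0 : ℝ), x)) (e.symm y) :=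
      contMDiffAt_const.prodMk contMDiffAt_id
    exact (h3.comp (e.symm y) h4).mdifferentiableAt (by simp)
  have h5 : MDifferentiableAt (𝓡 3) (𝓡 3) e.symm y :=
    ((contMDiffOn_symm_of_mem_maximalAtlas (n := ∞) (IsManifold.subset_maximalAtlas he)).contMDiffAt
      (e.open_target.mem_nhds hq.2)).mdifferentiableAt (by simp)
  have h6 := (h2.hasMFDerivAt.comp y h5.hasMFDerivAt).mfderiv
  rw [show (fun z => W.Φ 0 (e.symm z)) = W.Φ 0 ∘ e.symm from rfl, h6]
  exact W.orthogonal _ _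

theorem adaptedMetric_eq_syncMetric (he : e ∈ atlas (Coord 3) S) {q : Coord 4}
    (hq : q ∈ W.adaptedDomain e) : W.adaptedMetric e q = syncMetric (W.leafMetric' e) q := by
  ext i j
  refine Fin.cases ?_ (fun i => ?_) i <;> refine Fin.cases ?_ (fun j => ?_) j
  · simpa [syncMetric] using W.adaptedMetric_zero_zero he hq
  · simpa [syncMetric] using W.adaptedMetric_zero_succ he hq j
  · rw [show W.adaptedMetric e q i.succ 0 = W.adaptedMetric e q 0 i.succ from W.g.symm _ _ _]
    simpa [syncMetric] using W.adaptedMetric_zero_succ he hq i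
  · simpa [syncMetric] using W.adaptedMetric_succ_succ he hq i j

/-- The metric of the leaves is Riemannian. -/
theorem posDef_leafMetric (he : e ∈ atlas (Coord 3) S) {q : Coord 4}
    (hq : q ∈ W.adaptedDomain e) : (W.leafMetric' e q).PosDef := by
  refine Matrix.PosDef.of_dotProduct_mulVec_pos ?_ fun a ha => ?_
  · ext i j; exact congrFun (congrFun (W.leafMetric_symm q) i) j
  set L : Coord 4 →L[ℝ] Coord 4 := mfderiv (𝓡 4) (𝓡 4) (W.adapted e) q with hL
  set B : Coord 4 →L[ℝ] Coord 4 →L[ℝ] ℝ := W.g.val (W.adapted e q) with hB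
  set b : Coord 4 := joinCoord 0 (WithLp.toLp 2 a) with hb
  have hK : ∀ i j, B (L (basisVec i)) (L (basisVec j)) = syncMetric (W.leafMetric' e) q i j :=
    fun i j => congrFun (congrFun (W.adaptedMetric_eq_syncMetric he hq) i) j
  have h1 : star a ⬝ᵥ W.leafMetric' e q *ᵥ a = B (L b) (L b) := by
    rw [bilin_expand]
    simp only [hK, Fin.sum_univ_succ (n := 3), syncMetric, hb, joinCoord_zero, joinCoord_succ]
    simp [dotProduct, Matrix.mulVec, Finset.mul_sum]
    exact Finset.sum_congr rfl fun i _ => Finset.sum_congr rfl fun j _ => by ring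
  rw [h1]
  refine spacelike_of_orthogonal B (W.g.symm _) (W.g.lorentzian _) (u := W.u (W.adapted e q))
    (W.unit _) ?_ ?_
  · rw [← show L (basisVec 0) = W.u (W.adapted e q) from W.mfderiv_adapted_zero he hq, bilin_expand]
    simp only [hK, Fin.sum_univ_succ (n := 3), syncMetric, hb, joinCoord_zero, joinCoord_succ]
    simp [basisVec]
  · intro h0
    have h2 : b = 0 := W.injective_mfderiv_adapted he hq (h0.trans (map_zero L).symm)
    exact ha (by funext i; simpa [hb] using congrArg (fun x : Coord 4 => x i.succ) h2)

theorem det_leafMetric_pos (he : e ∈ atlas (Coord 3) S) {q : Coord 4}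
    (hq : q ∈ W.adaptedDomain e) : 0 < (W.leafMetric' e q).det := (W.posDef_leafMetric he hq).det_pos

/-- In the adapted chart `uᵢ = g₀ᵢ`, so the covector dual to `u` is `-dt`; this is the source of the
entries `-1` and `0` in `SyncEinstein`. -/
theorem syncEinstein (he : e ∈ atlas (Coord 3) S) {q : Coord 4} (hq : q ∈ W.adaptedDomain e) :
    SyncEinstein (W.leafMetric' e) (fun p => W.density (W.adapted e p)) W.Λ q := by
  obtain ⟨E, hEm, hqE, hEt, hE⟩ := W.exists_adapted_chart he hq
  have h1 : W.g.components E.symm =ᶠ[nhds q] syncMetric (W.leafMetric' e) := by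
    filter_upwards [W.components_chart_eventuallyEq hE hqE, E.open_target.mem_nhds hqE] with p hp hp'
    rw [hp, W.adaptedMetric_eq_syncMetric he (hEt hp')]
  have h2 : ∀ i, W.g.formComponents E W.u q i = if i = 0 then -1 else 0 := by
    intro i
    have h3 : W.g.formComponents E W.u q i = W.adaptedMetric e q 0 i := by
      rw [W.adaptedMetric_zero_left he hq]
      simp only [LorentzMetric.formComponents]
      rw [show mfderiv (𝓡 4) (𝓡 4) E.symm q (basisVec i) = _ from W.mfderiv_chartSymm hE hqE _, hE hqE]
    rw [h3, W.adaptedMetric_eq_syncMetric he hq]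
    refine Fin.cases ?_ (fun i => ?_) i <;> simp [syncMetric, Fin.succ_ne_zero]
  intro i j
  have h3 := W.einstein E hEm q hqE i j
  rw [ricci_congr h1, scalarCurv_congr h1, h1.eq_of_nhds, h2, h2, hE hqE] at h3
  exact h3

end DustSpacetime

/-! ### The expansion tensor in comoving coordinates -/

theorem pderiv_comp {n m : ℕ} {f : Coord m → ℝ} {P : Coord n → Coord m} {q : Coord n}
    (hf : DifferentiableAt ℝ f (P q)) (hP : DifferentiableAt ℝ P q) (c : Fin n) :
    pderiv c (fun p => f (P p)) q = ∑ l, pderiv l f (P q) * pderiv c (fun p => P p l) q := by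
  have h1 := (hf.hasFDerivAt.comp q hP.hasFDerivAt).fderiv
  have h2 : ∀ l, pderiv c (fun p => P p l) q = (fderiv ℝ P q (basisVec c)) l := by
    intro l
    have := ((EuclideanSpace.proj (𝕜 := ℝ) l).hasFDerivAt.comp q hP.hasFDerivAt).fderiv
    simp only [pderiv]
    rw [show (fun p => P p l) = (EuclideanSpace.proj (𝕜 := ℝ) l) ∘ P from rfl, this]
    rfl
  simp only [pderiv] at h2 ⊢
  rw [show (fun p => f (P p)) = f ∘ P from rfl, h1, ContinuousLinearMap.comp_apply]
  conv_lhs => rw [← sum_smul_basisVec (fderiv ℝ P q (basisVec c))]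
  simp only [map_sum, map_smul, smul_eq_mul, h2, mul_comm]

theorem fderiv_apply_coord {n m : ℕ} {P : Coord n → Coord m} {q : Coord n}
    (hP : DifferentiableAt ℝ P q) (c : Fin n) (l : Fin m) :
    (fderiv ℝ P q (basisVec c)) l = pderiv c (fun p => P p l) q := by
  have := ((EuclideanSpace.proj (𝕜 := ℝ) l).hasFDerivAt.comp q hP.hasFDerivAt).fderiv
  simp only [pderiv]
  rw [show (fun p => P p l) = (EuclideanSpace.proj (𝕜 := ℝ) l) ∘ P from rfl, this]
  rfl

/-- The derivatives of the components of a pulled back metric. -/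
theorem pderiv_pullback {n m : ℕ} {G : Coord m → Matrix (Fin m) (Fin m) ℝ} {P : Coord n → Coord m}
    {q : Coord n} {F H : Coord n → Fin m → ℝ}
    (hG : ∀ a b, DifferentiableAt ℝ (fun x => G x a b) (P q)) (hP : DifferentiableAt ℝ P q)
    (hF : ∀ a, DifferentiableAt ℝ (fun p => F p a) q)
    (hH : ∀ a, DifferentiableAt ℝ (fun p => H p a) q) (c : Fin n) :
    pderiv c (fun p => ∑ μ, ∑ ν, G (P p) μ ν * F p μ * H p ν) q
      = ∑ μ, ∑ ν, (∑ l, pderiv l (fun x => G x μ ν) (P q) * pderiv c (fun p => P p l) q)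
          * F q μ * H q ν
        + ∑ μ, ∑ ν, G (P q) μ ν * pderiv c (fun p => F p μ) q * H q ν
        + ∑ μ, ∑ ν, G (P q) μ ν * F q μ * pderiv c (fun p => H p ν) q := by
  have hGP : ∀ a b, DifferentiableAt ℝ (fun p => G (P p) a b) q := fun a b =>
    DifferentiableAt.comp q (hG a b) hP
  rw [pderiv_sum _ _ fun μ _ => DifferentiableAt.fun_sum fun ν _ =>
    ((hGP μ ν).fun_mul (hF μ)).fun_mul (hH ν), ← Finset.sum_add_distrib, ← Finset.sum_add_distrib]
  refine Finset.sum_congr rfl fun μ _ => ?_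
  rw [pderiv_sum _ _ fun ν _ => ((hGP μ ν).fun_mul (hF μ)).fun_mul (hH ν),
    ← Finset.sum_add_distrib, ← Finset.sum_add_distrib]
  refine Finset.sum_congr rfl fun ν _ => ?_
  rw [pderiv_mul _ ((hGP μ ν).fun_mul (hF μ)) (hH ν), pderiv_mul _ (hGP μ ν) (hF μ),
    pderiv_comp (hG μ ν) hP]
  ring

/-- The contraction of the covariant derivative of the one-form `w = G(V₀, ·)` with two vectors. -/
theorem contract_covDerivForm {G : Coord 4 → Matrix (Fin 4) (Fin 4) ℝ} {w : Coord 4 → Fin 4 → ℝ}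
    {x : Coord 4} (h0 : (G x).det ≠ 0) {U a b : Fin 4 → ℝ}
    (hw : ∀ μ, w x μ = ∑ ν, G x ν μ * U ν) :
    ∑ ν, (∑ μ, a μ * covDerivForm G w x μ ν) * b ν
      = ∑ μ, (∑ ν, pderiv ν (fun y => w y μ) x * b ν) * a μ
        - (1 / 2) * (∑ μ, ∑ ν, (∑ l, pderiv l (fun y => G y μ ν) x * a l) * U μ * b ν
          + ∑ μ, ∑ ν, (∑ l, pderiv l (fun y => G y μ ν) x * b l) * U μ * a ν
          - ∑ μ, ∑ ν, (∑ l, pderiv l (fun y => G y μ ν) x * U l) * a μ * b ν) := by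
  -- Raising the index of `w` returns `U`, so the inverse metric inside the Christoffel symbols
  -- disappears.
  have h1 : ∀ l, ∑ k, (G x)⁻¹ k l * w x k = U l := by
    intro l
    have h2 : w x = U ᵥ* G x := by
      funext μ; rw [hw]; simp only [Matrix.vecMul, dotProduct, mul_comm]
    have h3 : w x ᵥ* (G x)⁻¹ = U := by
      rw [h2, Matrix.vecMul_vecMul, Matrix.mul_nonsing_inv _ (isUnit_iff_ne_zero.2 h0),
        Matrix.vecMul_one]
    have := congrFun h3 l
    simpa only [Matrix.vecMul, dotProduct, mul_comm] using this
  have h4 : ∀ μ ν, ∑ k, christoffel G k μ ν x * w x k = (1 / 2) * ∑ l, U l *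
      (pderiv μ (fun y => G y l ν) x + pderiv ν (fun y => G y l μ) x
        - pderiv l (fun y => G y μ ν) x) := by
    intro μ ν
    simp only [christoffel, ← h1, Finset.mul_sum, Finset.sum_mul]
    rw [Finset.sum_comm]
    refine Finset.sum_congr rfl fun l _ => Finset.sum_congr rfl fun k _ => by ring
  have h5 : ∑ ν, (∑ μ, a μ * covDerivForm G w x μ ν) * b ν
      = ∑ μ, (∑ ν, pderiv ν (fun y => w y μ) x * b ν) * a μ
        - (1 / 2) * ∑ μ, ∑ ν, ∑ l, U l * a μ * b ν *
      (pderiv μ (fun y => G y l ν) x + pderiv ν (fun y => G y l μ) x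
        - pderiv l (fun y => G y μ ν) x) := by
    simp only [covDerivForm, Matrix.of_apply, h4, Finset.mul_sum, Finset.sum_mul]
    rw [Finset.sum_comm, ← Finset.sum_sub_distrib]
    refine Finset.sum_congr rfl fun μ _ => ?_
    rw [← Finset.sum_sub_distrib]
    refine Finset.sum_congr rfl fun ν _ => ?_
    rw [mul_sub, sub_mul, Finset.mul_sum, Finset.sum_mul]
    congr 1
    · ring
    · refine Finset.sum_congr rfl fun l _ => by ring
  rw [h5]
  congr 2
  simp only [mul_add, mul_sub, Finset.sum_add_distrib, Finset.sum_sub_distrib, Finset.sum_mul]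
  congr 2
  · rw [Finset.sum_congr rfl fun μ _ => Finset.sum_comm, Finset.sum_comm]
    refine Finset.sum_congr rfl fun l _ => ?_
    rw [Finset.sum_comm]
    refine Finset.sum_congr rfl fun ν _ => Finset.sum_congr rfl fun μ _ => by ring
  · rw [Finset.sum_comm, Finset.sum_congr rfl fun μ _ => Finset.sum_comm, Finset.sum_comm]
    refine Finset.sum_congr rfl fun l _ => ?_
    rw [Finset.sum_comm]
    refine Finset.sum_congr rfl fun ν _ => Finset.sum_congr rfl fun μ _ => by ring
  · funext μ
    exact Finset.sum_congr rfl fun ν _ => Finset.sum_congr rfl fun l _ => by ring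

namespace DustSpacetime

variable {M : Type*} [TopologicalSpace M] [ChartedSpace (Coord 4) M] [IsManifold (𝓡 4) ∞ M]
  {S : Type*} [TopologicalSpace S] [ChartedSpace (Coord 3) S] [IsManifold (𝓡 3) ∞ S]
  (W : DustSpacetime M S) {e : OpenPartialHomeomorph S (Coord 3)}

/-- This is `∇ᵢuⱼ = ½ (ℒᵤg)ᵢⱼ` on the leaf, for a hypersurface-orthogonal field. The left side is
defined in an arbitrary spacetime chart `c`. Instead of transforming Christoffel symbols, the proof
writes the comoving metric as the pull-back of `G` by the coordinate change `P` and combines three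
of its first derivatives, two of which vanish because the metric has no time-space components. -/
theorem expansionLow_eq (he : e ∈ atlas (Coord 3) S) {t : ℝ} {y : Coord 3} (ht : t ∈ W.I)
    (hy : y ∈ e.target) :
    W.expansionLow e t y = expLow (W.leafMetric' e) (joinCoord t y) := by
  have hq := W.joinCoord_mem_adaptedDomain ht hy
  set q := joinCoord t y with hqdef
  set c := chartAt (Coord 4) (W.Φ t (e.symm y)) with hc
  set P : Coord 4 → Coord 4 := fun p => c (W.adapted e p) with hP
  set Ω := W.adaptedDomain e ∩ W.adapted e ⁻¹' c.source with hΩ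
  have hcm : c ∈ IsManifold.maximalAtlas (𝓡 4) ∞ M := IsManifold.chart_mem_maximalAtlas _
  have hsm := W.contMDiffOn_adapted he
  have hΩo : IsOpen Ω :=
    hsm.continuousOn.isOpen_inter_preimage (W.isOpen_adaptedDomain e) c.open_source
  have hqΩ : q ∈ Ω := ⟨hq, mem_chart_source _ _⟩
  have hPs : ContDiffOn ℝ ∞ P Ω := contMDiffOn_iff_contDiffOn.1
    ((contMDiffOn_of_mem_maximalAtlas hcm).comp (hsm.mono inter_subset_left) fun p hp => hp.2)
  have hPd : ∀ p ∈ Ω, DifferentiableAt ℝ P p := fun p hp =>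
    (hPs.contDiffAt (hΩo.mem_nhds hp)).differentiableAt (by simp)
  have hPc : ∀ μ, ContDiffOn ℝ ∞ (fun p => P p μ) Ω := fun μ =>
    (EuclideanSpace.proj (𝕜 := ℝ) μ).contDiff.comp_contDiffOn hPs
  have hPt : ∀ p ∈ Ω, P p ∈ c.target := fun p hp => c.map_source hp.2
  have hcs : ContMDiffOn (𝓡 4) (𝓡 4) ∞ c.symm c.target := contMDiffOn_symm_of_mem_maximalAtlas hcm
  set G := W.g.components c.symm with hG
  set w := W.g.formComponents c W.u with hw
  have hGs : SmoothMatOn G c.target := W.g.smoothMatOn_components c.open_target hcs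
  have hws : ∀ μ, ContDiffOn ℝ ∞ (fun x => w x μ) c.target := fun μ =>
    W.g.contDiffOn_apply hcs (W.contMDiff_u.comp_contMDiffOn hcs)
      (contMDiffOn_mfderiv_const c.open_target hcs _)
  have hGsym : ∀ x a b, G x a b = G x b a := fun x a b => W.g.symm _ _ _
  have hcd : c.MDifferentiable (𝓡 4) (𝓡 4) := mdifferentiable_chart _
  have hDP : ∀ p ∈ Ω, ∀ v, (mfderiv (𝓡 4) (𝓡 4) (W.adapted e) p v : Coord 4)
      = mfderiv (𝓡 4) (𝓡 4) c.symm (P p) (fderiv ℝ P p v) := by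
    intro p hp v
    have h1 := (hcd.mdifferentiableAt_symm (hPt p hp)).hasMFDerivAt.comp p
      (hPd p hp).hasFDerivAt.hasMFDerivAt
    have h2 : W.adapted e =ᶠ[nhds p] c.symm ∘ P := by
      filter_upwards [hΩo.mem_nhds hp] with p' hp'
      exact (c.left_inv hp'.2).symm
    rw [h2.mfderiv_eq, h1.mfderiv]; rfl
  have hsymmP : ∀ p ∈ Ω, c.symm (P p) = W.adapted e p := fun p hp => c.left_inv hp.2
  have hK : ∀ p ∈ Ω, ∀ a b, W.adaptedMetric e p a b
      = ∑ μ, ∑ ν, G (P p) μ ν * pderiv a (fun p => P p μ) p * pderiv b (fun p => P p ν) p := by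
    intro p hp a b
    have h1 : W.adaptedMetric e p a b = W.g.val (c.symm (P p))
        (mfderiv (𝓡 4) (𝓡 4) c.symm (P p) (fderiv ℝ P p (basisVec a)))
        (mfderiv (𝓡 4) (𝓡 4) c.symm (P p) (fderiv ℝ P p (basisVec b))) := by
      rw [hsymmP p hp]
      exact congrArg₂ (fun v w : Coord 4 => W.g.val (W.adapted e p) v w)
        (hDP p hp (basisVec a)) (hDP p hp (basisVec b))
    rw [h1]
    refine (bilin_expand (E := Coord 4) (W.g.val (c.symm (P p))) (mfderiv (𝓡 4) (𝓡 4) c.symm (P p))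
      (fderiv ℝ P p (basisVec a)) (fderiv ℝ P p (basisVec b))).trans ?_
    refine Finset.sum_congr rfl fun μ _ => Finset.sum_congr rfl fun ν _ => ?_
    rw [fderiv_apply_coord (hPd p hp), fderiv_apply_coord (hPd p hp)]
    exact (show ∀ x y z : ℝ, x * y * z = z * x * y from fun _ _ _ => by ring) _ _ _
  have hwU : ∀ p ∈ Ω, ∀ μ, w (P p) μ = ∑ ν, G (P p) ν μ * pderiv 0 (fun p => P p ν) p := by
    intro p hp μ
    have h1 : w (P p) μ = W.g.val (c.symm (P p))
        (mfderiv (𝓡 4) (𝓡 4) c.symm (P p) (fderiv ℝ P p (basisVec 0)))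
        (mfderiv (𝓡 4) (𝓡 4) c.symm (P p) (basisVec μ)) := by
      have h2 : (W.u (c.symm (P p)) : Coord 4)
          = mfderiv (𝓡 4) (𝓡 4) c.symm (P p) (fderiv ℝ P p (basisVec 0)) := by
        rw [hsymmP p hp, ← W.mfderiv_adapted_zero he hp.1]
        exact hDP p hp _
      exact congrArg (fun v : Coord 4 => W.g.val (c.symm (P p)) v
        (mfderiv (𝓡 4) (𝓡 4) c.symm (P p) (basisVec μ))) h2
    rw [h1]
    refine (bilin_expand (E := Coord 4) (W.g.val (c.symm (P p))) (mfderiv (𝓡 4) (𝓡 4) c.symm (P p))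
      (fderiv ℝ P p (basisVec 0)) (basisVec μ)).trans ?_
    refine Finset.sum_congr rfl fun ν _ => ?_
    rw [fderiv_apply_coord (hPd p hp), Finset.sum_eq_single μ]
    · simp only [basisVec, PiLp.single_apply, if_true, mul_one]
      exact mul_comm _ _
    · intro b _ hb; simp [basisVec, hb]
    · simp
  have hdet : (G (P q)).det ≠ 0 :=
    det_gram_ne_zero (W.g.val (c.symm (P q))) (W.g.symm _) (W.g.lorentzian _)
      (mfderiv (𝓡 4) (𝓡 4) c.symm (P q)) (hcd.symm.mfderiv_injective (hPt q hqΩ))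
  have hGd : ∀ a b, DifferentiableAt ℝ (fun x => G x a b) (P q) := fun a b =>
    hGs.differentiableAt c.open_target (hPt q hqΩ) a b
  have hPdd : ∀ a μ, DifferentiableAt ℝ (pderiv a fun p => P p μ) q := fun a μ =>
    differentiableAt_of_contDiffOn hΩo (contDiffOn_pderiv hΩo (hPc μ) a) hqΩ
  have hKd : ∀ a b k, pderiv k (fun p => W.adaptedMetric e p a b) q = _ := fun a b k =>
    (pderiv_congr k ((hΩo.mem_nhds hqΩ |> fun h => Filter.eventuallyEq_of_mem h fun p hp =>
      hK p hp a b))).trans (pderiv_pullback (F := fun p μ => pderiv a (fun p => P p μ) p)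
        (H := fun p μ => pderiv b (fun p => P p μ) p) hGd (hPd q hqΩ) (hPdd a) (hPdd b) k)
  have hK0 : ∀ (j : Fin 3) k, pderiv k (fun p => W.adaptedMetric e p 0 j.succ) q = 0 := by
    intro j k
    rw [pderiv_congr (g := fun _ => 0), pderiv_const]
    filter_upwards [(W.isOpen_adaptedDomain e).mem_nhds hq] with p hp
    exact W.adaptedMetric_zero_succ he hp j
  have hKij : ∀ (i j : Fin 3) k, pderiv k (fun p => W.adaptedMetric e p i.succ j.succ) q
      = pderiv k (fun p => W.leafMetric' e p i j) q := by
    intro i j k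
    refine pderiv_congr k ?_
    filter_upwards [(W.isOpen_adaptedDomain e).mem_nhds hq] with p hp
    exact W.adaptedMetric_succ_succ he hp i j
  ext i j
  -- Orthogonality `w(∂ᵢP) = 0` differentiated along the leaf trades the derivative of `w` for a
  -- second derivative of `P`.
  have hw4 : ∑ μ, ((∑ ν, pderiv ν (fun x => w x μ) (P q) * pderiv j.succ (fun p => P p ν) q)
        * pderiv i.succ (fun p => P p μ) q
      + w (P q) μ * pderiv j.succ (pderiv i.succ fun p => P p μ) q) = 0 := by
    have hwd : ∀ μ, DifferentiableAt ℝ (fun x => w x μ) (P q) := fun μ =>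
      differentiableAt_of_contDiffOn c.open_target (hws μ) (hPt q hqΩ)
    have hwPd : ∀ μ, DifferentiableAt ℝ (fun p => w (P p) μ) q := fun μ =>
      DifferentiableAt.comp q (hwd μ) (hPd q hqΩ)
    rw [← hK0 i j.succ]
    have h1 : (fun p => W.adaptedMetric e p 0 i.succ) =ᶠ[nhds q]
        fun p => ∑ μ, w (P p) μ * pderiv i.succ (fun p => P p μ) p := by
      filter_upwards [hΩo.mem_nhds hqΩ] with p hp
      rw [hK p hp, Finset.sum_comm]
      refine Finset.sum_congr rfl fun μ _ => ?_
      rw [hwU p hp, Finset.sum_mul]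
    rw [pderiv_congr _ h1, pderiv_sum _ _ fun μ _ => (hwPd μ).fun_mul (hPdd _ μ)]
    refine Finset.sum_congr rfl fun μ _ => ?_
    rw [pderiv_mul _ (hwPd μ) (hPdd _ μ), pderiv_comp (hwd μ) (hPd q hqΩ)]
  have hJ : ∀ μ (k : Fin 3), pderiv k (fun z => c (W.Φ t (e.symm z)) μ) y
      = pderiv k.succ (fun p => P p μ) q := fun μ k =>
    pderiv_joinCoord (f := fun p => P p μ) (differentiableAt_of_contDiffOn hΩo (hPc μ) hqΩ) k
  have hL : W.expansionLow e t y i j = ∑ ν, (∑ μ, pderiv i.succ (fun p => P p μ) q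
      * covDerivForm G w (P q) μ ν) * pderiv j.succ (fun p => P p ν) q := by
    simp only [expansionLow, Matrix.mul_apply, Matrix.transpose_apply, Matrix.of_apply, ← hc, hJ]
    rfl
  rw [hL, contract_covDerivForm hdet (hwU q hqΩ)]
  -- A Koszul-type combination: `∂ₜhᵢⱼ` together with the vanishing `∂ᵢg₀ⱼ` and `∂ⱼg₀ᵢ`. Every
  -- second derivative of `P` cancels in it.
  have e1 := hKd i.succ j.succ 0
  have e2 := hKd 0 j.succ i.succ
  have e3 := hKd 0 i.succ j.succ
  rw [hK0] at e2 e3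
  rw [hKij] at e1
  have hcomm : ∀ a b μ, pderiv a (pderiv b fun p => P p μ) q = pderiv b (pderiv a fun p => P p μ) q :=
    fun a b μ => pderiv_comm hΩo (hPc μ) hqΩ a b
  have hswap : ∀ F H : Fin 4 → ℝ, ∑ μ, ∑ ν, G (P q) μ ν * F μ * H ν
      = ∑ μ, ∑ ν, G (P q) μ ν * H μ * F ν := by
    intro F H
    rw [Finset.sum_comm]
    refine Finset.sum_congr rfl fun μ _ => Finset.sum_congr rfl fun ν _ => ?_
    rw [hGsym]; ring
  have hw5 : ∑ μ, w (P q) μ * pderiv j.succ (pderiv i.succ fun p => P p μ) q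
      = ∑ μ, ∑ ν, G (P q) μ ν * pderiv 0 (fun p => P p μ) q
        * pderiv j.succ (pderiv i.succ fun p => P p ν) q := by
    rw [Finset.sum_comm]
    refine Finset.sum_congr rfl fun μ _ => ?_
    rw [hwU q hqΩ, Finset.sum_mul]
  rw [Finset.sum_add_distrib, hw5] at hw4
  have e4 := hswap (fun μ => pderiv i.succ (fun p => P p μ) q)
    (fun μ => pderiv 0 (pderiv j.succ fun p => P p μ) q)
  simp only [hcomm 0, hcomm i.succ j.succ] at e1 e2 e3 e4
  have e5 : expLow (W.leafMetric' e) q i j = (1 / 2) * pderiv 0 (fun p => W.leafMetric' e p i j) q :=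
    rfl
  rw [e5, e1]
  linarith

theorem expansion_eq (he : e ∈ atlas (Coord 3) S) {t : ℝ} {y : Coord 3} (ht : t ∈ W.I)
    (hy : y ∈ e.target) :
    W.expansion e t y = expMixed (W.leafMetric' e) (joinCoord t y) := by
  rw [expansion, W.expansionLow_eq he ht hy]; rfl

end DustSpacetime

/-! ### Entrywise derivatives of matrix curves -/

section MatrixCurves

variable {m : Type*} {X Y : ℝ → Matrix m m ℝ} {X' Y' : Matrix m m ℝ} {t : ℝ}

/-- `X' ` is the entrywise derivative of the matrix curve `X` at `t`. -/
def HasMatDerivAt (X : ℝ → Matrix m m ℝ) (X' : Matrix m m ℝ) (t : ℝ) : Prop :=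
  ∀ i j, HasDerivAt (fun s => X s i j) (X' i j) t

theorem HasMatDerivAt.congr (h : HasMatDerivAt X X' t) (hXY : ∀ᶠ s in nhds t, Y s = X s) :
    HasMatDerivAt Y X' t := fun i j =>
  (h i j).congr_of_eventuallyEq (hXY.mono fun s hs => by simp only [hs])

theorem HasMatDerivAt.unique (h : HasMatDerivAt X X' t) (h' : HasMatDerivAt X Y' t) : X' = Y' := by
  ext i j; exact (h i j).unique (h' i j)

theorem HasMatDerivAt.mul [Fintype m] (hX : HasMatDerivAt X X' t) (hY : HasMatDerivAt Y Y' t) :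
    HasMatDerivAt (fun s => X s * Y s) (X' * Y t + X t * Y') t := by
  intro i j
  simp only [Matrix.mul_apply, Matrix.add_apply, ← Finset.sum_add_distrib]
  exact HasDerivAt.fun_sum fun k _ => (hX i k).mul (hY k j)

theorem HasMatDerivAt.conj [Fintype m] (hX : HasMatDerivAt X X' t) (C D : Matrix m m ℝ) :
    HasMatDerivAt (fun s => C * X s * D) (C * X' * D) t := by
  have hc : ∀ C : Matrix m m ℝ, HasMatDerivAt (fun _ => C) 0 t := fun C i j => hasDerivAt_const _ _
  simpa using ((hc C).mul hX).mul (hc D)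

theorem HasMatDerivAt.trace [Fintype m] (hX : HasMatDerivAt X X' t) :
    HasDerivAt (fun s => (X s).trace) X'.trace t := by
  simp only [Matrix.trace, Matrix.diag]
  exact HasDerivAt.fun_sum fun k _ => hX k k

theorem HasMatDerivAt.traceFree {X : ℝ → Matrix (Fin 3) (Fin 3) ℝ} {X' : Matrix (Fin 3) (Fin 3) ℝ}
    (hX : HasMatDerivAt X X' t) :
    HasMatDerivAt (fun s => traceFree (X s)) (traceFree X') t := by
  intro i j
  simp only [DustCosmology.traceFree, Matrix.sub_apply, Matrix.smul_apply, smul_eq_mul]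
  exact (hX i j).sub ((hX.trace.const_mul _).mul_const _)

theorem SmoothMatOn.hasMatDerivAt {A : Coord 4 → Matrix m m ℝ} {Ω : Set (Coord 4)}
    (hΩ : IsOpen Ω) (hA : SmoothMatOn A Ω) {y : Coord 3} (hq : joinCoord t y ∈ Ω) :
    HasMatDerivAt (fun s => A (joinCoord s y)) (DustCosmology.pderivMat 0 A (joinCoord t y)) t :=
  fun i j => hasDerivAt_joinCoord (hA.differentiableAt hΩ hq i j)

end MatrixCurves

theorem trace_traceFree_mul (A B : Matrix (Fin 3) (Fin 3) ℝ) :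
    (traceFree A * traceFree B).trace = (A * B).trace - (1 / 3) * A.trace * B.trace := by
  simp [traceFree, sub_mul, mul_sub, Matrix.trace_sub, Matrix.trace_smul]
  ring

theorem trace_conj {A C : Matrix (Fin 3) (Fin 3) ℝ} (hC : IsUnit C.det) :
    (C⁻¹ * A * C).trace = A.trace := by
  rw [Matrix.trace_mul_comm, ← mul_assoc, Matrix.mul_nonsing_inv _ hC, one_mul]

theorem traceFree_conj {A C : Matrix (Fin 3) (Fin 3) ℝ} (hC : IsUnit C.det) :
    traceFree (C⁻¹ * A * C) = C⁻¹ * traceFree A * C := by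
  simp only [traceFree, trace_conj hC, mul_sub, sub_mul, Matrix.mul_smul, Matrix.smul_mul, mul_one,
    Matrix.nonsing_inv_mul _ hC]

theorem trace_conj_mul_conj {A B C : Matrix (Fin 3) (Fin 3) ℝ} (hC : IsUnit C.det) :
    (C⁻¹ * A * C * (C⁻¹ * B * C)).trace = (A * B).trace := by
  have h1 : C⁻¹ * A * C * (C⁻¹ * B * C) = C⁻¹ * (A * B) * C := by
    calc _ = C⁻¹ * A * (C * C⁻¹) * B * C := by simp only [mul_assoc]
      _ = _ := by rw [Matrix.mul_nonsing_inv _ hC, mul_one]; simp only [mul_assoc]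
  rw [h1, trace_conj hC]

/-- The Jacobian matrix of a map. -/
def jacobian {n m : ℕ} (f : Coord n → Coord m) (y : Coord n) : Matrix (Fin m) (Fin n) ℝ :=
  Matrix.of fun k i => (fderiv ℝ f y (basisVec i)) k

theorem det_jacobian {n : ℕ} (f : Coord n → Coord n) (y : Coord n) :
    (fderiv ℝ f y).det = (jacobian f y).det := by
  have h := LinearMap.det_toMatrix (EuclideanSpace.basisFun (Fin n) ℝ).toBasis
    (fderiv ℝ f y : Coord n →ₗ[ℝ] Coord n)
  rw [ContinuousLinearMap.det, ← h]
  congr 1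

theorem LorentzMetric.components_comp {M : Type*} [TopologicalSpace M] [ChartedSpace (Coord 4) M]
    [IsManifold (𝓡 4) ∞ M] (g : LorentzMetric M) {n m : ℕ} {φ : Coord m → M} {f : Coord n → Coord m}
    {y : Coord n} (hφ : MDifferentiableAt (𝓡 m) (𝓡 4) φ (f y)) (hf : DifferentiableAt ℝ f y) :
    g.components (φ ∘ f) y = (jacobian f y)ᵀ * g.components φ (f y) * jacobian f y := by
  have h1 := (hφ.hasMFDerivAt.comp y hf.hasFDerivAt.hasMFDerivAt).mfderiv
  ext i j
  simp only [LorentzMetric.components, Matrix.of_apply, h1]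
  refine (bilin_expand (E := Coord 4) (g.val (φ (f y))) (mfderiv (𝓡 m) (𝓡 4) φ (f y))
    (fderiv ℝ f y (basisVec i)) (fderiv ℝ f y (basisVec j))).trans ?_
  simp only [Matrix.mul_apply, Matrix.transpose_apply, Matrix.of_apply, jacobian, Finset.sum_mul]
  rw [Finset.sum_comm]
  refine Finset.sum_congr rfl fun k _ => Finset.sum_congr rfl fun l _ => ?_
  exact (show ∀ x y z : ℝ, x * y * z = x * z * y from fun _ _ _ => by ring) _ _ _

theorem isUnit_det_jacobian {S : Type*} [TopologicalSpace S] [ChartedSpace (Coord 3) S]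
    [IsManifold (𝓡 3) ∞ S] {e₁ e₂ : OpenPartialHomeomorph S (Coord 3)}
    (he₁ : e₁ ∈ atlas (Coord 3) S) (he₂ : e₂ ∈ atlas (Coord 3) S) {x : S}
    (hx₁ : x ∈ e₁.source) (hx₂ : x ∈ e₂.source) :
    IsUnit (jacobian (e₂ ∘ e₁.symm) (e₁ x)).det := by
  have hd₁ := (mdifferentiable_of_mem_atlas (I := 𝓡 3) he₁)
  have hd₂ := (mdifferentiable_of_mem_atlas (I := 𝓡 3) he₂)
  have hx₂' : e₁.symm (e₁ x) ∈ e₂.source := by rwa [e₁.left_inv hx₁]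
  have h1 := ((hd₂.mdifferentiableAt hx₂').hasMFDerivAt.comp (e₁ x)
    (hd₁.mdifferentiableAt_symm (e₁.map_source hx₁)).hasMFDerivAt).hasFDerivAt
  obtain ⟨G, hG, hGi⟩ : ∃ G : Coord 3 →L[ℝ] Coord 3,
      HasFDerivAt (e₂ ∘ e₁.symm) G (e₁ x) ∧ Function.Injective G :=
    ⟨_, h1, fun v w hvw => hd₁.symm.mfderiv_injective (e₁.map_source hx₁)
      (hd₂.mfderiv_injective hx₂' hvw)⟩
  rw [← det_jacobian, hG.fderiv]
  exact (LinearEquiv.ofInjectiveEndo (G : Coord 3 →ₗ[ℝ] Coord 3) hGi).isUnit_det'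

/-! ### Transformation of the leaf tensors under a change of chart of `S`. -/

namespace DustSpacetime

variable {M : Type*} [TopologicalSpace M] [ChartedSpace (Coord 4) M] [IsManifold (𝓡 4) ∞ M]
  {S : Type*} [TopologicalSpace S] [ChartedSpace (Coord 3) S] [IsManifold (𝓡 3) ∞ S]
  (W : DustSpacetime M S) {e e₁ e₂ : OpenPartialHomeomorph S (Coord 3)}

theorem det_leafMetric_ne_zero (he : e ∈ atlas (Coord 3) S) :
    ∀ q ∈ W.adaptedDomain e, (W.leafMetric' e q).det ≠ 0 :=
  fun _ hq => (W.det_leafMetric_pos he hq).ne'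

theorem smoothMatOn_expansion (he : e ∈ atlas (Coord 3) S) :
    SmoothMatOn (expMixed (W.leafMetric' e)) (W.adaptedDomain e) :=
  (W.smoothMatOn_leafMetric he).expMixed (W.isOpen_adaptedDomain e) (W.det_leafMetric_ne_zero he)

/-- The mixed Ricci tensor of the leaves as a function on `ℝ⁴`. -/
def leafRicci (e : OpenPartialHomeomorph S (Coord 3)) (q : Coord 4) : Matrix (Fin 3) (Fin 3) ℝ :=
  (W.leafMetric' e q)⁻¹ * spatialRicci (W.leafMetric' e) q

theorem smoothMatOn_leafRicci (he : e ∈ atlas (Coord 3) S) :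
    SmoothMatOn (W.leafRicci e) (W.adaptedDomain e) :=
  ((W.smoothMatOn_leafMetric he).inv (W.det_leafMetric_ne_zero he)).mul
    (smoothMatOn_spatialRicci (W.isOpen_adaptedDomain e) (W.smoothMatOn_leafMetric he)
      (W.det_leafMetric_ne_zero he))

theorem ricciMixed_eq (he : e ∈ atlas (Coord 3) S) {t : ℝ} {y : Coord 3} (ht : t ∈ W.I)
    (hy : y ∈ e.target) :
    ricciMixed (W.leafMetric e t) y = W.leafRicci e (joinCoord t y) := by
  rw [leafRicci, ← ricci_slice (W.isOpen_adaptedDomain e) (W.smoothMatOn_leafMetric he)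
    (W.det_leafMetric_ne_zero he) (W.joinCoord_mem_adaptedDomain ht hy)]
  rfl

theorem evolution (he : e ∈ atlas (Coord 3) S) {q : Coord 4} (hq : q ∈ W.adaptedDomain e) :
    pderivMat 0 (expMixed (W.leafMetric' e)) q
      = (W.density (W.adapted e q) / 2 + W.Λ) • (1 : Matrix (Fin 3) (Fin 3) ℝ)
        - (expMixed (W.leafMetric' e) q).trace • expMixed (W.leafMetric' e) q - W.leafRicci e q :=
  (W.syncEinstein he hq).evolution (W.isOpen_adaptedDomain e) (W.smoothMatOn_leafMetric he)
    W.leafMetric_symm (W.det_leafMetric_ne_zero he) hq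

/-! #### Change of the chart of the leaf -/

/-- The transition map is independent of `t`, so its Jacobian is constant along a flow line and the
law may be differentiated in time entrywise, as the later transformation laws do. -/
theorem leafMetric_change (he₁ : e₁ ∈ atlas (Coord 3) S) (he₂ : e₂ ∈ atlas (Coord 3) S) {x : S}
    (hx₁ : x ∈ e₁.source) (hx₂ : x ∈ e₂.source) {t : ℝ} (ht : t ∈ W.I) :
    W.leafMetric e₁ t (e₁ x) = (jacobian (e₂ ∘ e₁.symm) (e₁ x))ᵀ * W.leafMetric e₂ t (e₂ x)
      * jacobian (e₂ ∘ e₁.symm) (e₁ x) := by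
  have h1 : MDifferentiableAt (𝓡 3) (𝓡 4) (fun z => W.Φ t (e₂.symm z)) ((e₂ ∘ e₁.symm) (e₁ x)) := by
    have h0 : (e₂ ∘ e₁.symm) (e₁ x) = e₂ x := by simp [e₁.left_inv hx₁]
    rw [h0]
    have h2 : HasMFDerivAt (𝓡 3) (𝓡 4) (fun z => joinCoord t z) (e₂ x) spatialIncl :=
      (hasFDerivAt_joinCoord_right t _).hasMFDerivAt
    exact ((W.mdifferentiableAt_adapted he₂ (W.joinCoord_mem_adaptedDomain ht
      (e₂.map_source hx₂))).hasMFDerivAt.comp (e₂ x) h2).mdifferentiableAt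
  have h2 : DifferentiableAt ℝ (e₂ ∘ e₁.symm) (e₁ x) := by
    have h3 : MDifferentiableAt (𝓡 3) (𝓡 3) e₁.symm (e₁ x) :=
      ((mdifferentiable_of_mem_atlas he₁).mdifferentiableAt_symm (e₁.map_source hx₁))
    have h4 : MDifferentiableAt (𝓡 3) (𝓡 3) e₂ (e₁.symm (e₁ x)) :=
      (mdifferentiable_of_mem_atlas he₂).mdifferentiableAt (by rwa [e₁.left_inv hx₁])
    exact (h4.comp (e₁ x) h3).differentiableAt
  have h3 := W.g.components_comp h1 h2
  have h4 : (e₂ ∘ e₁.symm) (e₁ x) = e₂ x := by simp [e₁.left_inv hx₁]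
  rw [h4] at h3
  refine (W.g.components_congr ?_).trans h3
  have h5 : ∀ᶠ z in nhds (e₁ x), e₁.symm z ∈ e₂.source :=
    (e₁.continuousAt_symm (e₁.map_source hx₁)).eventually_mem
      (e₂.open_source.mem_nhds (by rwa [e₁.left_inv hx₁]))
  filter_upwards [h5] with z hz
  simp only [Function.comp, e₂.left_inv hz]

theorem expMixed_change (he₁ : e₁ ∈ atlas (Coord 3) S) (he₂ : e₂ ∈ atlas (Coord 3) S) {x : S}
    (hx₁ : x ∈ e₁.source) (hx₂ : x ∈ e₂.source) {t : ℝ} (ht : t ∈ W.I) :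
    expMixed (W.leafMetric' e₁) (joinCoord t (e₁ x)) = (jacobian (e₂ ∘ e₁.symm) (e₁ x))⁻¹
      * expMixed (W.leafMetric' e₂) (joinCoord t (e₂ x)) * jacobian (e₂ ∘ e₁.symm) (e₁ x) := by
  set A := jacobian (e₂ ∘ e₁.symm) (e₁ x) with hA
  have hAu : IsUnit A.det := isUnit_det_jacobian he₁ he₂ hx₁ hx₂
  have hAu' : IsUnit Aᵀ.det := by rwa [Matrix.det_transpose]
  have hq₁ := W.joinCoord_mem_adaptedDomain ht (e₁.map_source hx₁)
  have hq₂ := W.joinCoord_mem_adaptedDomain ht (e₂.map_source hx₂)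
  have h1 := ((W.smoothMatOn_leafMetric he₂).hasMatDerivAt (W.isOpen_adaptedDomain e₂) hq₂).conj Aᵀ A
  have h2 := (W.smoothMatOn_leafMetric he₁).hasMatDerivAt (W.isOpen_adaptedDomain e₁) hq₁
  have h3 : pderivMat 0 (W.leafMetric' e₁) (joinCoord t (e₁ x))
      = Aᵀ * pderivMat 0 (W.leafMetric' e₂) (joinCoord t (e₂ x)) * A :=
    h2.unique (h1.congr (Filter.eventually_of_mem (W.isOpen_I.mem_nhds ht) fun s hs =>
      W.leafMetric_change he₁ he₂ hx₁ hx₂ hs))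
  have h4 : W.leafMetric' e₁ (joinCoord t (e₁ x)) = Aᵀ * W.leafMetric' e₂ (joinCoord t (e₂ x)) * A :=
    W.leafMetric_change he₁ he₂ hx₁ hx₂ ht
  rw [expMixed, expMixed, expLow, expLow, h3, h4, Matrix.mul_inv_rev, Matrix.mul_inv_rev]
  simp only [Matrix.mul_smul, Matrix.smul_mul]
  congr 1
  calc _ = A⁻¹ * (W.leafMetric' e₂ (joinCoord t (e₂ x)))⁻¹ * (Aᵀ⁻¹ * Aᵀ)
        * pderivMat 0 (W.leafMetric' e₂) (joinCoord t (e₂ x)) * A := by simp only [mul_assoc]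
    _ = _ := by rw [Matrix.nonsing_inv_mul _ hAu', mul_one]; simp only [mul_assoc]

theorem pderivMat_expMixed_change (he₁ : e₁ ∈ atlas (Coord 3) S) (he₂ : e₂ ∈ atlas (Coord 3) S)
    {x : S} (hx₁ : x ∈ e₁.source) (hx₂ : x ∈ e₂.source) {t : ℝ} (ht : t ∈ W.I) :
    pderivMat 0 (expMixed (W.leafMetric' e₁)) (joinCoord t (e₁ x))
      = (jacobian (e₂ ∘ e₁.symm) (e₁ x))⁻¹
      * pderivMat 0 (expMixed (W.leafMetric' e₂)) (joinCoord t (e₂ x))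
      * jacobian (e₂ ∘ e₁.symm) (e₁ x) := by
  have hq₁ := W.joinCoord_mem_adaptedDomain ht (e₁.map_source hx₁)
  have hq₂ := W.joinCoord_mem_adaptedDomain ht (e₂.map_source hx₂)
  refine ((W.smoothMatOn_expansion he₁).hasMatDerivAt (W.isOpen_adaptedDomain e₁) hq₁).unique
    ((((W.smoothMatOn_expansion he₂).hasMatDerivAt (W.isOpen_adaptedDomain e₂) hq₂).conj _ _).congr
      (Filter.eventually_of_mem (W.isOpen_I.mem_nhds ht) fun s hs => W.expMixed_change he₁ he₂ hx₁ hx₂ hs))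

/-- The evolution equation expresses `ℛⁱⱼ` through the density, `Θⁱⱼ` and `∂ₜΘⁱⱼ`, whose behaviour
is already known. The tensor law thus needs no second derivatives of the transition map. -/
theorem leafRicci_change (he₁ : e₁ ∈ atlas (Coord 3) S) (he₂ : e₂ ∈ atlas (Coord 3) S)
    {x : S} (hx₁ : x ∈ e₁.source) (hx₂ : x ∈ e₂.source) {t : ℝ} (ht : t ∈ W.I) :
    W.leafRicci e₁ (joinCoord t (e₁ x)) = (jacobian (e₂ ∘ e₁.symm) (e₁ x))⁻¹
      * W.leafRicci e₂ (joinCoord t (e₂ x)) * jacobian (e₂ ∘ e₁.symm) (e₁ x) := by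
  set A := jacobian (e₂ ∘ e₁.symm) (e₁ x) with hA
  have hAu : IsUnit A.det := isUnit_det_jacobian he₁ he₂ hx₁ hx₂
  have hq₁ := W.joinCoord_mem_adaptedDomain ht (e₁.map_source hx₁)
  have hq₂ := W.joinCoord_mem_adaptedDomain ht (e₂.map_source hx₂)
  have h1 := W.evolution he₁ hq₁
  have h2 := W.evolution he₂ hq₂
  rw [W.pderivMat_expMixed_change he₁ he₂ hx₁ hx₂ ht, h2, W.expMixed_change he₁ he₂ hx₁ hx₂ ht,
    ← hA] at h1
  have h3 : W.adapted e₁ (joinCoord t (e₁ x)) = W.adapted e₂ (joinCoord t (e₂ x)) := by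
    simp [adapted, e₁.left_inv hx₁, e₂.left_inv hx₂]
  simp only [h3, trace_conj hAu, mul_sub, sub_mul, Matrix.mul_smul, Matrix.smul_mul, mul_one,
    Matrix.nonsing_inv_mul _ hAu] at h1
  exact (sub_right_inj.1 h1).symm

theorem pderivMat_leafRicci_change (he₁ : e₁ ∈ atlas (Coord 3) S) (he₂ : e₂ ∈ atlas (Coord 3) S)
    {x : S} (hx₁ : x ∈ e₁.source) (hx₂ : x ∈ e₂.source) {t : ℝ} (ht : t ∈ W.I) :
    pderivMat 0 (W.leafRicci e₁) (joinCoord t (e₁ x)) = (jacobian (e₂ ∘ e₁.symm) (e₁ x))⁻¹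
      * pderivMat 0 (W.leafRicci e₂) (joinCoord t (e₂ x)) * jacobian (e₂ ∘ e₁.symm) (e₁ x) := by
  have hq₁ := W.joinCoord_mem_adaptedDomain ht (e₁.map_source hx₁)
  have hq₂ := W.joinCoord_mem_adaptedDomain ht (e₂.map_source hx₂)
  refine ((W.smoothMatOn_leafRicci he₁).hasMatDerivAt (W.isOpen_adaptedDomain e₁) hq₁).unique
    ((((W.smoothMatOn_leafRicci he₂).hasMatDerivAt (W.isOpen_adaptedDomain e₂) hq₂).conj _ _).congr
      (Filter.eventually_of_mem (W.isOpen_I.mem_nhds ht) fun s hs => W.leafRicci_change he₁ he₂ hx₁ hx₂ hs))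

end DustSpacetime

/-- Jacobi's formula for the determinant of a curve of `3 × 3` matrices with `X' = X Y`. -/
theorem HasMatDerivAt.det_of_eq_mul {X : ℝ → Matrix (Fin 3) (Fin 3) ℝ}
    {Y : Matrix (Fin 3) (Fin 3) ℝ} {t : ℝ} (hX : HasMatDerivAt X (X t * Y) t) :
    HasDerivAt (fun s => (X s).det) (Y.trace * (X t).det) t := by
  simp only [Matrix.det_fin_three]
  have h := ((((((hX 0 0).mul (hX 1 1)).mul (hX 2 2)).sub (((hX 0 0).mul (hX 1 2)).mul (hX 2 1))).sub
    (((hX 0 1).mul (hX 1 0)).mul (hX 2 2))).add (((hX 0 1).mul (hX 1 2)).mul (hX 2 0))).add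
    (((hX 0 2).mul (hX 1 0)).mul (hX 2 1)) |>.sub (((hX 0 2).mul (hX 1 1)).mul (hX 2 0))
  refine h.congr_deriv ?_
  simp only [Matrix.mul_apply, Fin.sum_univ_three, Matrix.trace_fin_three, Pi.mul_apply]
  ring

theorem continuous_joinCoord : Continuous fun q : ℝ × Coord 3 => joinCoord q.1 q.2 := by
  refine (PiLp.continuous_toLp 2 _).comp (continuous_pi fun i => ?_)
  refine Fin.cases ?_ (fun j => ?_) i
  · exact continuous_fst
  · exact (EuclideanSpace.proj j).continuous.comp continuous_snd

theorem continuousOn_trace_mul_sub {A B : Coord 4 → Matrix (Fin 3) (Fin 3) ℝ} {Ω : Set (Coord 4)}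
    (hA : SmoothMatOn A Ω) (hB : SmoothMatOn B Ω) (c : ℝ) :
    ContinuousOn (fun q => c * ((A q * B q).trace - (1 / 3) * (A q).trace * (B q).trace)) Ω :=
  continuousOn_const.mul ((hA.mul hB).trace.continuousOn.sub
    ((continuousOn_const.mul hA.trace.continuousOn).mul hB.trace.continuousOn))

namespace DustSpacetime

variable {M : Type*} [TopologicalSpace M] [ChartedSpace (Coord 4) M] [IsManifold (𝓡 4) ∞ M]
  {S : Type*} [TopologicalSpace S] [ChartedSpace (Coord 3) S] [IsManifold (𝓡 3) ∞ S]
  (W : DustSpacetime M S) {e : OpenPartialHomeomorph S (Coord 3)} {t : ℝ} {x : S}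

/-! #### The scalars in an arbitrary chart -/

theorem trace_expMixed_change {e₁ e₂ : OpenPartialHomeomorph S (Coord 3)}
    (he₁ : e₁ ∈ atlas (Coord 3) S) (he₂ : e₂ ∈ atlas (Coord 3) S)
    (hx₁ : x ∈ e₁.source) (hx₂ : x ∈ e₂.source) (ht : t ∈ W.I) :
    (expMixed (W.leafMetric' e₁) (joinCoord t (e₁ x))).trace
      = (expMixed (W.leafMetric' e₂) (joinCoord t (e₂ x))).trace := by
  rw [W.expMixed_change he₁ he₂ hx₁ hx₂ ht, trace_conj (isUnit_det_jacobian he₁ he₂ hx₁ hx₂)]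

theorem theta_eq (he : e ∈ atlas (Coord 3) S) (ht : t ∈ W.I) (hx : x ∈ e.source) :
    W.theta t x = (expMixed (W.leafMetric' e) (joinCoord t (e x))).trace := by
  have hc := chart_mem_atlas (Coord 3) x
  have hcx := mem_chart_source (Coord 3) x
  rw [theta, W.expansion_eq hc ht (OpenPartialHomeomorph.map_source _ hcx),
    W.trace_expMixed_change hc he hcx hx ht]

theorem scalR_eq (he : e ∈ atlas (Coord 3) S) (ht : t ∈ W.I) (hx : x ∈ e.source) :
    W.scalR t x = (W.leafRicci e (joinCoord t (e x))).trace := by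
  have hc := chart_mem_atlas (Coord 3) x
  have hcx := mem_chart_source (Coord 3) x
  rw [scalR, scalarCurv, W.ricciMixed_eq hc ht (OpenPartialHomeomorph.map_source _ hcx),
    W.leafRicci_change hc he hcx hx ht, trace_conj (isUnit_det_jacobian hc he hcx hx)]

theorem sigmaSq_eq (he : e ∈ atlas (Coord 3) S) (ht : t ∈ W.I) (hx : x ∈ e.source) :
    W.sigmaSq t x = (1 / 2) * ((expMixed (W.leafMetric' e) (joinCoord t (e x))
        * expMixed (W.leafMetric' e) (joinCoord t (e x))).trace
      - (1 / 3) * (expMixed (W.leafMetric' e) (joinCoord t (e x))).trace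
        * (expMixed (W.leafMetric' e) (joinCoord t (e x))).trace) := by
  have hc := chart_mem_atlas (Coord 3) x
  have hcx := mem_chart_source (Coord 3) x
  have hu := isUnit_det_jacobian hc he hcx hx
  rw [sigmaSq]
  simp only [shear]
  rw [W.expansion_eq hc ht (OpenPartialHomeomorph.map_source _ hcx),
    W.expMixed_change hc he hcx hx ht, traceFree_conj hu, trace_conj_mul_conj hu,
    trace_traceFree_mul]

theorem tauSq_eq (he : e ∈ atlas (Coord 3) S) (ht : t ∈ W.I) (hx : x ∈ e.source) :
    W.tauSq t x = (1 / 2) * ((W.leafRicci e (joinCoord t (e x))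
        * W.leafRicci e (joinCoord t (e x))).trace
      - (1 / 3) * (W.leafRicci e (joinCoord t (e x))).trace
        * (W.leafRicci e (joinCoord t (e x))).trace) := by
  have hc := chart_mem_atlas (Coord 3) x
  have hcx := mem_chart_source (Coord 3) x
  have hu := isUnit_det_jacobian hc he hcx hx
  rw [tauSq]
  simp only [curvAniso]
  rw [W.ricciMixed_eq hc ht (OpenPartialHomeomorph.map_source _ hcx),
    W.leafRicci_change hc he hcx hx ht, traceFree_conj hu, trace_conj_mul_conj hu,
    trace_traceFree_mul]

theorem nu_eq (he : e ∈ atlas (Coord 3) S) (ht : t ∈ W.I) (hx : x ∈ e.source) :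
    W.nu t x = 2 * ((W.leafRicci e (joinCoord t (e x))
        * expMixed (W.leafMetric' e) (joinCoord t (e x))).trace
      - (1 / 3) * (W.leafRicci e (joinCoord t (e x))).trace
        * (expMixed (W.leafMetric' e) (joinCoord t (e x))).trace) := by
  have hc := chart_mem_atlas (Coord 3) x
  have hcx := mem_chart_source (Coord 3) x
  have hu := isUnit_det_jacobian hc he hcx hx
  rw [nu]
  simp only [curvAniso, shear]
  rw [W.ricciMixed_eq hc ht (OpenPartialHomeomorph.map_source _ hcx),
    W.expansion_eq hc ht (OpenPartialHomeomorph.map_source _ hcx),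
    W.leafRicci_change hc he hcx hx ht, W.expMixed_change hc he hcx hx ht,
    traceFree_conj hu, traceFree_conj hu, trace_conj_mul_conj hu,
    trace_traceFree_mul]

theorem curvAnisoDot_eq (he : e ∈ atlas (Coord 3) S) (ht : t ∈ W.I) (hx : x ∈ e.source) :
    W.curvAnisoDot e t (e x) = traceFree (pderivMat 0 (W.leafRicci e) (joinCoord t (e x))) := by
  have h1 := (((W.smoothMatOn_leafRicci he).hasMatDerivAt (W.isOpen_adaptedDomain e)
    (W.joinCoord_mem_adaptedDomain ht (e.map_source hx))).traceFree).congr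
    (Y := fun s => W.curvAniso e s (e x))
    (Filter.eventually_of_mem (W.isOpen_I.mem_nhds ht) fun s hs => by
      rw [curvAniso, W.ricciMixed_eq he hs (e.map_source hx)])
  ext i j
  exact (h1 i j).deriv

theorem kappa_eq (he : e ∈ atlas (Coord 3) S) (ht : t ∈ W.I) (hx : x ∈ e.source) :
    W.kappa t x = 2 * ((pderivMat 0 (W.leafRicci e) (joinCoord t (e x))
        * expMixed (W.leafMetric' e) (joinCoord t (e x))).trace
      - (1 / 3) * (pderivMat 0 (W.leafRicci e) (joinCoord t (e x))).trace
        * (expMixed (W.leafMetric' e) (joinCoord t (e x))).trace) := by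
  have hc := chart_mem_atlas (Coord 3) x
  have hcx := mem_chart_source (Coord 3) x
  have hu := isUnit_det_jacobian hc he hcx hx
  rw [kappa]
  simp only [shear]
  rw [W.curvAnisoDot_eq hc ht hcx,
    W.expansion_eq hc ht (OpenPartialHomeomorph.map_source _ hcx),
    W.pderivMat_leafRicci_change hc he hcx hx ht, W.expMixed_change hc he hcx hx ht,
    traceFree_conj hu, traceFree_conj hu, trace_conj_mul_conj hu,
    trace_traceFree_mul]

/-! #### Continuity of the scalars -/

/-- The scalars are defined at each `x` with the preferred chart at `x`, which may jump from point
to point. Continuity follows once a single chart computes them on a neighbourhood. -/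
theorem continuousOn_of_charts {ψ : ℝ → S → ℝ}
    {F : OpenPartialHomeomorph S (Coord 3) → Coord 4 → ℝ}
    (hF : ∀ e ∈ atlas (Coord 3) S, ContinuousOn (F e) (W.adaptedDomain e))
    (h : ∀ e ∈ atlas (Coord 3) S, ∀ t ∈ W.I, ∀ x ∈ e.source, ψ t x = F e (joinCoord t (e x))) :
    ContinuousOn (fun q : ℝ × S => ψ q.1 q.2) (W.I ×ˢ univ) := by
  rintro ⟨t, x⟩ ⟨ht, -⟩
  set e := chartAt (Coord 3) x with he
  have hc : e ∈ atlas (Coord 3) S := chart_mem_atlas (Coord 3) x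
  have hx : x ∈ e.source := mem_chart_source (Coord 3) x
  have hn : W.I ×ˢ e.source ∈ nhds (t, x) :=
    (W.isOpen_I.prod e.open_source).mem_nhds ⟨ht, hx⟩
  have h1 : ContinuousOn (fun q : ℝ × S => joinCoord q.1 (e q.2)) (W.I ×ˢ e.source) :=
    continuous_joinCoord.comp_continuousOn (continuousOn_fst.prodMk
      (e.continuousOn.comp continuousOn_snd fun q hq => hq.2))
  have h2 : ContinuousOn (fun q : ℝ × S => F e (joinCoord q.1 (e q.2))) (W.I ×ˢ e.source) :=
    (hF e hc).comp h1 fun q hq =>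
      W.joinCoord_mem_adaptedDomain hq.1 (e.map_source hq.2)
  have h3 : ContinuousOn (fun q : ℝ × S => ψ q.1 q.2) (W.I ×ˢ e.source) :=
    h2.congr fun q hq => h e hc q.1 hq.1 q.2 hq.2
  exact (h3.continuousAt hn).continuousWithinAt

theorem continuousOn_rho :
    ContinuousOn (fun q : ℝ × S => W.rho q.1 q.2) (W.I ×ˢ univ) :=
  W.contMDiff_density.continuous.comp_continuousOn W.contMDiffOn_Φ.continuousOn

theorem continuousOn_theta :
    ContinuousOn (fun q : ℝ × S => W.theta q.1 q.2) (W.I ×ˢ univ) :=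
  W.continuousOn_of_charts (fun _ he => (W.smoothMatOn_expansion he).trace.continuousOn)
    fun _ he _ ht _ hx => W.theta_eq he ht hx

theorem continuousOn_scalR :
    ContinuousOn (fun q : ℝ × S => W.scalR q.1 q.2) (W.I ×ˢ univ) :=
  W.continuousOn_of_charts (fun _ he => (W.smoothMatOn_leafRicci he).trace.continuousOn)
    fun _ he _ ht _ hx => W.scalR_eq he ht hx

theorem continuousOn_sigmaSq :
    ContinuousOn (fun q : ℝ × S => W.sigmaSq q.1 q.2) (W.I ×ˢ univ) :=
  W.continuousOn_of_charts (fun _ he => continuousOn_trace_mul_sub (W.smoothMatOn_expansion he)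
    (W.smoothMatOn_expansion he) _) fun _ he _ ht _ hx => W.sigmaSq_eq he ht hx

theorem continuousOn_tauSq :
    ContinuousOn (fun q : ℝ × S => W.tauSq q.1 q.2) (W.I ×ˢ univ) :=
  W.continuousOn_of_charts (fun _ he => continuousOn_trace_mul_sub (W.smoothMatOn_leafRicci he)
    (W.smoothMatOn_leafRicci he) _) fun _ he _ ht _ hx => W.tauSq_eq he ht hx

theorem continuousOn_nu :
    ContinuousOn (fun q : ℝ × S => W.nu q.1 q.2) (W.I ×ˢ univ) :=
  W.continuousOn_of_charts (fun _ he => continuousOn_trace_mul_sub (W.smoothMatOn_leafRicci he)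
    (W.smoothMatOn_expansion he) _) fun _ he _ ht _ hx => W.nu_eq he ht hx

theorem continuousOn_kappa :
    ContinuousOn (fun q : ℝ × S => W.kappa q.1 q.2) (W.I ×ˢ univ) :=
  W.continuousOn_of_charts (fun e he => continuousOn_trace_mul_sub
    ((W.smoothMatOn_leafRicci he).pderivMat (W.isOpen_adaptedDomain e) 0)
    (W.smoothMatOn_expansion he) _) fun _ he _ ht _ hx => W.kappa_eq he ht hx

/-! #### Evolution of the scalars along the flow lines -/

theorem adapted_joinCoord (hx : x ∈ e.source) : W.adapted e (joinCoord t (e x)) = W.Φ t x := by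
  simp [adapted, e.left_inv hx]

theorem hasMatDerivAt_expMixed (he : e ∈ atlas (Coord 3) S) (ht : t ∈ W.I) (hx : x ∈ e.source) :
    HasMatDerivAt (fun s => expMixed (W.leafMetric' e) (joinCoord s (e x)))
      ((W.rho t x / 2 + W.Λ) • (1 : Matrix (Fin 3) (Fin 3) ℝ)
        - W.theta t x • expMixed (W.leafMetric' e) (joinCoord t (e x))
        - W.leafRicci e (joinCoord t (e x))) t := by
  have hq := W.joinCoord_mem_adaptedDomain ht (e.map_source hx)
  have h1 := (W.smoothMatOn_expansion he).hasMatDerivAt (W.isOpen_adaptedDomain e) hq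
  rwa [W.evolution he hq, W.adapted_joinCoord hx, ← W.theta_eq he ht hx] at h1

theorem hasMatDerivAt_leafRicci (he : e ∈ atlas (Coord 3) S) (ht : t ∈ W.I) (hx : x ∈ e.source) :
    HasMatDerivAt (fun s => W.leafRicci e (joinCoord s (e x)))
      (pderivMat 0 (W.leafRicci e) (joinCoord t (e x))) t :=
  (W.smoothMatOn_leafRicci he).hasMatDerivAt (W.isOpen_adaptedDomain e)
    (W.joinCoord_mem_adaptedDomain ht (e.map_source hx))

theorem trace_pderivMat_leafRicci (he : e ∈ atlas (Coord 3) S) (ht : t ∈ W.I) (hx : x ∈ e.source) :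
    (pderivMat 0 (W.leafRicci e) (joinCoord t (e x))).trace
      = -2 * (W.leafRicci e (joinCoord t (e x))
        * expMixed (W.leafMetric' e) (joinCoord t (e x))).trace := by
  have hq := W.joinCoord_mem_adaptedDomain ht (e.map_source hx)
  have h1 := pderiv_zero_spatialScalar (W.isOpen_adaptedDomain e) (W.smoothMatOn_leafMetric he)
    W.leafMetric_symm (W.det_leafMetric_ne_zero he) hq fun y hy => W.syncEinstein he hy
  rw [leafRicci, ← h1]
  exact (pderiv_trace 0
    ((W.smoothMatOn_leafRicci he).differentiableAt (W.isOpen_adaptedDomain e) hq)).symm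

theorem hamiltonian (ht : t ∈ W.I) (x : S) :
    W.scalR t x + (2 / 3) * W.theta t x ^ 2 - 2 * W.sigmaSq t x = 2 * W.rho t x + 2 * W.Λ := by
  have he := chart_mem_atlas (Coord 3) x
  have hx := mem_chart_source (Coord 3) x
  have hq := W.joinCoord_mem_adaptedDomain ht (OpenPartialHomeomorph.map_source _ hx)
  have h1 := (W.syncEinstein he hq).hamiltonian (W.isOpen_adaptedDomain _)
    (W.smoothMatOn_leafMetric he) W.leafMetric_symm (W.det_leafMetric_ne_zero he) hq
  rw [W.adapted_joinCoord hx] at h1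
  rw [W.scalR_eq he ht hx, W.theta_eq he ht hx, W.sigmaSq_eq he ht hx, rho, ← h1, leafRicci]
  ring

theorem hasDerivAt_theta (ht : t ∈ W.I) (x : S) :
    HasDerivAt (fun s => W.theta s x)
      (3 / 2 * W.rho t x + 3 * W.Λ - W.theta t x ^ 2 - W.scalR t x) t := by
  have he := chart_mem_atlas (Coord 3) x
  have hx := mem_chart_source (Coord 3) x
  refine ((W.hasMatDerivAt_expMixed he ht hx).trace.congr_of_eventuallyEq
    (Filter.eventually_of_mem (W.isOpen_I.mem_nhds ht) fun s hs => W.theta_eq he hs hx)).congr_deriv ?_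
  simp only [Matrix.trace_sub, Matrix.trace_smul, Matrix.trace_one, smul_eq_mul, Fintype.card_fin]
  rw [← W.theta_eq he ht hx, ← W.scalR_eq he ht hx]
  push_cast
  ring

/-- Splitting both factors of `-2 ℛⁱⱼΘʲᵢ` into trace and trace-free part gives `-ν` and `-⅔ ℛΘ`. -/
theorem hasDerivAt_scalR (ht : t ∈ W.I) (x : S) :
    HasDerivAt (fun s => W.scalR s x)
      (-W.nu t x - 2 / 3 * (W.scalR t x * W.theta t x)) t := by
  have he := chart_mem_atlas (Coord 3) x
  have hx := mem_chart_source (Coord 3) x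
  refine ((W.hasMatDerivAt_leafRicci he ht hx).trace.congr_of_eventuallyEq
    (Filter.eventually_of_mem (W.isOpen_I.mem_nhds ht) fun s hs => W.scalR_eq he hs hx)).congr_deriv ?_
  rw [W.trace_pderivMat_leafRicci he ht hx, W.nu_eq he ht hx, W.theta_eq he ht hx,
    W.scalR_eq he ht hx]
  ring

/-- The trace-free part of the evolution equation is `∂ₜσ = -Θσ - τ`; the density and `Λ` enter only
through the trace and drop out. -/
theorem hasDerivAt_sigmaSq (ht : t ∈ W.I) (x : S) :
    HasDerivAt (fun s => W.sigmaSq s x)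
      (-2 * (W.theta t x * W.sigmaSq t x) - 1 / 2 * W.nu t x) t := by
  have he := chart_mem_atlas (Coord 3) x
  have hx := mem_chart_source (Coord 3) x
  have h1 := W.hasMatDerivAt_expMixed he ht hx
  refine ((((h1.mul h1).trace.sub ((h1.trace.const_mul (1 / 3)).mul h1.trace)).const_mul
    (1 / 2)).congr_of_eventuallyEq
    (Filter.eventually_of_mem (W.isOpen_I.mem_nhds ht) fun s hs => W.sigmaSq_eq he hs hx)).congr_deriv ?_
  simp only [Matrix.trace_add, Matrix.trace_sub, Matrix.trace_smul, Matrix.trace_one, smul_eq_mul,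
    Fintype.card_fin, sub_mul, mul_sub, Matrix.smul_mul, Matrix.mul_smul, one_mul, mul_one]
  rw [W.sigmaSq_eq he ht hx, W.nu_eq he ht hx, W.theta_eq he ht hx,
    Matrix.trace_mul_comm (expMixed _ _) (W.leafRicci _ _)]
  push_cast
  ring

/-- Product rule for `2 τⁱⱼσʲᵢ`: the factor `∂ₜτ` gives `κ` by definition, and `∂ₜσ = -Θσ - τ` gives
the other two terms. -/
theorem hasDerivAt_nu (ht : t ∈ W.I) (x : S) :
    HasDerivAt (fun s => W.nu s x)
      (W.kappa t x - W.nu t x * W.theta t x - 4 * W.tauSq t x) t := by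
  have he := chart_mem_atlas (Coord 3) x
  have hx := mem_chart_source (Coord 3) x
  have h1 := W.hasMatDerivAt_expMixed he ht hx
  have h2 := W.hasMatDerivAt_leafRicci he ht hx
  refine ((((h2.mul h1).trace.sub ((h2.trace.const_mul (1 / 3)).mul h1.trace)).const_mul
    2).congr_of_eventuallyEq
    (Filter.eventually_of_mem (W.isOpen_I.mem_nhds ht) fun s hs => W.nu_eq he hs hx)).congr_deriv ?_
  simp only [Matrix.trace_add, Matrix.trace_sub, Matrix.trace_smul, Matrix.trace_one, smul_eq_mul,
    Fintype.card_fin, mul_sub, Matrix.mul_smul, mul_one]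
  rw [W.kappa_eq he ht hx, W.tauSq_eq he ht hx, W.nu_eq he ht hx, W.theta_eq he ht hx]
  push_cast
  ring

/-- Conservation of dust. The Hamiltonian constraint expresses `ϱ` through `ℛ`, `Θ²` and `σ²`, whose
derivatives are known; the `ν` terms from `ℛ` and `σ²` cancel, and the constraint itself reduces the
rest to `-ϱΘ`. -/
theorem hasDerivAt_rho (ht : t ∈ W.I) (x : S) :
    HasDerivAt (fun s => W.rho s x) (-(W.rho t x * W.theta t x)) t := by
  have h1 := (((((W.hasDerivAt_scalR ht x).add (((W.hasDerivAt_theta ht x).pow 2).const_mul (2 / 3))).sub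
    ((W.hasDerivAt_sigmaSq ht x).const_mul 2)).sub_const (2 * W.Λ)).const_mul (1 / 2))
  refine (h1.congr_of_eventuallyEq
    (Filter.eventually_of_mem (W.isOpen_I.mem_nhds ht) fun s hs => ?_)).congr_deriv ?_
  · have := W.hamiltonian hs x
    simp only [Pi.add_apply, Pi.sub_apply, Pi.pow_apply]
    linarith
  · have := W.hamiltonian ht x
    push_cast
    linear_combination (-W.theta t x) * this

/-! #### The volume element -/

theorem hasDerivAt_det_leafMetric (he : e ∈ atlas (Coord 3) S) (ht : t ∈ W.I) (hx : x ∈ e.source) :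
    HasDerivAt (fun s => (W.leafMetric e s (e x)).det)
      (2 * W.theta t x * (W.leafMetric e t (e x)).det) t := by
  have hq := W.joinCoord_mem_adaptedDomain ht (e.map_source hx)
  have h1 := (W.smoothMatOn_leafMetric he).hasMatDerivAt (W.isOpen_adaptedDomain e) hq
  have h2 : pderivMat 0 (W.leafMetric' e) (joinCoord t (e x))
      = W.leafMetric' e (joinCoord t (e x)) * ((2 : ℝ) • expMixed (W.leafMetric' e) (joinCoord t (e x))) := by
    rw [expMixed, expLow, ← Matrix.mul_smul, ← mul_assoc,
      Matrix.mul_nonsing_inv _ (W.det_leafMetric_pos he hq).ne'.isUnit, one_mul, smul_smul]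
    norm_num
  rw [h2] at h1
  have h3 := h1.det_of_eq_mul
  rw [Matrix.trace_smul, ← W.theta_eq he ht hx, smul_eq_mul] at h3
  exact h3

end DustSpacetime

/-! ### Measure theory of the leaf volumes. -/

theorem measurableSet_inter_preimage_of_continuousOn {X Y : Type*} [TopologicalSpace X]
    [MeasurableSpace X] [OpensMeasurableSpace X] [TopologicalSpace Y] [MeasurableSpace Y]
    [BorelSpace Y] {f : X → Y} {s : Set X} (hs : MeasurableSet s) (hf : ContinuousOn f s)
    {A : Set Y} (hA : MeasurableSet A) : MeasurableSet (s ∩ f ⁻¹' A) := by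
  have h1 := hs.subtype_image ((continuousOn_iff_continuous_domRestrict.1 hf).measurable hA)
  convert h1 using 1
  ext x
  simp [and_comm]

/-- Moves a density on `S` back to the coordinate domain, where it can be multiplied with `√det h`.
-/
theorem map_withDensity_comp {X Y : Type*} [MeasurableSpace X] [MeasurableSpace Y] {μ : Measure X}
    [SFinite μ] {φ : X → Y} (hφ : AEMeasurable φ μ) {f : Y → ENNReal} (hf : Measurable f) :
    (Measure.map φ μ).withDensity f = Measure.map φ (μ.withDensity fun x => f (φ x)) := by
  ext A hA
  rw [withDensity_apply _ hA, Measure.map_apply_of_aemeasurable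
    (hφ.mono_ac (withDensity_absolutelyContinuous _ _)) hA, withDensity_apply', ← lintegral_indicator hA,
    lintegral_map' (hf.indicator hA).aemeasurable hφ, ← lintegral_indicator₀ (hφ.nullMeasurable hA)]
  rfl

section ChartPieces

variable {S : Type*} [TopologicalSpace S] [ChartedSpace (Coord 3) S]
  [SecondCountableTopology S] [Nonempty S]

theorem chartPiece_subset (n : ℕ) :
    chartPiece S n ⊆ (chartAt (Coord 3) (chartCentre S n)).source :=
  disjointed_subset _ _

theorem iUnion_chartPiece : ⋃ n, chartPiece S n = univ := by
  rw [chartPiece, iUnion_disjointed]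
  exact Classical.choose_spec (exists_countable_chart_cover (S := S))

theorem disjoint_chartPiece : Pairwise (Function.onFun Disjoint (chartPiece S)) :=
  disjoint_disjointed _

theorem measurableSet_chartPiece [MeasurableSpace S] [BorelSpace S] (n : ℕ) : MeasurableSet (chartPiece S n) :=
  MeasurableSet.disjointed (fun _ => (OpenPartialHomeomorph.open_source _).measurableSet) n

end ChartPieces

section ChartImages

variable {S : Type*} [TopologicalSpace S] [MeasurableSpace S] [BorelSpace S]

theorem measurableSet_chart_image (e : OpenPartialHomeomorph S (Coord 3)) {A : Set S}
    (hA : MeasurableSet A) : MeasurableSet (e.target ∩ e.symm ⁻¹' A) :=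
  measurableSet_inter_preimage_of_continuousOn e.open_target.measurableSet e.continuousOn_symm hA

theorem aemeasurable_chart_symm (e : OpenPartialHomeomorph S (Coord 3)) {A : Set S} :
    AEMeasurable e.symm (volume.restrict (e.target ∩ e.symm ⁻¹' A)) :=
  (e.continuousOn_symm.aemeasurable e.open_target.measurableSet).mono_set inter_subset_left

end ChartImages

namespace DustSpacetime

variable {M : Type*} [TopologicalSpace M] [ChartedSpace (Coord 4) M] [IsManifold (𝓡 4) ∞ M]
  {S : Type*} [TopologicalSpace S] [ChartedSpace (Coord 3) S] [IsManifold (𝓡 3) ∞ S]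
  (W : DustSpacetime M S) {e e₁ e₂ : OpenPartialHomeomorph S (Coord 3)} {t : ℝ} {x : S}

theorem leafMetric'_joinCoord (y : Coord 3) :
    W.leafMetric' e (joinCoord t y) = W.leafMetric e t y := by
  simp [leafMetric']

theorem det_leafMetric_pos' (he : e ∈ atlas (Coord 3) S) (ht : t ∈ W.I) {y : Coord 3}
    (hy : y ∈ e.target) : 0 < (W.leafMetric e t y).det := by
  rw [← W.leafMetric'_joinCoord]
  exact W.det_leafMetric_pos he (W.joinCoord_mem_adaptedDomain ht hy)

theorem continuousOn_det_leafMetric (he : e ∈ atlas (Coord 3) S) (ht : t ∈ W.I) :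
    ContinuousOn (fun y => (W.leafMetric e t y).det) e.target := by
  simp only [← W.leafMetric'_joinCoord]
  exact (W.smoothMatOn_leafMetric he).det.continuousOn.comp
    (continuous_joinCoord.comp (Continuous.prodMk_right t)).continuousOn
    fun _ hy => W.joinCoord_mem_adaptedDomain ht hy

theorem det_leafMetric_change (he₁ : e₁ ∈ atlas (Coord 3) S) (he₂ : e₂ ∈ atlas (Coord 3) S)
    (hx₁ : x ∈ e₁.source) (hx₂ : x ∈ e₂.source) (ht : t ∈ W.I) :
    (W.leafMetric e₁ t (e₁ x)).det
      = (jacobian (e₂ ∘ e₁.symm) (e₁ x)).det ^ 2 * (W.leafMetric e₂ t (e₂ x)).det := by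
  rw [W.leafMetric_change he₁ he₂ hx₁ hx₂ ht, Matrix.det_mul, Matrix.det_mul, Matrix.det_transpose]
  ring

/-- The ratio of the volume elements of the leaves `Σ_t` and `Σ_0`. -/
def volumeRatio (t : ℝ) (x : S) : ℝ :=
  Real.sqrt ((W.leafMetric (chartAt (Coord 3) x) t (chartAt (Coord 3) x x)).det
    / (W.leafMetric (chartAt (Coord 3) x) 0 (chartAt (Coord 3) x x)).det)

/-- Both determinants acquire the same squared Jacobian determinant under a change of chart, so the
quotient is unaffected. -/
theorem volumeRatio_eq (he : e ∈ atlas (Coord 3) S) (ht : t ∈ W.I) (hx : x ∈ e.source) :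
    W.volumeRatio t x
      = Real.sqrt ((W.leafMetric e t (e x)).det / (W.leafMetric e 0 (e x)).det) := by
  have hc := chart_mem_atlas (Coord 3) x
  have hcx := mem_chart_source (Coord 3) x
  have hu := (isUnit_det_jacobian hc he hcx hx).ne_zero
  rw [volumeRatio, W.det_leafMetric_change hc he hcx hx ht,
    W.det_leafMetric_change hc he hcx hx W.zero_mem_I, mul_div_mul_left _ _ (pow_ne_zero 2 hu)]

theorem volumeRatio_pos (ht : t ∈ W.I) (x : S) : 0 < W.volumeRatio t x := by
  have hc := chart_mem_atlas (Coord 3) x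
  have hy := OpenPartialHomeomorph.map_source _ (mem_chart_source (Coord 3) x)
  exact Real.sqrt_pos.2 (div_pos (W.det_leafMetric_pos' hc ht hy)
    (W.det_leafMetric_pos' hc W.zero_mem_I hy))

theorem continuousOn_volumeRatio :
    ContinuousOn (fun q : ℝ × S => W.volumeRatio q.1 q.2) (W.I ×ˢ univ) := by
  refine W.continuousOn_of_charts (F := fun e q => Real.sqrt ((W.leafMetric' e q).det
    / (W.leafMetric' e (joinCoord 0 (spatial q))).det)) (fun e he => ?_)
    fun _ he _ ht _ hx => by
      rw [W.volumeRatio_eq he ht hx, W.leafMetric'_joinCoord, spatial_joinCoord,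
        W.leafMetric'_joinCoord]
  have h1 := (W.smoothMatOn_leafMetric he).det.continuousOn
  have h2 : MapsTo (fun q => joinCoord 0 (spatial q)) (W.adaptedDomain e) (W.adaptedDomain e) :=
    fun q hq => W.joinCoord_mem_adaptedDomain W.zero_mem_I hq.2
  have h3 : Continuous fun q : Coord 4 => joinCoord 0 (spatial q) :=
    continuous_joinCoord.comp (Continuous.prodMk continuous_const contDiff_spatial.continuous)
  exact Real.continuous_sqrt.comp_continuousOn (h1.div (h1.comp h3.continuousOn h2)
    fun q hq => W.det_leafMetric_ne_zero he _ (h2 hq))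

theorem hasDerivAt_volumeRatio (ht : t ∈ W.I) (x : S) :
    HasDerivAt (fun s => W.volumeRatio s x) (W.theta t x * W.volumeRatio t x) t := by
  have hc := chart_mem_atlas (Coord 3) x
  have hcx := mem_chart_source (Coord 3) x
  have hp := W.volumeRatio_pos ht x
  have h1 := (W.hasDerivAt_det_leafMetric hc ht hcx).div_const
    (W.leafMetric (chartAt (Coord 3) x) 0 (chartAt (Coord 3) x x)).det
  refine (h1.sqrt (Real.sqrt_pos.1 hp).ne').congr_deriv ?_
  have h2 := Real.mul_self_sqrt (Real.sqrt_pos.1 hp).le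
  rw [← volumeRatio] at h2 ⊢
  rw [div_eq_iff (by positivity), mul_div_assoc, ← h2]
  ring

section Measure

variable [MeasurableSpace S] [BorelSpace S]

/-- Change of variables: the factor `|det|` of the transition map is absorbed by `√det h`, because
`det h` scales with the square of that determinant. -/
theorem lintegral_chart_change (he₁ : e₁ ∈ atlas (Coord 3) S) (he₂ : e₂ ∈ atlas (Coord 3) S)
    (ht : t ∈ W.I) {A : Set S} (hA : MeasurableSet A) (hA₁ : A ⊆ e₁.source) (hA₂ : A ⊆ e₂.source) :
    ∫⁻ y in e₂.target ∩ e₂.symm ⁻¹' A, ENNReal.ofReal (Real.sqrt (W.leafMetric e₂ t y).det)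
      = ∫⁻ y in e₁.target ∩ e₁.symm ⁻¹' A, ENNReal.ofReal (Real.sqrt (W.leafMetric e₁ t y).det) := by
  set B := e₁.target ∩ e₁.symm ⁻¹' A with hB
  have hBm : MeasurableSet B := measurableSet_chart_image e₁ hA
  have h1 : (e₂ ∘ e₁.symm) '' B = e₂.target ∩ e₂.symm ⁻¹' A := by
    ext z
    constructor
    · rintro ⟨y, hy, rfl⟩
      exact ⟨e₂.map_source (hA₂ hy.2), by simpa [e₂.left_inv (hA₂ hy.2)] using hy.2⟩
    · rintro ⟨hz, hzA⟩
      refine ⟨e₁ (e₂.symm z), ⟨e₁.map_source (hA₁ hzA), ?_⟩, ?_⟩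
      · simpa [e₁.left_inv (hA₁ hzA)] using hzA
      · simp [e₁.left_inv (hA₁ hzA), e₂.right_inv hz]
  have h2 : InjOn (e₂ ∘ e₁.symm) B := fun y hy z hz hyz =>
    e₁.symm.injOn hy.1 hz.1 (e₂.injOn (hA₂ hy.2) (hA₂ hz.2) hyz)
  have h3 : ∀ y ∈ B, HasFDerivWithinAt (e₂ ∘ e₁.symm) (fderiv ℝ (e₂ ∘ e₁.symm) y) B y := by
    intro y hy
    have h4 : MDifferentiableAt (𝓡 3) (𝓡 3) e₁.symm y :=
      (mdifferentiable_of_mem_atlas he₁).mdifferentiableAt_symm hy.1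
    have h5 : MDifferentiableAt (𝓡 3) (𝓡 3) e₂ (e₁.symm y) :=
      (mdifferentiable_of_mem_atlas he₂).mdifferentiableAt (hA₂ hy.2)
    exact (h5.comp y h4).differentiableAt.hasFDerivAt.hasFDerivWithinAt
  rw [← h1, lintegral_image_eq_lintegral_abs_det_fderiv_mul volume hBm h3 h2]
  refine setLIntegral_congr_fun hBm fun y hy => ?_
  have h6 := W.det_leafMetric_change he₁ he₂ (hA₁ hy.2) (hA₂ hy.2) ht
  rw [e₁.right_inv hy.1] at h6
  simp only [Function.comp] at h6 ⊢
  rw [h6, Real.sqrt_mul (sq_nonneg _), Real.sqrt_sq_eq_abs, ENNReal.ofReal_mul (abs_nonneg _)]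
  congr 3
  exact det_jacobian _ _

variable [SecondCountableTopology S] [Nonempty S]

/-- All leaf volumes become densities against the one fixed measure of the initial leaf. The time
dependence then sits in the integrand, where it can be differentiated. -/
theorem leafVolume_eq_withDensity (ht : t ∈ W.I) :
    W.leafVolume t = (W.leafVolume 0).withDensity fun x => ENNReal.ofReal (W.volumeRatio t x) := by
  have hJ : Measurable fun x => ENNReal.ofReal (W.volumeRatio t x) :=
    ENNReal.measurable_ofReal.comp (continuousOn_univ.1 (W.continuousOn_volumeRatio.comp
      (Continuous.prodMk_right t).continuousOn fun x _ => ⟨ht, mem_univ x⟩)).measurable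
  simp only [leafVolume, riemannianVolume]
  rw [withDensity_sum]
  congr 1
  ext1 n
  set e := chartAt (Coord 3) (chartCentre S n) with he
  have hc : e ∈ atlas (Coord 3) S := chart_mem_atlas _ _
  have hm := aemeasurable_chart_symm e (A := chartPiece S n)
  have hB := measurableSet_chart_image e (measurableSet_chartPiece (S := S) n)
  have h0 : AEMeasurable (fun y => ENNReal.ofReal (Real.sqrt (W.leafMetric e 0 y).det))
      (volume.restrict (e.target ∩ e.symm ⁻¹' chartPiece S n)) :=
    ENNReal.measurable_ofReal.comp_aemeasurable (((Real.continuous_sqrt.comp_continuousOn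
      (W.continuousOn_det_leafMetric hc W.zero_mem_I)).aemeasurable
      e.open_target.measurableSet).mono_set inter_subset_left)
  rw [map_withDensity_comp (hm.mono_ac (withDensity_absolutelyContinuous _ _)) hJ,
    show (fun y => ENNReal.ofReal (W.volumeRatio t (e.symm y)))
      = (fun y => ENNReal.ofReal (W.volumeRatio t y)) ∘ e.symm from rfl,
    ← withDensity_mul₀ h0 (hJ.comp_aemeasurable hm)]
  congr 1
  refine withDensity_congr_ae ((ae_restrict_iff' hB).2 (Filter.Eventually.of_forall fun y hy => ?_))
  have hp := W.det_leafMetric_pos' hc W.zero_mem_I hy.1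
  simp only [Pi.mul_apply, Function.comp_apply]
  rw [W.volumeRatio_eq hc ht (e.map_target hy.1), e.right_inv hy.1,
    ← ENNReal.ofReal_mul (Real.sqrt_nonneg _), ← Real.sqrt_mul hp.le, mul_div_cancel₀ _ hp.ne']

/-- The countable family of charts in the definition is irrelevant: summing `lintegral_chart_change`
over the pieces lets any atlas chart compute the volume. Positivity and local finiteness are
obtained through it. -/
theorem leafVolume_apply_of_subset_source (he : e ∈ atlas (Coord 3) S) (ht : t ∈ W.I) {A : Set S}
    (hA : MeasurableSet A) (hAe : A ⊆ e.source) :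
    W.leafVolume t A
      = ∫⁻ y in e.target ∩ e.symm ⁻¹' A, ENNReal.ofReal (Real.sqrt (W.leafMetric e t y).det) := by
  have h1 : e.target ∩ e.symm ⁻¹' A = ⋃ n, e.target ∩ e.symm ⁻¹' (chartPiece S n ∩ A) := by
    rw [← inter_iUnion, ← preimage_iUnion, ← iUnion_inter, iUnion_chartPiece, univ_inter]
  rw [h1, lintegral_iUnion
    (fun n => measurableSet_chart_image e ((measurableSet_chartPiece n).inter hA))
    (fun i j hij => Disjoint.inter_left' _ (Disjoint.inter_right' _ (Disjoint.preimage _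
      (((disjoint_chartPiece hij).inter_left A).inter_right A))))]
  simp only [leafVolume, riemannianVolume]
  rw [Measure.sum_apply _ hA]
  refine tsum_congr fun n => ?_
  have hn : chartAt (Coord 3) (chartCentre S n) ∈ atlas (Coord 3) S := chart_mem_atlas _ _
  rw [Measure.map_apply_of_aemeasurable ((aemeasurable_chart_symm _).mono_ac
    (withDensity_absolutelyContinuous _ _)) hA, withDensity_apply',
    Measure.restrict_restrict' (measurableSet_chart_image _ (measurableSet_chartPiece n)),
    inter_comm, inter_assoc, ← preimage_inter]
  exact W.lintegral_chart_change he hn ht ((measurableSet_chartPiece n).inter hA)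
    (inter_subset_right.trans hAe) (inter_subset_left.trans (chartPiece_subset n))

theorem leafVolume_pos_of_isOpen (ht : t ∈ W.I) {U : Set S} (hU : IsOpen U) (hne : U.Nonempty) :
    0 < W.leafVolume t U := by
  obtain ⟨x, hx⟩ := hne
  set e := chartAt (Coord 3) x with he
  have hc : e ∈ atlas (Coord 3) S := chart_mem_atlas _ _
  have hx' : x ∈ e.source := mem_chart_source _ x
  refine lt_of_lt_of_le ?_ (measure_mono (inter_subset_left : U ∩ e.source ⊆ U))
  have hV := hU.inter e.open_source
  rw [W.leafVolume_apply_of_subset_source hc ht hV.measurableSet inter_subset_right]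
  have hO : IsOpen (e.target ∩ e.symm ⁻¹' (U ∩ e.source)) := e.isOpen_inter_preimage_symm hV
  rw [pos_iff_ne_zero, Ne, lintegral_eq_zero_iff']
  · intro h
    refine (hO.measure_pos volume ⟨e x, e.map_source hx', ?_⟩).ne' (measure_mono_null (fun y hy => ?_)
      (ae_iff.1 ((ae_restrict_iff' hO.measurableSet).1 h)))
    · simp [e.left_inv hx', hx, hx']
    · have := W.det_leafMetric_pos' hc ht hy.1
      simpa [hy.1, hy.2.1, hy.2.2] using this
  · exact ENNReal.measurable_ofReal.comp_aemeasurable (((Real.continuous_sqrt.comp_continuousOn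
      (W.continuousOn_det_leafMetric hc ht)).aemeasurable
      e.open_target.measurableSet).mono_set inter_subset_left)

theorem isLocallyFiniteMeasure_leafVolume (ht : t ∈ W.I) :
    IsLocallyFiniteMeasure (W.leafVolume t) := by
  refine ⟨fun x => ?_⟩
  set e := chartAt (Coord 3) x with he
  have hc : e ∈ atlas (Coord 3) S := chart_mem_atlas _ _
  have hx : x ∈ e.source := mem_chart_source _ x
  have h1 := (W.continuousOn_det_leafMetric hc ht).continuousAt
    (e.open_target.mem_nhds (e.map_source hx))
  obtain ⟨r, hr, hrt, hrb⟩ : ∃ r > 0, Metric.ball (e x) r ⊆ e.target ∧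
      ∀ y ∈ Metric.ball (e x) r, (W.leafMetric e t y).det < (W.leafMetric e t (e x)).det + 1 := by
    obtain ⟨r, hr, h⟩ := Metric.mem_nhds_iff.1 (Filter.inter_mem
      (e.open_target.mem_nhds (e.map_source hx)) (h1.eventually_lt continuousAt_const (lt_add_one _)))
    exact ⟨r, hr, fun y hy => (h hy).1, fun y hy => (h hy).2⟩
  have hO : IsOpen (e.source ∩ e ⁻¹' Metric.ball (e x) r) :=
    e.isOpen_inter_preimage Metric.isOpen_ball
  refine ⟨_, hO.mem_nhds ⟨hx, Metric.mem_ball_self hr⟩, ?_⟩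
  rw [W.leafVolume_apply_of_subset_source hc ht hO.measurableSet inter_subset_left]
  have hsub : e.target ∩ e.symm ⁻¹' (e.source ∩ e ⁻¹' Metric.ball (e x) r) ⊆ Metric.ball (e x) r := by
    intro y hy
    have := hy.2.2
    rwa [mem_preimage, e.right_inv hy.1] at this
  refine lt_of_le_of_lt (lintegral_mono_set hsub) (lt_of_le_of_lt
    (setLIntegral_mono' (g := fun _ => ENNReal.ofReal (Real.sqrt
      ((W.leafMetric e t (e x)).det + 1))) Metric.isOpen_ball.measurableSet fun y hy =>
        ENNReal.ofReal_le_ofReal (Real.sqrt_le_sqrt (hrb y hy).le)) ?_)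
  rw [setLIntegral_const]
  exact ENNReal.mul_lt_top ENNReal.ofReal_lt_top measure_ball_lt_top

end Measure

end DustSpacetime

/-! ### Integrals over compact sets that depend on a parameter -/

section ParametricIntegral

variable {S : Type*} [TopologicalSpace S] [T2Space S] [MeasurableSpace S] [BorelSpace S]
  {μ : Measure S} [IsFiniteMeasureOnCompacts μ] {D : Set S} {I : Set ℝ} {f f' : ℝ → S → ℝ} {t : ℝ}

theorem exists_bound_of_continuousOn {S : Type*} [TopologicalSpace S] {D : Set S} {I : Set ℝ}
    {f : ℝ → S → ℝ} {t : ℝ} (hD : IsCompact D) (hI : IsOpen I)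
    (hf : ContinuousOn (fun q : ℝ × S => f q.1 q.2) (I ×ˢ univ)) (ht : t ∈ I) :
    ∃ ε > 0, Metric.ball t ε ⊆ I ∧ ∃ C, ∀ s ∈ Metric.ball t ε, ∀ x ∈ D, ‖f s x‖ ≤ C := by
  obtain ⟨ε, hε, hb⟩ := Metric.nhds_basis_closedBall.mem_iff.1 (hI.mem_nhds ht)
  -- A closed time interval times `D` is compact, so a constant dominates the integrand uniformly
  -- for nearby times.
  obtain ⟨C, hC⟩ := ((isCompact_closedBall t ε).prod hD).exists_bound_of_continuousOn
    (hf.mono (prod_mono hb (subset_univ D)))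
  exact ⟨ε, hε, Metric.ball_subset_closedBall.trans hb, C,
    fun s hs x hx => hC (s, x) ⟨Metric.ball_subset_closedBall hs, hx⟩⟩

theorem continuous_slice {S : Type*} [TopologicalSpace S] {I : Set ℝ} {f : ℝ → S → ℝ} {t : ℝ}
    (hf : ContinuousOn (fun q : ℝ × S => f q.1 q.2) (I ×ˢ univ)) (ht : t ∈ I) :
    Continuous (f t) :=
  continuousOn_univ.1 (hf.comp (Continuous.prodMk_right t).continuousOn
    fun x _ => ⟨ht, mem_univ x⟩)

theorem continuousOn_setIntegral (hD : IsCompact D) (hI : IsOpen I)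
    (hf : ContinuousOn (fun q : ℝ × S => f q.1 q.2) (I ×ˢ univ)) :
    ContinuousOn (fun s => ∫ x in D, f s x ∂μ) I := by
  intro t ht
  obtain ⟨ε, hε, hb, C, hC⟩ := exists_bound_of_continuousOn hD hI hf ht
  refine ContinuousAt.continuousWithinAt (continuousAt_of_dominated (bound := fun _ => C) ?_ ?_ ?_ ?_)
  · filter_upwards [hI.mem_nhds ht] with s hs
    exact ((continuous_slice hf hs).continuousOn.integrableOn_compact hD).aestronglyMeasurable
  · filter_upwards [Metric.ball_mem_nhds t hε] with s hs
    exact (ae_restrict_iff' hD.measurableSet).2 (Filter.Eventually.of_forall (hC s hs))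
  · exact continuousOn_const.integrableOn_compact hD
  · refine Filter.Eventually.of_forall fun x => ?_
    exact ContinuousAt.comp (f := fun s => (s, x)) (g := fun q : ℝ × S => f q.1 q.2)
      (hf.continuousAt ((hI.prod isOpen_univ).mem_nhds ⟨ht, mem_univ x⟩))
      (Continuous.prodMk_left x).continuousAt

theorem hasDerivAt_setIntegral (hD : IsCompact D) (hI : IsOpen I)
    (hf : ContinuousOn (fun q : ℝ × S => f q.1 q.2) (I ×ˢ univ))
    (hf' : ContinuousOn (fun q : ℝ × S => f' q.1 q.2) (I ×ˢ univ))
    (h : ∀ s ∈ I, ∀ x, HasDerivAt (fun r => f r x) (f' s x) s) (ht : t ∈ I) :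
    HasDerivAt (fun s => ∫ x in D, f s x ∂μ) (∫ x in D, f' t x ∂μ) t := by
  obtain ⟨ε, hε, hb, C, hC⟩ := exists_bound_of_continuousOn hD hI hf' ht
  refine (hasDerivAt_integral_of_dominated_loc_of_deriv_le (bound := fun _ => C)
    (Metric.ball_mem_nhds t hε) ?_ ((continuous_slice hf ht).continuousOn.integrableOn_compact hD)
    ((continuous_slice hf' ht).continuousOn.integrableOn_compact hD).aestronglyMeasurable ?_
    (continuousOn_const.integrableOn_compact hD) ?_).2
  · filter_upwards [hI.mem_nhds ht] with s hs
    exact ((continuous_slice hf hs).continuousOn.integrableOn_compact hD).aestronglyMeasurable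
  · exact (ae_restrict_iff' hD.measurableSet).2
      (Filter.Eventually.of_forall fun x hx s hs => hC s hs x hx)
  · exact Filter.Eventually.of_forall fun x s hs => h s (hb hs) x

end ParametricIntegral

/-! ### Volume averages and the commutation rule. -/

namespace DustSpacetime

variable {M : Type*} [TopologicalSpace M] [ChartedSpace (Coord 4) M] [IsManifold (𝓡 4) ∞ M]
  {S : Type*} [TopologicalSpace S] [ChartedSpace (Coord 3) S] [IsManifold (𝓡 3) ∞ S]
  (W : DustSpacetime M S) [SecondCountableTopology S] [Nonempty S] [MeasurableSpace S]
  {D : Set S} {ψ χ ψ' : ℝ → S → ℝ} {t : ℝ}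

theorem avg_congr (h : ∀ x, ψ t x = χ t x) : W.avg D ψ t = W.avg D χ t := by
  rw [avg, avg, show ψ t = χ t from funext h]

theorem avg_const_mul (D : Set S) (c : ℝ) (ψ : ℝ → S → ℝ) :
    W.avg D (fun s x => c * ψ s x) t = c * W.avg D ψ t := by
  simp only [avg, setAverage_eq, smul_eq_mul, integral_const_mul]
  ring

variable [BorelSpace S]

theorem leafVolume_lt_top (hD : IsCompact D) (ht : t ∈ W.I) : W.leafVolume t D < ⊤ :=
  have := W.isLocallyFiniteMeasure_leafVolume ht
  hD.measure_lt_top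

theorem leafVolume_pos (hD' : (interior D).Nonempty) (ht : t ∈ W.I) : 0 < W.leafVolume t D :=
  (W.leafVolume_pos_of_isOpen ht isOpen_interior hD').trans_le (measure_mono interior_subset)

theorem avg_const (hD : IsCompact D) (hD' : (interior D).Nonempty) (ht : t ∈ W.I) (c : ℝ) :
    W.avg D (fun _ _ => c) t = c :=
  setAverage_const (W.leafVolume_pos hD' ht).ne' (W.leafVolume_lt_top hD ht).ne c

variable [T2Space S]

theorem integrableOn_of_continuous (hD : IsCompact D) (ht : t ∈ W.I) {f : S → ℝ} (hf : Continuous f) :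
    IntegrableOn f D (W.leafVolume t) :=
  have := W.isLocallyFiniteMeasure_leafVolume ht
  hf.continuousOn.integrableOn_compact hD

/-! #### Algebra of averages -/

theorem avg_add (hD : IsCompact D) (ht : t ∈ W.I) (hψ : Continuous (ψ t)) (hχ : Continuous (χ t)) :
    W.avg D (fun s x => ψ s x + χ s x) t = W.avg D ψ t + W.avg D χ t := by
  simp only [avg, setAverage_eq, smul_eq_mul]
  rw [integral_add (W.integrableOn_of_continuous hD ht hψ) (W.integrableOn_of_continuous hD ht hχ),
    mul_add]

theorem avg_sub (hD : IsCompact D) (ht : t ∈ W.I) (hψ : Continuous (ψ t)) (hχ : Continuous (χ t)) :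
    W.avg D (fun s x => ψ s x - χ s x) t = W.avg D ψ t - W.avg D χ t := by
  simp only [avg, setAverage_eq, smul_eq_mul]
  rw [integral_sub (W.integrableOn_of_continuous hD ht hψ) (W.integrableOn_of_continuous hD ht hχ),
    mul_sub]

/-! #### Evolution of averages -/

theorem setIntegral_leafVolume (hD : IsCompact D) (ht : t ∈ W.I) (f : S → ℝ) :
    ∫ x in D, f x ∂W.leafVolume t = ∫ x in D, f x * W.volumeRatio t x ∂W.leafVolume 0 := by
  have hJ : Measurable fun x => ENNReal.ofReal (W.volumeRatio t x) :=
    ENNReal.measurable_ofReal.comp (continuous_slice W.continuousOn_volumeRatio ht).measurable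
  rw [W.leafVolume_eq_withDensity ht, setIntegral_withDensity_eq_setIntegral_toReal_smul hJ
    (Filter.Eventually.of_forall fun _ => ENNReal.ofReal_lt_top) _ hD.measurableSet]
  simp only [smul_eq_mul, ENNReal.toReal_ofReal (W.volumeRatio_pos ht _).le, mul_comm]

theorem avg_eq_div (hD : IsCompact D) (ht : t ∈ W.I) (ψ : ℝ → S → ℝ) :
    W.avg D ψ t = (∫ x in D, ψ t x * W.volumeRatio t x ∂W.leafVolume 0)
      / ∫ x in D, W.volumeRatio t x ∂W.leafVolume 0 := by
  have h1 := W.setIntegral_leafVolume hD ht fun _ => 1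
  simp only [integral_const, smul_eq_mul, mul_one, one_mul, measureReal_restrict_apply_univ] at h1
  rw [avg, setAverage_eq, smul_eq_mul, W.setIntegral_leafVolume hD ht, h1, inv_mul_eq_div]

theorem integral_volumeRatio_ne_zero (hD : IsCompact D) (hD' : (interior D).Nonempty)
    (ht : t ∈ W.I) : ∫ x in D, W.volumeRatio t x ∂W.leafVolume 0 ≠ 0 := by
  have h1 := W.setIntegral_leafVolume hD ht fun _ => 1
  simp only [integral_const, smul_eq_mul, mul_one, one_mul, measureReal_restrict_apply_univ] at h1
  rw [← h1]
  exact (ENNReal.toReal_pos (W.leafVolume_pos hD' ht).ne' (W.leafVolume_lt_top hD ht).ne).ne'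

theorem continuousOn_avg (hD : IsCompact D) (hD' : (interior D).Nonempty)
    (hψ : ContinuousOn (fun q : ℝ × S => ψ q.1 q.2) (W.I ×ˢ univ)) :
    ContinuousOn (W.avg D ψ) W.I := by
  have := W.isLocallyFiniteMeasure_leafVolume W.zero_mem_I
  refine ContinuousOn.congr (ContinuousOn.div
    (continuousOn_setIntegral (f := fun s x => ψ s x * W.volumeRatio s x) hD W.isOpen_I
      (hψ.mul W.continuousOn_volumeRatio))
    (continuousOn_setIntegral hD W.isOpen_I W.continuousOn_volumeRatio)
    fun s hs => W.integral_volumeRatio_ne_zero hD hD' hs) fun s hs => W.avg_eq_div hD hs ψ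

/-- The commutation rule `⟨ψ⟩˙ = ⟨ψ˙⟩ + ⟨ψΘ⟩ - ⟨ψ⟩⟨Θ⟩`. -/
theorem hasDerivAt_avg (hD : IsCompact D) (hD' : (interior D).Nonempty)
    (hψ : ContinuousOn (fun q : ℝ × S => ψ q.1 q.2) (W.I ×ˢ univ))
    (hψ' : ContinuousOn (fun q : ℝ × S => ψ' q.1 q.2) (W.I ×ˢ univ))
    (h : ∀ s ∈ W.I, ∀ x, HasDerivAt (fun r => ψ r x) (ψ' s x) s) (ht : t ∈ W.I) :
    HasDerivAt (W.avg D ψ) (W.avg D ψ' t + W.cov D ψ W.theta t) t := by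
  have := W.isLocallyFiniteMeasure_leafVolume W.zero_mem_I
  have hJ := W.continuousOn_volumeRatio
  have hθ := W.continuousOn_theta
  have hV := W.integral_volumeRatio_ne_zero hD hD' ht
  -- Quotient rule for numerator and volume. The derivative `∂ₜJ = ΘJ` produces `⟨ψΘ⟩` in the
  -- numerator and `⟨ψ⟩⟨Θ⟩` from the volume.
  have h1 := hasDerivAt_setIntegral (μ := W.leafVolume 0) (f := fun s x => ψ s x * W.volumeRatio s x)
    (f' := fun s x => ψ' s x * W.volumeRatio s x + ψ s x * (W.theta s x * W.volumeRatio s x))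
    hD W.isOpen_I (hψ.mul hJ) ((hψ'.mul hJ).add (hψ.mul (hθ.mul hJ)))
    (fun s hs x => (h s hs x).mul (W.hasDerivAt_volumeRatio hs x)) ht
  have h2 := hasDerivAt_setIntegral (μ := W.leafVolume 0)
    (f' := fun s x => W.theta s x * W.volumeRatio s x) hD W.isOpen_I hJ (hθ.mul hJ)
    (fun s hs x => W.hasDerivAt_volumeRatio hs x) ht
  have h3 := (h1.div h2 hV).congr_of_eventuallyEq
    (Filter.eventually_of_mem (W.isOpen_I.mem_nhds ht) fun s hs => W.avg_eq_div hD hs ψ)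
  refine h3.congr_deriv ?_
  have hint : ∀ {f : S → ℝ}, Continuous f → IntegrableOn f D (W.leafVolume 0) :=
    fun hf => W.integrableOn_of_continuous hD W.zero_mem_I hf
  have cψ := continuous_slice hψ ht
  have cψ' := continuous_slice hψ' ht
  have cJ := continuous_slice hJ ht
  have cθ := continuous_slice hθ ht
  have h4 : ∫ x in D, (ψ' t x * W.volumeRatio t x + ψ t x * (W.theta t x * W.volumeRatio t x))
        ∂W.leafVolume 0 = (∫ x in D, ψ' t x * W.volumeRatio t x ∂W.leafVolume 0)
        + ∫ x in D, ψ t x * (W.theta t x * W.volumeRatio t x) ∂W.leafVolume 0 :=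
    integral_add (hint (cψ'.mul cJ)) (hint (cψ.mul (cθ.mul cJ)))
  rw [h4, cov, W.avg_eq_div hD ht,
    W.avg_eq_div hD ht, W.avg_eq_div hD ht, W.avg_eq_div hD ht]
  simp only [mul_assoc]
  field_simp
  ring

end DustSpacetime

theorem contDiffOn_succ_of_hasDerivAt {f f' : ℝ → ℝ} {I : Set ℝ} (hI : IsOpen I) {n : ℕ}
    (h : ∀ t ∈ I, HasDerivAt f (f' t) t) (hf' : ContDiffOn ℝ n f' I) :
    ContDiffOn ℝ (n + 1) f I := by
  refine (contDiffOn_succ_iff_deriv_of_isOpen hI).2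
    ⟨fun t ht => (h t ht).differentiableAt.differentiableWithinAt, fun hn => ?_,
      hf'.congr fun t ht => (h t ht).deriv⟩
  exact absurd hn (by simp)

theorem contDiffOn_one_of_hasDerivAt {f f' : ℝ → ℝ} {I : Set ℝ} (hI : IsOpen I)
    (h : ∀ t ∈ I, HasDerivAt f (f' t) t) (hf' : ContinuousOn f' I) : ContDiffOn ℝ 1 f I := by
  simpa using contDiffOn_succ_of_hasDerivAt hI (n := 0) h (by simpa using hf')

theorem contDiffOn_two_of_hasDerivAt {f f' : ℝ → ℝ} {I : Set ℝ} (hI : IsOpen I)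
    (h : ∀ t ∈ I, HasDerivAt f (f' t) t) (hf' : ContDiffOn ℝ 1 f' I) : ContDiffOn ℝ 2 f I := by
  have := contDiffOn_succ_of_hasDerivAt hI (n := 1) h (by simpa using hf')
  rw [← one_add_one_eq_two]
  exact_mod_cast this

/-! ### Evolution of the averaged scalars and the effective cosmological equations. -/

namespace DustSpacetime

variable {M : Type*} [TopologicalSpace M] [ChartedSpace (Coord 4) M] [IsManifold (𝓡 4) ∞ M]
  {S : Type*} [TopologicalSpace S] [ChartedSpace (Coord 3) S] [IsManifold (𝓡 3) ∞ S]
  (W : DustSpacetime M S) [SecondCountableTopology S] [Nonempty S] [MeasurableSpace S]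
  {D : Set S} {t : ℝ}

theorem continuous_mu (ht : t ∈ W.I) : Continuous (W.mu D t) := by
  have cθ := continuous_slice W.continuousOn_theta ht
  have cR := continuous_slice W.continuousOn_scalR ht
  unfold mu
  fun_prop

variable [T2Space S] [BorelSpace S]

/-! #### Derivatives of the averaged scalars -/

/-- Conservation of the dust mass in the comoving domain: the average of `-ϱΘ` cancels the term
`⟨ϱΘ⟩` of the commutation rule. -/
theorem hasDerivAt_avg_rho (hD : IsCompact D) (hD' : (interior D).Nonempty) (ht : t ∈ W.I) :
    HasDerivAt (W.avg D W.rho) (-(W.avg D W.rho t * W.avg D W.theta t)) t := by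
  have hρ := W.continuousOn_rho
  have hθ := W.continuousOn_theta
  refine (W.hasDerivAt_avg (ψ' := fun s x => (-1) * (W.rho s x * W.theta s x)) hD hD' hρ
    (continuousOn_const.mul (hρ.mul hθ))
    (fun s hs x => (W.hasDerivAt_rho hs x).congr_deriv (by ring)) ht).congr_deriv ?_
  rw [W.avg_const_mul, cov]
  ring

/-- The term `-⟨Θ²⟩` from the pointwise equation cancels the `⟨Θ²⟩` of the commutation rule, so the
rate involves averages of `ϱ`, `ℛ` and `Θ` only. -/
theorem hasDerivAt_avg_theta (hD : IsCompact D) (hD' : (interior D).Nonempty) (ht : t ∈ W.I) :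
    HasDerivAt (W.avg D W.theta) (3 / 2 * W.avg D W.rho t + 3 * W.Λ - W.avg D W.scalR t
      - W.avg D W.theta t ^ 2) t := by
  have hρ := W.continuousOn_rho
  have hθ := W.continuousOn_theta
  have hR := W.continuousOn_scalR
  have cρ := continuous_slice hρ ht
  have cθ := continuous_slice hθ ht
  have cR := continuous_slice hR ht
  refine (W.hasDerivAt_avg hD hD' hθ
    ((((continuousOn_const.mul hρ).add continuousOn_const).sub (hθ.pow 2)).sub hR)
    (fun s hs x => W.hasDerivAt_theta hs x) ht).congr_deriv ?_
  rw [W.avg_sub hD ht (by fun_prop) (by fun_prop), W.avg_sub hD ht (by fun_prop) (by fun_prop),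
    W.avg_add hD ht (by fun_prop) (by fun_prop), W.avg_const_mul, W.avg_const hD hD' ht, cov]
  simp only [pow_two]
  ring

theorem hasDerivAt_avg_scalR (hD : IsCompact D) (hD' : (interior D).Nonempty) (ht : t ∈ W.I) :
    HasDerivAt (W.avg D W.scalR) (-W.avg D W.nu t
      + 1 / 3 * W.avg D (fun s x => W.scalR s x * W.theta s x) t
      - W.avg D W.scalR t * W.avg D W.theta t) t := by
  have hν := W.continuousOn_nu
  have hθ := W.continuousOn_theta
  have hR := W.continuousOn_scalR
  have cν := continuous_slice hν ht
  have cθ := continuous_slice hθ ht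
  have cR := continuous_slice hR ht
  refine (W.hasDerivAt_avg
    (ψ' := fun s x => -1 * W.nu s x - 2 / 3 * (W.scalR s x * W.theta s x)) hD hD' hR
    ((continuousOn_const.mul hν).sub (continuousOn_const.mul (hR.mul hθ)))
    (fun s hs x => (W.hasDerivAt_scalR hs x).congr_deriv (by ring)) ht).congr_deriv ?_
  rw [W.avg_sub hD ht (by fun_prop) (by fun_prop), W.avg_const_mul, W.avg_const_mul, cov]
  ring

theorem hasDerivAt_avg_nu (hD : IsCompact D) (hD' : (interior D).Nonempty) (ht : t ∈ W.I) :
    HasDerivAt (W.avg D W.nu) (W.avg D W.kappa t - 4 * W.avg D W.tauSq t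
      - W.avg D W.nu t * W.avg D W.theta t) t := by
  have hν := W.continuousOn_nu
  have hθ := W.continuousOn_theta
  have hκ := W.continuousOn_kappa
  have hτ := W.continuousOn_tauSq
  have cν := continuous_slice hν ht
  have cθ := continuous_slice hθ ht
  have cκ := continuous_slice hκ ht
  have cτ := continuous_slice hτ ht
  refine (W.hasDerivAt_avg hD hD' hν ((hκ.sub (hν.mul hθ)).sub (continuousOn_const.mul hτ))
    (fun s hs x => W.hasDerivAt_nu hs x) ht).congr_deriv ?_
  rw [W.avg_sub hD ht (by fun_prop) (by fun_prop), W.avg_sub hD ht (by fun_prop) (by fun_prop),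
    W.avg_const_mul, cov]
  ring

/-- Needed for `⟨μ⟩`, which is a covariance of `ℛ` and `Θ`. The pointwise rate contains `-5/3 ℛΘ²`,
with `2/3` from `∂ₜℛ` and `1` from `∂ₜΘ`; the commutation rule gives one unit back, leaving `-2/3`.
-/
theorem hasDerivAt_avg_scalR_mul_theta (hD : IsCompact D) (hD' : (interior D).Nonempty)
    (ht : t ∈ W.I) :
    HasDerivAt (W.avg D fun s x => W.scalR s x * W.theta s x)
      (-W.avg D (fun s x => W.nu s x * W.theta s x) t
        - 2 / 3 * W.avg D (fun s x => W.scalR s x * W.theta s x ^ 2) t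
        + 3 / 2 * W.avg D (fun s x => W.rho s x * W.scalR s x) t + 3 * W.Λ * W.avg D W.scalR t
        - W.avg D (fun s x => W.scalR s x ^ 2) t
        - W.avg D (fun s x => W.scalR s x * W.theta s x) t * W.avg D W.theta t) t := by
  have hν := W.continuousOn_nu
  have hθ := W.continuousOn_theta
  have hρ := W.continuousOn_rho
  have hR := W.continuousOn_scalR
  have cν := continuous_slice hν ht
  have cθ := continuous_slice hθ ht
  have cρ := continuous_slice hρ ht
  have cR := continuous_slice hR ht
  refine (W.hasDerivAt_avg (ψ := fun s x => W.scalR s x * W.theta s x)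
    (ψ' := fun s x => -1 * (W.nu s x * W.theta s x)
      - 5 / 3 * (W.scalR s x * W.theta s x ^ 2) + 3 / 2 * (W.rho s x * W.scalR s x)
      + 3 * W.Λ * W.scalR s x - W.scalR s x ^ 2) hD hD' (hR.mul hθ)
    (((((continuousOn_const.mul (hν.mul hθ)).sub (continuousOn_const.mul (hR.mul (hθ.pow 2)))).add
      (continuousOn_const.mul (hρ.mul hR))).add (continuousOn_const.mul hR)).sub (hR.pow 2))
    (fun s hs x => ((W.hasDerivAt_scalR hs x).mul (W.hasDerivAt_theta hs x)).congr_deriv (by ring))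
    ht).congr_deriv ?_
  rw [W.avg_sub hD ht (by fun_prop) (by fun_prop), W.avg_add hD ht (by fun_prop) (by fun_prop),
    W.avg_add hD ht (by fun_prop) (by fun_prop), W.avg_sub hD ht (by fun_prop) (by fun_prop),
    W.avg_const_mul, W.avg_const_mul, W.avg_const_mul, W.avg_const_mul, cov,
    W.avg_congr (ψ := fun s x => W.scalR s x * W.theta s x * W.theta s x)
      (χ := fun s x => W.scalR s x * W.theta s x ^ 2) fun x => by ring]
  ring

/-! #### The averaged constraint, and the averages of `μ` -/

/-- The averaged Hamiltonian constraint: `⟨Θ²⟩` and `⟨σ²⟩` occur in it exactly in the combination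
that defines `Q`. -/
theorem backreaction_eq (hD : IsCompact D) (hD' : (interior D).Nonempty) (ht : t ∈ W.I) :
    W.backreaction D t = 2 * W.avg D W.rho t + 2 * W.Λ - W.avg D W.scalR t
      - 2 / 3 * W.avg D W.theta t ^ 2 := by
  have cρ := continuous_slice W.continuousOn_rho ht
  have cθ := continuous_slice W.continuousOn_theta ht
  have cR := continuous_slice W.continuousOn_scalR ht
  have cσ := continuous_slice W.continuousOn_sigmaSq ht
  have h1 : W.avg D (fun s x => W.scalR s x + 2 / 3 * W.theta s x ^ 2 - 2 * W.sigmaSq s x) t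
      = W.avg D (fun s x => 2 * W.rho s x + 2 * W.Λ) t := W.avg_congr (W.hamiltonian ht)
  rw [W.avg_sub hD ht (by fun_prop) (by fun_prop), W.avg_add hD ht (by fun_prop) (by fun_prop),
    W.avg_add hD ht (by fun_prop) (by fun_prop), W.avg_const_mul, W.avg_const_mul, W.avg_const_mul,
    W.avg_const hD hD' ht] at h1
  rw [backreaction]
  linarith

/-- On a leaf `⟨Θ⟩` is a constant, so `⟨(Θ - ⟨Θ⟩)ℛ⟩` is the covariance. -/
theorem avg_mu (hD : IsCompact D) (ht : t ∈ W.I) :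
    W.avg D (W.mu D) t = -(1 / 3) * (W.avg D (fun s x => W.scalR s x * W.theta s x) t
      - W.avg D W.scalR t * W.avg D W.theta t) := by
  have cθ := continuous_slice W.continuousOn_theta ht
  have cR := continuous_slice W.continuousOn_scalR ht
  rw [W.avg_congr (ψ := W.mu D) (χ := fun s x => -(1 / 3) * (W.scalR s x * W.theta s x
    - W.avg D W.theta t * W.scalR s x)) fun x => by rw [mu]; ring, W.avg_const_mul,
    W.avg_sub hD ht (by fun_prop) (by fun_prop), W.avg_const_mul]
  ring

theorem avg_mu_mul_theta (hD : IsCompact D) (ht : t ∈ W.I) :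
    W.avg D (fun s x => W.mu D s x * W.theta s x) t
      = -(1 / 3) * (W.avg D (fun s x => W.scalR s x * W.theta s x ^ 2) t
        - W.avg D (fun s x => W.scalR s x * W.theta s x) t * W.avg D W.theta t) := by
  have cθ := continuous_slice W.continuousOn_theta ht
  have cR := continuous_slice W.continuousOn_scalR ht
  rw [W.avg_congr (ψ := fun s x => W.mu D s x * W.theta s x)
    (χ := fun s x => -(1 / 3) * (W.scalR s x * W.theta s x ^ 2
    - W.avg D W.theta t * (W.scalR s x * W.theta s x))) fun x => by rw [mu]; ring, W.avg_const_mul,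
    W.avg_sub hD ht (by fun_prop) (by fun_prop), W.avg_const_mul]
  ring

/-! #### The averaged dynamics -/

theorem hasDerivAt_hubble (hD : IsCompact D) (hD' : (interior D).Nonempty) (ht : t ∈ W.I) :
    HasDerivAt (W.hubble D) (1 / 3 * (3 / 2 * W.avg D W.rho t + 3 * W.Λ - W.avg D W.scalR t
      - W.avg D W.theta t ^ 2)) t :=
  (W.hasDerivAt_avg_theta hD hD' ht).const_mul _

/-- The covariance form of `⟨μ⟩` is differentiated rather than `μ`, which would bring in the time
dependence of the average inside it. The two `Λ` terms cancel. -/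
theorem hasDerivAt_avg_mu (hD : IsCompact D) (hD' : (interior D).Nonempty) (ht : t ∈ W.I) :
    HasDerivAt (W.avg D (W.mu D)) (-(1 / 3) *
      ((-W.avg D (fun s x => W.nu s x * W.theta s x) t
        - 2 / 3 * W.avg D (fun s x => W.scalR s x * W.theta s x ^ 2) t
        + 3 / 2 * W.avg D (fun s x => W.rho s x * W.scalR s x) t + 3 * W.Λ * W.avg D W.scalR t
        - W.avg D (fun s x => W.scalR s x ^ 2) t
        - W.avg D (fun s x => W.scalR s x * W.theta s x) t * W.avg D W.theta t)
      - ((-W.avg D W.nu t + 1 / 3 * W.avg D (fun s x => W.scalR s x * W.theta s x) t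
        - W.avg D W.scalR t * W.avg D W.theta t) * W.avg D W.theta t
        + W.avg D W.scalR t * (3 / 2 * W.avg D W.rho t + 3 * W.Λ - W.avg D W.scalR t
      - W.avg D W.theta t ^ 2)))) t :=
  (((W.hasDerivAt_avg_scalR_mul_theta hD hD' ht).sub ((W.hasDerivAt_avg_scalR hD hD' ht).mul
    (W.hasDerivAt_avg_theta hD hD' ht))).const_mul _).congr_of_eventuallyEq
    (Filter.eventually_of_mem (W.isOpen_I.mem_nhds ht) fun _ hs => W.avg_mu hD hs)

/-- The curvature part of the integrability condition, `⟨ℛ⟩˙ + 2 H ⟨ℛ⟩ = -⟨ν⟩ - ⟨μ⟩`. -/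
theorem hasDerivAt_avg_scalR' (hD : IsCompact D) (hD' : (interior D).Nonempty) (ht : t ∈ W.I) :
    HasDerivAt (W.avg D W.scalR) (-W.avg D W.nu t - W.avg D (W.mu D) t
      - 2 * W.hubble D t * W.avg D W.scalR t) t := by
  refine (W.hasDerivAt_avg_scalR hD hD' ht).congr_deriv ?_
  rw [W.avg_mu hD ht, hubble]
  ring

/-- The integrability condition `Q˙ + 6 H Q = ⟨ν⟩ + ⟨μ⟩`. -/
theorem hasDerivAt_backreaction (hD : IsCompact D) (hD' : (interior D).Nonempty) (ht : t ∈ W.I) :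
    HasDerivAt (W.backreaction D) (W.avg D W.nu t + W.avg D (W.mu D) t
      - 6 * W.hubble D t * W.backreaction D t) t := by
  -- The averaged constraint is differentiated instead of the definition of `Q`, so no rate of
  -- `⟨Θ²⟩` or `⟨σ²⟩` is needed.
  have h1 := ((((W.hasDerivAt_avg_rho hD hD' ht).const_mul 2).add_const (2 * W.Λ)).sub
    (W.hasDerivAt_avg_scalR' hD hD' ht)).sub
    (((W.hasDerivAt_avg_theta hD hD' ht).pow 2).const_mul (2 / 3))
  refine (h1.congr_of_eventuallyEq (Filter.eventually_of_mem (W.isOpen_I.mem_nhds ht)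
    fun s hs => W.backreaction_eq hD hD' hs)).congr_deriv ?_
  rw [W.backreaction_eq hD hD' ht, hubble]
  push_cast
  ring

/-- The first Friedmann equation is the averaged Hamiltonian constraint: inserting it into the
effective density leaves `⟨Θ⟩²/3 - Λ`. -/
theorem rhoEff_eq (hD : IsCompact D) (hD' : (interior D).Nonempty) (ht : t ∈ W.I) :
    W.rhoEff D t = 3 * W.hubble D t ^ 2 - W.Λ := by
  rw [rhoEff, W.backreaction_eq hD hD' ht, hubble]
  ring

theorem hasDerivAt_rhoEff (hD : IsCompact D) (hD' : (interior D).Nonempty) (ht : t ∈ W.I) :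
    HasDerivAt (W.rhoEff D) (6 * W.hubble D t * (1 / 3 * (3 / 2 * W.avg D W.rho t + 3 * W.Λ
      - W.avg D W.scalR t - W.avg D W.theta t ^ 2))) t := by
  refine ((((W.hasDerivAt_hubble hD hD' ht).pow 2).const_mul 3).sub_const
    W.Λ |>.congr_of_eventuallyEq (Filter.eventually_of_mem (W.isOpen_I.mem_nhds ht)
    fun _ hs => W.rhoEff_eq hD hD' hs)).congr_deriv ?_
  push_cast
  ring

theorem raychaudhuri (hD : IsCompact D) (hD' : (interior D).Nonempty) (ht : t ∈ W.I) :
    3 * deriv (W.hubble D) t = -(3 / 2) * (W.rhoEff D t + W.pEff D t) := by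
  rw [(W.hasDerivAt_hubble hD hD' ht).deriv, W.rhoEff_eq hD hD' ht, pEff,
    W.backreaction_eq hD hD' ht, hubble]
  ring

/-! #### Regularity of the averages -/

theorem contDiffOn_avg_rho (hD : IsCompact D) (hD' : (interior D).Nonempty) :
    ContDiffOn ℝ 1 (W.avg D W.rho) W.I :=
  contDiffOn_one_of_hasDerivAt W.isOpen_I (fun _ ht => W.hasDerivAt_avg_rho hD hD' ht)
    ((W.continuousOn_avg hD hD' W.continuousOn_rho).mul
      (W.continuousOn_avg hD hD' W.continuousOn_theta)).neg

theorem contDiffOn_avg_nu (hD : IsCompact D) (hD' : (interior D).Nonempty) :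
    ContDiffOn ℝ 1 (W.avg D W.nu) W.I :=
  contDiffOn_one_of_hasDerivAt W.isOpen_I (fun _ ht => W.hasDerivAt_avg_nu hD hD' ht)
    (((W.continuousOn_avg hD hD' W.continuousOn_kappa).sub (continuousOn_const.mul
      (W.continuousOn_avg hD hD' W.continuousOn_tauSq))).sub
      ((W.continuousOn_avg hD hD' W.continuousOn_nu).mul
      (W.continuousOn_avg hD hD' W.continuousOn_theta)))

theorem contDiffOn_avg_scalR_mul_theta (hD : IsCompact D) (hD' : (interior D).Nonempty) :
    ContDiffOn ℝ 1 (W.avg D fun s x => W.scalR s x * W.theta s x) W.I := by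
  have hν := W.continuousOn_nu
  have hθ := W.continuousOn_theta
  have hρ := W.continuousOn_rho
  have hR := W.continuousOn_scalR
  refine contDiffOn_one_of_hasDerivAt W.isOpen_I
    (fun _ ht => W.hasDerivAt_avg_scalR_mul_theta hD hD' ht) ?_
  have h1 := W.continuousOn_avg hD hD' (ψ := fun s x => W.nu s x * W.theta s x) (hν.mul hθ)
  have h2 := W.continuousOn_avg hD hD' (ψ := fun s x => W.scalR s x * W.theta s x ^ 2)
    (hR.mul (hθ.pow 2))
  have h3 := W.continuousOn_avg hD hD' (ψ := fun s x => W.rho s x * W.scalR s x) (hρ.mul hR)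
  have h4 := W.continuousOn_avg hD hD' hR
  have h5 := W.continuousOn_avg hD hD' (ψ := fun s x => W.scalR s x ^ 2) (hR.pow 2)
  have h6 := W.continuousOn_avg hD hD' (ψ := fun s x => W.scalR s x * W.theta s x) (hR.mul hθ)
  have h7 := W.continuousOn_avg hD hD' hθ
  exact ((((h1.neg.sub (continuousOn_const.mul h2)).add (continuousOn_const.mul h3)).add
    (continuousOn_const.mul h4)).sub h5).sub (h6.mul h7)

theorem contDiffOn_avg_theta (hD : IsCompact D) (hD' : (interior D).Nonempty) :
    ContDiffOn ℝ 1 (W.avg D W.theta) W.I :=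
  contDiffOn_one_of_hasDerivAt W.isOpen_I (fun _ ht => W.hasDerivAt_avg_theta hD hD' ht)
    ((((continuousOn_const.mul (W.continuousOn_avg hD hD' W.continuousOn_rho)).add
      continuousOn_const).sub (W.continuousOn_avg hD hD' W.continuousOn_scalR)).sub
      ((W.continuousOn_avg hD hD' W.continuousOn_theta).pow 2))

theorem contDiffOn_hubble (hD : IsCompact D) (hD' : (interior D).Nonempty) :
    ContDiffOn ℝ 1 (W.hubble D) W.I :=
  contDiffOn_const.mul (W.contDiffOn_avg_theta hD hD')

theorem contDiffOn_avg_scalR_one (hD : IsCompact D) (hD' : (interior D).Nonempty) :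
    ContDiffOn ℝ 1 (W.avg D W.scalR) W.I :=
  contDiffOn_one_of_hasDerivAt W.isOpen_I (fun _ ht => W.hasDerivAt_avg_scalR hD hD' ht)
    (((W.contDiffOn_avg_nu hD hD').continuousOn.neg.add (continuousOn_const.mul
      (W.contDiffOn_avg_scalR_mul_theta hD hD').continuousOn)).sub
      ((W.continuousOn_avg hD hD' W.continuousOn_scalR).mul
      (W.continuousOn_avg hD hD' W.continuousOn_theta)))

/-- Bootstrap: the first derivative is a polynomial in averages already known to be `C¹`. -/
theorem contDiffOn_avg_scalR (hD : IsCompact D) (hD' : (interior D).Nonempty) :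
    ContDiffOn ℝ 2 (W.avg D W.scalR) W.I :=
  contDiffOn_two_of_hasDerivAt W.isOpen_I (fun _ ht => W.hasDerivAt_avg_scalR hD hD' ht)
    (((W.contDiffOn_avg_nu hD hD').neg.add (contDiffOn_const.mul
      (W.contDiffOn_avg_scalR_mul_theta hD hD'))).sub
      ((W.contDiffOn_avg_scalR_one hD hD').mul (W.contDiffOn_avg_theta hD hD')))

theorem contDiffOn_two_hubble (hD : IsCompact D) (hD' : (interior D).Nonempty) :
    ContDiffOn ℝ 2 (W.hubble D) W.I :=
  contDiffOn_two_of_hasDerivAt W.isOpen_I (fun _ ht => W.hasDerivAt_hubble hD hD' ht)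
    (contDiffOn_const.mul ((((contDiffOn_const.mul (W.contDiffOn_avg_rho hD hD')).add
      contDiffOn_const).sub (W.contDiffOn_avg_scalR_one hD hD')).sub
      ((W.contDiffOn_avg_theta hD hD').pow 2)))

theorem contDiffOn_avg_mu (hD : IsCompact D) (hD' : (interior D).Nonempty) :
    ContDiffOn ℝ 1 (W.avg D (W.mu D)) W.I :=
  (contDiffOn_const.mul ((W.contDiffOn_avg_scalR_mul_theta hD hD').sub
    ((W.contDiffOn_avg_scalR_one hD hD').mul (W.contDiffOn_avg_theta hD hD')))).congr
    fun _ ht => W.avg_mu hD ht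

theorem contDiffOn_backreaction (hD : IsCompact D) (hD' : (interior D).Nonempty) :
    ContDiffOn ℝ 2 (W.backreaction D) W.I := by
  have h1 : ContDiffOn ℝ 1 (W.backreaction D) W.I :=
    ((((contDiffOn_const.mul (W.contDiffOn_avg_rho hD hD')).add contDiffOn_const).sub
      (W.contDiffOn_avg_scalR_one hD hD')).sub
      (contDiffOn_const.mul ((W.contDiffOn_avg_theta hD hD').pow 2))).congr
      fun _ ht => W.backreaction_eq hD hD' ht
  exact contDiffOn_two_of_hasDerivAt W.isOpen_I (fun _ ht => W.hasDerivAt_backreaction hD hD' ht)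
    (((W.contDiffOn_avg_nu hD hD').add (W.contDiffOn_avg_mu hD hD')).sub
      ((contDiffOn_const.mul (W.contDiffOn_hubble hD hD')).mul h1))

theorem contDiffOn_rhoEff (hD : IsCompact D) (hD' : (interior D).Nonempty) :
    ContDiffOn ℝ 1 (W.rhoEff D) W.I :=
  ((contDiffOn_const.mul ((W.contDiffOn_hubble hD hD').pow 2)).sub contDiffOn_const).congr
    fun _ ht => W.rhoEff_eq hD hD' ht

/-! #### The second-order equations -/

/-- The time derivative of the integrability condition, which holds throughout the open set `I`; the
product rule on `6HQ` accounts for both `H` terms. -/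
theorem deriv_deriv_backreaction (hD : IsCompact D) (hD' : (interior D).Nonempty) (ht : t ∈ W.I) :
    deriv (deriv (W.backreaction D)) t + 6 * W.hubble D t * deriv (W.backreaction D) t
        + 6 * deriv (W.hubble D) t * W.backreaction D t
      = deriv (W.avg D W.nu) t + deriv (W.avg D (W.mu D)) t := by
  have h1 := (((W.hasDerivAt_avg_nu hD hD' ht).add (W.hasDerivAt_avg_mu hD hD' ht)).sub
    (((W.hasDerivAt_hubble hD hD' ht).const_mul 6).mul
      (W.hasDerivAt_backreaction hD hD' ht))).congr_of_eventuallyEq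
    (f₁ := deriv (W.backreaction D)) (Filter.eventually_of_mem (W.isOpen_I.mem_nhds ht)
      fun s hs => (W.hasDerivAt_backreaction hD hD' hs).deriv)
  rw [h1.deriv, (W.hasDerivAt_backreaction hD hD' ht).deriv, (W.hasDerivAt_hubble hD hD' ht).deriv,
    (W.hasDerivAt_avg_nu hD hD' ht).deriv, (W.hasDerivAt_avg_mu hD hD' ht).deriv]
  ring

theorem deriv_deriv_avg_scalR (hD : IsCompact D) (hD' : (interior D).Nonempty) (ht : t ∈ W.I) :
    -(deriv (deriv (W.avg D W.scalR)) t + 2 * W.hubble D t * deriv (W.avg D W.scalR) t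
        + 2 * deriv (W.hubble D) t * W.avg D W.scalR t)
      = deriv (W.avg D W.nu) t + deriv (W.avg D (W.mu D)) t := by
  have h1 := (((W.hasDerivAt_avg_nu hD hD' ht).neg.sub (W.hasDerivAt_avg_mu hD hD' ht)).sub
    (((W.hasDerivAt_hubble hD hD' ht).const_mul 2).mul
      (W.hasDerivAt_avg_scalR' hD hD' ht))).congr_of_eventuallyEq
    (f₁ := deriv (W.avg D W.scalR)) (Filter.eventually_of_mem (W.isOpen_I.mem_nhds ht)
      fun s hs => (W.hasDerivAt_avg_scalR' hD hD' hs).deriv)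
  rw [h1.deriv, (W.hasDerivAt_avg_scalR' hD hD' ht).deriv, (W.hasDerivAt_hubble hD hD' ht).deriv,
    (W.hasDerivAt_avg_nu hD hD' ht).deriv, (W.hasDerivAt_avg_mu hD hD' ht).deriv]
  ring

/-- In the rate of `⟨μ⟩`, the terms `ϱ` and `-ℛ` of `∂ₜΘ` give the covariance of `ϱ` and `ℛ` and the
variance of `ℛ`, while `-ν` in `∂ₜℛ` gives `⟨νΘ⟩/3`. The rate of `⟨ν⟩` contributes `⟨κ⟩` and
`-4⟨τ²⟩`, which completes the curvature backreaction. -/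
theorem deriv_avg_nu_add_deriv_avg_mu (hD : IsCompact D) (hD' : (interior D).Nonempty)
    (ht : t ∈ W.I) :
    deriv (W.avg D W.nu) t + deriv (W.avg D (W.mu D)) t
      = -3 * W.hubble D t * W.avg D W.nu t + (1 / 3) * W.cov D W.nu W.theta t
        - 8 * W.hubble D t * W.avg D (W.mu D) t - (2 / 3) * W.cov D (W.mu D) W.theta t
        + W.curvBackreaction D t - (1 / 2) * W.cov D W.rho W.scalR t + W.avg D W.kappa t := by
  rw [(W.hasDerivAt_avg_nu hD hD' ht).deriv, (W.hasDerivAt_avg_mu hD hD' ht).deriv, cov, cov, cov,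
    W.avg_mu_mul_theta hD ht, W.avg_mu hD ht, curvBackreaction, hubble]
  ring

end DustSpacetime

end DustCosmology

end

theorem mainTheorem8
    {M : Type*} [TopologicalSpace M] [ChartedSpace (DustCosmology.Coord 4) M]
    [IsManifold (𝓡 4) ∞ M]
    {S : Type*} [TopologicalSpace S] [T2Space S] [SecondCountableTopology S] [Nonempty S]
    [ChartedSpace (DustCosmology.Coord 3) S] [IsManifold (𝓡 3) ∞ S]
    [MeasurableSpace S] [BorelSpace S]
    (W : DustCosmology.DustSpacetime M S)
    (D : Set S) (hD : IsCompact D) (hD' : (interior D).Nonempty) :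
    -- all averages below are averages of integrable functions over a domain of
    -- finite positive volume
    (∀ t ∈ W.I, 0 < W.leafVolume t D ∧ W.leafVolume t D < ⊤ ∧
      ∀ ψ ∈ ({W.rho, W.theta, W.scalR, W.sigmaSq, W.tauSq, W.nu, W.kappa, W.mu D,
          fun s x => W.theta s x ^ 2, fun s x => W.scalR s x ^ 2,
          fun s x => W.nu s x * W.theta s x, fun s x => W.mu D s x * W.theta s x,
          fun s x => W.rho s x * W.scalR s x} : Set (ℝ → S → ℝ)),
        IntegrableOn (ψ t) D (W.leafVolume t)) ∧
    -- the time derivatives below exist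
    ContDiffOn ℝ 2 (W.backreaction D) W.I ∧ ContDiffOn ℝ 2 (W.avg D W.scalR) W.I ∧
    ContDiffOn ℝ 2 (W.hubble D) W.I ∧ ContDiffOn ℝ 1 (W.rhoEff D) W.I ∧
    ContDiffOn ℝ 1 (W.avg D W.nu) W.I ∧ ContDiffOn ℝ 1 (W.avg D (W.mu D)) W.I ∧
    ∀ t ∈ W.I,
      -- the second-order evolution equations
      deriv (deriv (W.backreaction D)) t + 6 * W.hubble D t * deriv (W.backreaction D) t
          + 6 * deriv (W.hubble D) t * W.backreaction D t
        = -(deriv (deriv (W.avg D W.scalR)) t + 2 * W.hubble D t * deriv (W.avg D W.scalR) t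
          + 2 * deriv (W.hubble D) t * W.avg D W.scalR t) ∧
      -(deriv (deriv (W.avg D W.scalR)) t + 2 * W.hubble D t * deriv (W.avg D W.scalR) t
          + 2 * deriv (W.hubble D) t * W.avg D W.scalR t)
        = deriv (W.avg D W.nu) t + deriv (W.avg D (W.mu D)) t ∧
      deriv (W.avg D W.nu) t + deriv (W.avg D (W.mu D)) t
        = -3 * W.hubble D t * W.avg D W.nu t + (1 / 3) * W.cov D W.nu W.theta t
          - 8 * W.hubble D t * W.avg D (W.mu D) t - (2 / 3) * W.cov D (W.mu D) W.theta t
          + W.curvBackreaction D t - (1 / 2) * W.cov D W.rho W.scalR t + W.avg D W.kappa t ∧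
      -- the averaged dynamics of the volume Hubble rate
      3 * W.hubble D t ^ 2 = W.rhoEff D t + W.Λ ∧
      3 * deriv (W.hubble D) t = -(3 / 2) * (W.rhoEff D t + W.pEff D t) ∧
      deriv (W.rhoEff D) t + 3 * W.hubble D t * (W.rhoEff D t + W.pEff D t) = 0 := by
  refine ⟨fun t ht => ⟨W.leafVolume_pos hD' ht, W.leafVolume_lt_top hD ht, fun ψ hψ =>
    W.integrableOn_of_continuous hD ht ?_⟩, W.contDiffOn_backreaction hD hD',
    W.contDiffOn_avg_scalR hD hD', W.contDiffOn_two_hubble hD hD', W.contDiffOn_rhoEff hD hD',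
    W.contDiffOn_avg_nu hD hD', W.contDiffOn_avg_mu hD hD', fun t ht => ⟨?_, ?_, ?_, ?_, ?_, ?_⟩⟩
  · have cρ := DustCosmology.continuous_slice W.continuousOn_rho ht
    have cθ := DustCosmology.continuous_slice W.continuousOn_theta ht
    have cR := DustCosmology.continuous_slice W.continuousOn_scalR ht
    have cσ := DustCosmology.continuous_slice W.continuousOn_sigmaSq ht
    have cτ := DustCosmology.continuous_slice W.continuousOn_tauSq ht
    have cν := DustCosmology.continuous_slice W.continuousOn_nu ht
    have cκ := DustCosmology.continuous_slice W.continuousOn_kappa ht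
    have cμ := W.continuous_mu (D := D) ht
    simp only [mem_insert_iff, mem_singleton_iff] at hψ
    rcases hψ with rfl | rfl | rfl | rfl | rfl | rfl | rfl | rfl | rfl | rfl | rfl | rfl | rfl <;>
      fun_prop
  · rw [W.deriv_deriv_backreaction hD hD' ht, W.deriv_deriv_avg_scalR hD hD' ht]
  · exact W.deriv_deriv_avg_scalR hD hD' ht
  · exact W.deriv_avg_nu_add_deriv_avg_mu hD hD' ht
  · rw [W.rhoEff_eq hD hD' ht, sub_add_cancel]
  · exact W.raychaudhuri hD hD' ht
  · have h1 := W.raychaudhuri hD hD' ht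
    rw [(W.hasDerivAt_hubble hD hD' ht).deriv] at h1
    rw [(W.hasDerivAt_rhoEff hD hD' ht).deriv]
    -- As the effective density is `3H² - Λ`, its rate is `6HH˙`, so the continuity equation is `2H`
    -- times the Raychaudhuri equation.
    linear_combination 2 * W.hubble D t * h1
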